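/- Let $W$ be one of the complex cubic Jordan algebras attached to the complex simple Lie groups $G$ not of type $A_\ell$, $C_\ell$, with its cubic form $\mathfrak{C}\in S^3W^*$, that is (up to linear isomorphism): $W=\mathbb{C}$ with $\mathfrak{C}(t^3)=t^3/3$ ($G_2$); the spin factor $W=\mathbb{C}^m\oplus\mathbb{C}$, $m\ge 1$, with $\mathfrak{C}(t^3)=\langle v,v\rangle\lambda$ for $t=(v,\lambda)$, where $\langle\cdot,\cdot\rangle$ is a non-degenerate symmetric bilinear form (types $B$, $D$); or the $3\times3$ hermitian matrices $W=\mathcal{J}_3(\mathbb{A})$ with $\mathfrak{C}(t^3)=\det t$, where $\mathbb{A}$ is the trivial algebra $0$ or the complexification of $\mathbb{R},\mathbb{C},\mathbb{H},\mathbb{O}$ ($D_4,F_4,E_6,E_7,E_8$). Let $\{\mathsf{w}_a\}_{a=1}^{n-1}$ be any basis of $W$, $n=1+\dim W$, write $t=t^a\mathsf{w}_a$, $\mathfrak{C}_{abe}=\mathfrak{C}(\mathsf{w}_a,\mathsf{w}_b,\mathsf{w}_e)$, $\mathfrak{C}_a(t^2)=\mathfrak{C}_{abe}t^bt^e$, and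 fix $1\le c\le n-1$. On $J^1(\mathbb{C}^n,\mathbb{C})$ with coordinates $(x^i,u,u_i)$, $0\le i\le n-1$, and contact distribution $\mathcal{C}=\ker(du-u_i\,dx^i)$, put $$\mathbf{X}_0=\partial_{x^0}+u_0\partial_u+x^c\partial_{u_0},\quad \mathbf{X}_a=\partial_{x^a}+u_a\partial_u,\quad \mathbf{U}^0=\partial_{u_0},\quad \mathbf{U}^a=\partial_{u_a},$$ and consider the $G$-contact structure given by the field $\mathcal{V}\subset\mathbb{P}(\mathcal{C})$ of sub-adjoint varieties that is (the closure of) the projectivization of the vector fields $$\mathbf{V}(\lambda,t)=\lambda^3\mathbf{X}_0-\lambda^2t^a\mathbf{X}_a-\tfrac12\mathfrak{C}(t^3)\mathbf{U}^0-\tfrac32\lambda\,\mathfrak{C}_a(t^2)\mathbf{U}^a,\qquad \lambda\in\mathbb{C},\ t\in W.$$ An (infinitesimal) symmetry on an open set $U$ is a holomorphic contact vector field $\mathbf{S}$ on $U$ such that $[\mathbf{S},\mathbf{V}(\lambda,t)]$ takes values in the affine tangent space $\widehat{T}_{[\mathbf{V}(\lambda,t)]}\mathcal{V}$ for all $\lambda$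 and $t$. The contact vector field with generating function $f$ is $\mathbf{S}_f=-f_{u_i}\partial_{x^i}+(f-u_if_{u_i})\partial_u+(f_{x^i}+u_if_u)\partial_{u_i}$. Then on every connected open set $U$ the symmetries are exactly the restrictions of the fields $\mathbf{S}_f$ with $f$ in the complex linear span of the following functions (equivalently, the generating functions of symmetries on $U$ are exactly the restrictions to $U$ of the elements of this span): $$1,\quad x^i,\quad u_i-\delta_i{}^c\frac{(x^0)^2}{2},\quad 7u-2x^0u_0-3x^au_a,\quad x^0u_a+\frac32\mathfrak{C}_a(X^2)-\frac16\delta_a{}^c(x^0)^3,$$ $$7A^a{}_bx^bu_a-k\,(3x^0u_0+x^au_a),\quad\text{where } A^a{}_{(b}\mathfrak{C}_{de)a}=0 \text{ and } A^c{}_b=k\,\delta^c{}_b \text{ for all } b.$$ Here $X=x^a\mathsf{w}_a$, $0\le i\le n-1$, $1\le a,b,d,e\le n-1$, $k\in\mathbb{C}$, $A=(A^a{}_b)$ is a complex matrix, repeated indices $i$ and $a,b$ are summed over these ranges (there is no sum over the fixed index $c$), and parentheses around indices denote symmetrization. -/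

import Mathlib

/-! ## Complex composition algebras and cubic Jordan algebras -/

/-- A product, a conjugation and a scalar-part functional on a complex vector space. -/
class ConjAlgebra (A : Type) where
  mul : A → A → A
  conj : A → A
  re : A → ℂ

/-- The complexification of `ℝ`: the field `ℂ`, with trivial (complex linear) conjugation. -/
instance conjAlgebraComplex : ConjAlgebra ℂ where
  mul a b := a * b
  conj a := a
  re a := a

/-- The trivial algebra. -/
instance conjAlgebraTrivial : ConjAlgebra PUnit.{1} where
  mul _ _ := PUnit.unit
  conj _ := PUnit.unit
  re _ := 0

/-- The Cayley--Dickson double of `A`. -/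
def CayleyDickson (A : Type) : Type := A × A

instance cayleyDicksonAddCommGroup (A : Type) [AddCommGroup A] :
    AddCommGroup (CayleyDickson A) :=
  inferInstanceAs (AddCommGroup (A × A))

instance cayleyDicksonModule (A : Type) [AddCommGroup A] [Module ℂ A] :
    Module ℂ (CayleyDickson A) :=
  inferInstanceAs (Module ℂ (A × A))

/-- `(a, b) (c, e) = (a c - ē b, e a + b c̄)`, with conjugate `(ā, -b)` of `(a, b)`. -/
instance conjAlgebraCayleyDickson (A : Type) [AddCommGroup A] [ConjAlgebra A] :
    ConjAlgebra (CayleyDickson A) where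
  mul p q :=
    (ConjAlgebra.mul p.1 q.1 - ConjAlgebra.mul (ConjAlgebra.conj q.2) p.2,
      ConjAlgebra.mul q.2 p.1 + ConjAlgebra.mul p.2 (ConjAlgebra.conj q.1))
  conj p := (ConjAlgebra.conj p.1, -p.2)
  re p := ConjAlgebra.re p.1

/-- The complexified complex numbers `ℂ ⊗ ℂ`. -/
abbrev BiComplex : Type := CayleyDickson ℂ

/-- The complexified quaternions `ℍ ⊗ ℂ`. -/
abbrev BiQuaternion : Type := CayleyDickson BiComplex

/-- The complexified octonions `𝕆 ⊗ ℂ`. -/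
abbrev BiOctonion : Type := CayleyDickson BiQuaternion

/-- The quadratic norm `x x̄` of a composition algebra. -/
def compNorm {A : Type} [ConjAlgebra A] (x : A) : ℂ :=
  ConjAlgebra.re (ConjAlgebra.mul x (ConjAlgebra.conj x))

/-- The space of `3 × 3` hermitian matrices over `A`: the pair `(l, v)` stands for the matrix with
rows `(l 0, v 0, v 1)`, `(conj (v 0), l 1, v 2)`, `(conj (v 1), conj (v 2), l 2)`. -/
abbrev Herm3 (A : Type) : Type := (Fin 3 → ℂ) × (Fin 3 → A)

/-- The determinant of a `3 × 3` hermitian matrix over a composition algebra. -/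
def hermDet {A : Type} [ConjAlgebra A] (t : Herm3 A) : ℂ :=
  t.1 0 * t.1 1 * t.1 2
    - t.1 0 * compNorm (t.2 2) - t.1 1 * compNorm (t.2 1) - t.1 2 * compNorm (t.2 0)
    + 2 * ConjAlgebra.re
        (ConjAlgebra.mul (ConjAlgebra.mul (t.2 0) (t.2 2)) (ConjAlgebra.conj (t.2 1)))

/-- The list of the cubic forms `t ↦ N t` of the complex cubic Jordan algebras attached to the
complex simple Lie groups that are not of type `A` or `C`. -/
inductive IsJordanCubic {W : Type*} [AddCommGroup W] [Module ℂ W] (N : W → ℂ) : Prop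
  /-- Type `G₂`: `W = ℂ`. -/
  | line (e : W ≃ₗ[ℂ] ℂ) (h : ∀ t, N t = (e t) ^ 3 / 3)
  /-- Types `B` and `D`: the spin factors `W = ℂ^m ⊕ ℂ`. -/
  | spin (m : ℕ) (hm : 1 ≤ m) (B : LinearMap.BilinForm ℂ (Fin m → ℂ)) (hB : B.IsSymm)
      (hB' : B.Nondegenerate) (e : W ≃ₗ[ℂ] (Fin m → ℂ) × ℂ)
      (h : ∀ t, N t = B (e t).1 (e t).1 * (e t).2)
  /-- Type `D₄`. -/
  | herm_zero (e : W ≃ₗ[ℂ] Herm3 PUnit.{1}) (h : ∀ t, N t = hermDet (e t))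
  /-- Type `F₄`. -/
  | herm_real (e : W ≃ₗ[ℂ] Herm3 ℂ) (h : ∀ t, N t = hermDet (e t))
  /-- Type `E₆`. -/
  | herm_complex (e : W ≃ₗ[ℂ] Herm3 BiComplex) (h : ∀ t, N t = hermDet (e t))
  /-- Type `E₇`. -/
  | herm_quaternion (e : W ≃ₗ[ℂ] Herm3 BiQuaternion) (h : ∀ t, N t = hermDet (e t))
  /-- Type `E₈`. -/
  | herm_octonion (e : W ≃ₗ[ℂ] Herm3 BiOctonion) (h : ∀ t, N t = hermDet (e t))

/-- `C ∈ S³ W*` is the cubic form of a complex cubic Jordan algebra `W`. -/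
structure IsJordanCubicForm {W : Type*} [AddCommGroup W] [Module ℂ W]
    (C : W →ₗ[ℂ] W →ₗ[ℂ] W →ₗ[ℂ] ℂ) : Prop where
  swap_left : ∀ r s t, C r s t = C s r t
  swap_right : ∀ r s t, C r s t = C r t s
  cubic : IsJordanCubic (fun t => C t t t)

/-! ## The first jet space and its contact structure -/

/-- The jet space `J¹(ℂⁿ, ℂ)`, `n = d + 1`, with coordinates `m = (x, u, p)`: `x i = xⁱ` and
`p i = u_i` for `0 ≤ i ≤ d`. The index `a = 1, …, d` of a basis of `W` is `Fin.succ` of an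
element of `Fin d`. -/
abbrev J1 (d : ℕ) : Type := (Fin (d + 1) → ℂ) × ℂ × (Fin (d + 1) → ℂ)

section
variable {d : ℕ}

/-- The coordinate vector `∂/∂xⁱ`. -/
def ddx (i : Fin (d + 1)) : J1 d := (Pi.single i 1, 0, 0)

/-- The coordinate vector `∂/∂u`. -/
def ddu : J1 d := (0, 1, 0)

/-- The coordinate vector `∂/∂u_i`. -/
def ddp (i : Fin (d + 1)) : J1 d := (0, 0, Pi.single i 1)

/-- The contact distribution, the kernel of `du - u_i dxⁱ`. -/
def contactDist (m : J1 d) : Set (J1 d) := {v | v.2.1 = ∑ i, m.2.2 i * v.1 i}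

/-- `S` is a contact vector field on `U`: brackets of `S` with sections of the contact
distribution are sections of the contact distribution. -/
def IsContactField (U : Set (J1 d)) (S : J1 d → J1 d) : Prop :=
  ∀ Y : J1 d → J1 d, DifferentiableOn ℂ Y U → (∀ m ∈ U, Y m ∈ contactDist m) →
    ∀ m ∈ U, VectorField.lieBracket ℂ S Y m ∈ contactDist m

/-- The vector field with generating function `f`:
`-f_{u_i} ∂_{xⁱ} + (f - u_i f_{u_i}) ∂_u + (f_{xⁱ} + u_i f_u) ∂_{u_i}`. -/
noncomputable def contactField (f : J1 d → ℂ) (m : J1 d) : J1 d :=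
  -(∑ i, fderiv ℂ f m (ddp i) • ddx i)
    + (f m - ∑ i, m.2.2 i * fderiv ℂ f m (ddp i)) • ddu
    + ∑ i, (fderiv ℂ f m (ddx i) + m.2.2 i * fderiv ℂ f m ddu) • ddp i

/-- The affine tangent space at `v` of a cone `K` in a complex vector space: the span of `v` and of
the velocities at `v` of the holomorphic curves in `K` through `v`. -/
def affineTangentSpace {E : Type*} [NormedAddCommGroup E] [NormedSpace ℂ E] (K : Set E) (v : E) :
    Submodule ℂ E :=
  Submodule.span ℂ ({v} ∪ {y | ∃ γ : ℂ → E, AnalyticAt ℂ γ 0 ∧ γ 0 = v ∧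
    (∀ᶠ z in nhds 0, γ z ∈ K) ∧ deriv γ 0 = y})

/-! ## The curved structure -/

/-- `X_0 = ∂_{x⁰} + u_0 ∂_u + x^c ∂_{u_0}`. -/
def frameX0 (c : Fin d) (m : J1 d) : J1 d := ddx 0 + m.2.2 0 • ddu + m.1 c.succ • ddp 0

/-- `X_a = ∂_{x^a} + u_a ∂_u`. -/
def frameX (a : Fin d) (m : J1 d) : J1 d := ddx a.succ + m.2.2 a.succ • ddu

variable {W : Type*} [AddCommGroup W] [Module ℂ W]

/-- The vector field
`V(l, t) = l³ X_0 - l² t^a X_a - (1/2) C(t³) ∂_{u_0} - (3/2) l C_a(t²) ∂_{u_a}`. -/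
noncomputable def fieldV (C : W →ₗ[ℂ] W →ₗ[ℂ] W →ₗ[ℂ] ℂ) (w : Module.Basis (Fin d) ℂ W)
    (c : Fin d) (l : ℂ) (t : W) (m : J1 d) : J1 d :=
  l ^ 3 • frameX0 c m - l ^ 2 • ∑ a, w.repr t a • frameX a m
    - (1 / 2 * C t t t) • ddp 0 - (3 / 2 * l) • ∑ a : Fin d, C (w a) t t • ddp a.succ

/-- The affine cone over the sub-adjoint variety at `m`, the closure of the values of all
`V(l, t)` at `m`. -/
def subadjointCone (C : W →ₗ[ℂ] W →ₗ[ℂ] W →ₗ[ℂ] ℂ) (w : Module.Basis (Fin d) ℂ W)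
    (c : Fin d) (m : J1 d) : Set (J1 d) :=
  closure {v | ∃ (l : ℂ) (t : W), fieldV C w c l t m = v}

/-- `S` is a (holomorphic, infinitesimal) symmetry on `U` of the contact distribution endowed with
the field of sub-adjoint varieties. -/
structure IsSymmetry (C : W →ₗ[ℂ] W →ₗ[ℂ] W →ₗ[ℂ] ℂ) (w : Module.Basis (Fin d) ℂ W)
    (c : Fin d) (U : Set (J1 d)) (S : J1 d → J1 d) : Prop where
  holomorphic : DifferentiableOn ℂ S U
  contact : IsContactField U S
  preserves : ∀ (l : ℂ) (t : W), ∀ m ∈ U,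
    VectorField.lieBracket ℂ S (fieldV C w c l t) m ∈
      affineTangentSpace (subadjointCone C w c m) (fieldV C w c l t m)

/-- The element `X = x^a w_a` of `W`. -/
noncomputable def pointX (w : Module.Basis (Fin d) ℂ W) (m : J1 d) : W :=
  ∑ a : Fin d, m.1 a.succ • w a

/-- The endomorphism `A` of `W`, with components `A a b = A^a_b`, annihilates the cubic:
the symmetrization of `A^a_b C_{eha}` over `b, e, h` vanishes. -/
def AnnihilatesCubic (C : W →ₗ[ℂ] W →ₗ[ℂ] W →ₗ[ℂ] ℂ) (w : Module.Basis (Fin d) ℂ W)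
    (A : Matrix (Fin d) (Fin d) ℂ) : Prop :=
  ∀ b e h : Fin d, ∑ a : Fin d, (A a b * C (w e) (w h) (w a) + A a e * C (w b) (w h) (w a)
    + A a h * C (w b) (w e) (w a)) = 0

/-- The listed generating functions. -/
inductive ListedFunction (C : W →ₗ[ℂ] W →ₗ[ℂ] W →ₗ[ℂ] ℂ) (w : Module.Basis (Fin d) ℂ W)
    (c : Fin d) : (J1 d → ℂ) → Prop
  /-- `1` -/
  | one : ListedFunction C w c (fun _ => 1)
  /-- `xⁱ` -/
  | coord (i : Fin (d + 1)) : ListedFunction C w c (fun m => m.1 i)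
  /-- `u_i - δ_i^c (x⁰)² / 2` -/
  | momentum (i : Fin (d + 1)) : ListedFunction C w c
      (fun m => m.2.2 i - if i = c.succ then (m.1 0) ^ 2 / 2 else 0)
  /-- `7 u - 2 x⁰ u_0 - 3 x^a u_a` -/
  | scaling : ListedFunction C w c
      (fun m => 7 * m.2.1 - 2 * (m.1 0 * m.2.2 0)
        - 3 * ∑ a : Fin d, m.1 a.succ * m.2.2 a.succ)
  /-- `x⁰ u_a + (3/2) C_a(X²) - (1/6) δ_a^c (x⁰)³` -/
  | shear (a : Fin d) : ListedFunction C w c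
      (fun m => m.1 0 * m.2.2 a.succ + 3 / 2 * C (w a) (pointX w m) (pointX w m)
        - if a = c then (m.1 0) ^ 3 / 6 else 0)
  /-- `7 A^a_b x^b u_a - k (3 x⁰ u_0 + x^a u_a)`, where `A` annihilates the cubic and
  `A^c_b = k δ^c_b` -/
  | linear (A : Matrix (Fin d) (Fin d) ℂ) (k : ℂ) (hA : AnnihilatesCubic C w A)
      (hk : ∀ b, A c b = if b = c then k else 0) : ListedFunction C w c
      (fun m => 7 * ∑ a : Fin d, ∑ b : Fin d, A a b * m.1 b.succ * m.2.2 a.succ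
        - k * (3 * (m.1 0 * m.2.2 0) + ∑ a : Fin d, m.1 a.succ * m.2.2 a.succ))

end

/-!
The contact field `S_f` is a symmetry exactly if `V² f + l⁵ t^c f_{u_0} + l⁶ f_{u_c} = 0` for all
`V = V(l, t)`: the tangent spaces of the cone are Lagrangian, so that they are cut out by the
symplectic products with `V` and its `t`-derivatives. This equation is polynomial in `l`. As the
adjoints `C(t, t)` lie on no quadric, its coefficients force the vertical second derivatives of `f`
to vanish. The vertical first derivatives of `f` are then affine functions on the base, and some
combination of the listed functions has the same ones. The difference depends on the `x^i` only,
and the equation makes it affine.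
-/

/-! ## Derivatives of holomorphic maps -/

section HolomorphicCalculus

variable {E F : Type*} [NormedAddCommGroup E] [NormedSpace ℂ E] [NormedAddCommGroup F]
  [NormedSpace ℂ F]

theorem norm_fderiv_le_of_forall_mem_ball_norm_le {f : E → F} {x : E} {R M : ℝ} (hR : 0 < R)
    (hf : DifferentiableOn ℂ f (Metric.ball x R)) (hM : ∀ y ∈ Metric.ball x R, ‖f y‖ ≤ M) :
    ‖fderiv ℂ f x‖ ≤ 2 * M / R := by
  refine Complex.norm_fderiv_le_div_of_mapsTo_ball hf (fun y hy => ?_) hR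
  rw [mem_closedBall_iff_norm]
  linarith [norm_sub_le (f y) (f x), hM y hy, hM x (Metric.mem_ball_self hR)]

theorem uniformCauchySeqOn_fderiv {ι : Type*} {l : Filter ι} {f : ι → E → F} {x : E} {R : ℝ}
    (hR : 0 < R) (hf : ∀ n, DifferentiableOn ℂ (f n) (Metric.ball x R))
    (hcauchy : UniformCauchySeqOn f l (Metric.ball x R)) :
    UniformCauchySeqOn (fun n => fderiv ℂ (f n)) l (Metric.ball x (R / 2)) := by
  intro u hu
  obtain ⟨ε, hε, hεu⟩ := Metric.mem_uniformity_dist.1 hu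
  filter_upwards [hcauchy _ (Metric.dist_mem_uniformity (by positivity : 0 < ε * R / 8))]
    with n hn y hy
  apply hεu
  have hball := Metric.ball_half_subset _ hy
  have hdiff (i) : DifferentiableAt ℂ (f i) y :=
    (hf i).differentiableAt (Metric.isOpen_ball.mem_nhds (hball (Metric.mem_ball_self (by simpa))))
  have hle : ‖fderiv ℂ (f n.1 - f n.2) y‖ ≤ 2 * (ε * R / 8) / (R / 2) :=
    norm_fderiv_le_of_forall_mem_ball_norm_le (half_pos hR)
      (((hf n.1).sub (hf n.2)).mono hball)
      fun z hz => by simpa [dist_eq_norm] using (hn z (hball hz)).le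
  rw [fderiv_sub (hdiff _) (hdiff _)] at hle
  rw [dist_eq_norm]
  calc _ ≤ 2 * (ε * R / 8) / (R / 2) := hle
    _ = ε / 2 := by field_simp; norm_num
    _ < ε := half_lt_self hε

theorem differentiableAt_of_tendstoUniformlyOn_ball [CompleteSpace F] {ι : Type*} {l : Filter ι}
    [l.NeBot] {f : ι → E → F} {g : E → F} {x : E} {R : ℝ} (hR : 0 < R)
    (hf : ∀ n, DifferentiableOn ℂ (f n) (Metric.ball x R))
    (hfg : TendstoUniformlyOn f g l (Metric.ball x R)) : DifferentiableAt ℂ g x := by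
  have hsub : Metric.ball x (R / 2) ⊆ Metric.ball x R := Metric.ball_subset_ball (by linarith)
  have hcauchy := uniformCauchySeqOn_fderiv hR hf hfg.uniformCauchySeqOn
  have hlim : ∀ y, ∃ g' : E →L[ℂ] F, y ∈ Metric.ball x (R / 2) →
      Filter.Tendsto (fun n => fderiv ℂ (f n) y) l (nhds g') := fun y => by
    by_cases hy : y ∈ Metric.ball x (R / 2)
    · exact (CompleteSpace.complete (hcauchy.cauchy_map hy)).imp fun _ h _ => h
    · exact ⟨0, fun h => absurd h hy⟩
  choose g' hg' using hlim
  exact (hasFDerivAt_of_tendstoUniformlyOn Metric.isOpen_ball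
    (hcauchy.tendstoUniformlyOn_of_tendsto hg')
    (fun n y hy => ((hf n).differentiableAt
      (Metric.isOpen_ball.mem_nhds (hsub hy))).hasFDerivAt)
    (fun y hy => hfg.tendsto_at (hsub hy))
    (Metric.mem_ball_self (half_pos hR))).differentiableAt

theorem exists_lipschitzOnWith_ball_of_holomorphic {f : E → F} {U : Set E} (hU : IsOpen U)
    (hf : DifferentiableOn ℂ f U) {m : E} (hm : m ∈ U) :
    ∃ R > 0, Metric.ball m R ⊆ U ∧ ∃ K, LipschitzOnWith K f (Metric.ball m R) := by
  have hbdd : ∀ᶠ x in nhds m, x ∈ U ∧ ‖f x‖ ≤ ‖f m‖ + 1 :=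
    (hU.eventually_mem hm).and <| ((hf.differentiableAt
      (hU.mem_nhds hm)).continuousAt.norm.eventually_lt_const (lt_add_one _)).mono fun _ => le_of_lt
  obtain ⟨R, hR, hRU⟩ := Metric.eventually_nhds_iff_ball.1 hbdd
  have hsub : Metric.ball m (R / 2) ⊆ U := fun x hx =>
    (hRU x (Metric.ball_subset_ball (by linarith) hx)).1
  refine ⟨R / 2, half_pos hR, hsub, Real.toNNReal (2 * (‖f m‖ + 1) / (R / 2)),
    (convex_ball m _).lipschitzOnWith_of_nnnorm_fderiv_le (𝕜 := ℂ)
      (fun x hx => hf.differentiableAt (hU.mem_nhds (hsub hx))) fun x hx => ?_⟩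
  rw [← NNReal.coe_le_coe, coe_nnnorm, Real.coe_toNNReal _ (by positivity)]
  have hball := Metric.ball_half_subset _ hx
  exact norm_fderiv_le_of_forall_mem_ball_norm_le (half_pos hR)
    (hf.mono fun y hy => (hRU y (hball hy)).1) fun y hy => (hRU y (hball hy)).2

theorem exists_lipschitzOnWith_fderiv_ball {f : E → F} {U : Set E} (hU : IsOpen U)
    (hf : DifferentiableOn ℂ f U) {m : E} (hm : m ∈ U) :
    ∃ R > 0, Metric.ball m R ⊆ U ∧ ∃ K, LipschitzOnWith K (fderiv ℂ f) (Metric.ball m R) := by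
  obtain ⟨R, hR, hRU, K, hK⟩ := exists_lipschitzOnWith_ball_of_holomorphic hU hf hm
  have hsub : Metric.ball m (R / 2 / 2) ⊆ Metric.ball m R :=
    Metric.ball_subset_ball (by linarith)
  refine ⟨R / 2 / 2, by positivity, hsub.trans hRU, Real.toNNReal (2 * K / (R / 2 / 2)),
    LipschitzOnWith.of_dist_le_mul fun y hy z hz => ?_⟩
  have hball : Metric.ball z (R / 2 / 2) ⊆ Metric.ball m R :=
    (Metric.ball_half_subset _ hz).trans (Metric.ball_subset_ball (by linarith))
  have htranslate : ∀ w ∈ Metric.ball z (R / 2 / 2), w + (y - z) ∈ Metric.ball m R :=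
    fun w hw => by
      rw [mem_ball_iff_norm] at *
      calc ‖w + (y - z) - m‖ = ‖(w - z) + (y - m)‖ := by congr 1; abel
        _ ≤ ‖w - z‖ + ‖y - m‖ := norm_add_le _ _
        _ < R := by linarith
  have hdiff : ∀ w ∈ Metric.ball m R, DifferentiableAt ℂ f w := fun w hw =>
    hf.differentiableAt (hU.mem_nhds (hRU hw))
  have hle : ‖fderiv ℂ (fun w => f (w + (y - z)) - f w) z‖ ≤ 2 * (K * ‖y - z‖) / (R / 2 / 2) := by
    refine norm_fderiv_le_of_forall_mem_ball_norm_le (by positivity) (fun w hw => ?_) fun w hw => ?_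
    · exact (((hdiff _ (htranslate w hw)).comp w (differentiableAt_id.add_const _)).sub
        (hdiff _ (hball hw))).differentiableWithinAt
    · simpa using hK.norm_sub_le (htranslate w hw) (hball hw)
  have hz' : y = z + (y - z) := by abel
  rw [fderiv_fun_sub (by
    rw [differentiableAt_comp_add_right, ← hz']; exact hdiff y (hsub hy)) (hdiff z (hsub hz)),
    fderiv_comp_add_right, ← hz'] at hle
  rw [dist_eq_norm, dist_eq_norm, Real.coe_toNNReal _ (by positivity)]
  exact hle.trans_eq (by ring)

theorem norm_sub_sub_fderiv_le_of_lipschitzOnWith {f : E → F} {s : Set E} {K : NNReal}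
    (hs : Convex ℝ s) (hf : ∀ x ∈ s, DifferentiableAt ℂ f x)
    (hK : LipschitzOnWith K (fderiv ℂ f) s) {y z : E} (hy : y ∈ s) (hz : z ∈ s) :
    ‖f z - f y - fderiv ℂ f y (z - y)‖ ≤ K * ‖z - y‖ * ‖z - y‖ := by
  have hseg : segment ℝ y z ⊆ s := hs.segment_subset hy hz
  refine (convex_segment y z).norm_image_sub_le_of_norm_fderiv_le' (fun w hw => hf w (hseg hw))
    (fun w hw => (hK.norm_sub_le (hseg hw) hy).trans ?_)
    (left_mem_segment ℝ y z) (right_mem_segment ℝ y z)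
  gcongr
  exact norm_sub_le_of_mem_segment hw

theorem norm_inv_natCast_add_one_smul (n : ℕ) (v : E) :
    ‖((n : ℂ) + 1)⁻¹ • v‖ = 1 / (n + 1) * ‖v‖ := by
  have hn : ‖((n : ℂ) + 1)‖ = n + 1 := by exact_mod_cast Complex.norm_natCast (n + 1)
  rw [norm_smul, norm_inv, hn, one_div]

theorem add_inv_natCast_add_one_smul_mem_ball {x y v : E} {R : ℝ} (hv : ‖v‖ < R / 2)
    (hy : y ∈ Metric.ball x (R / 2)) (n : ℕ) : y + ((n : ℂ) + 1)⁻¹ • v ∈ Metric.ball x R := by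
  have hle : ‖((n : ℂ) + 1)⁻¹ • v‖ ≤ ‖v‖ := by
    rw [norm_inv_natCast_add_one_smul]
    exact mul_le_of_le_one_left (norm_nonneg v)
      (div_le_one_of_le₀ (by linarith [n.cast_nonneg (α := ℝ)]) (by positivity))
  rw [mem_ball_iff_norm] at *
  calc ‖y + ((n : ℂ) + 1)⁻¹ • v - x‖ = ‖(y - x) + ((n : ℂ) + 1)⁻¹ • v‖ := by congr 1; abel
    _ ≤ ‖y - x‖ + ‖((n : ℂ) + 1)⁻¹ • v‖ := norm_add_le _ _
    _ < R := by linarith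

theorem tendstoUniformlyOn_smul_sub_fderiv {f : E → F} {x v : E} {R : ℝ} {K : NNReal}
    (hf : DifferentiableOn ℂ f (Metric.ball x R))
    (hK : LipschitzOnWith K (fderiv ℂ f) (Metric.ball x R)) (hv : ‖v‖ < R / 2) :
    TendstoUniformlyOn
      (fun (n : ℕ) y => ((n : ℂ) + 1) • (f (y + ((n : ℂ) + 1)⁻¹ • v) - f y))
      (fun y => fderiv ℂ f y v) Filter.atTop (Metric.ball x (R / 2)) := by
  rw [Metric.tendstoUniformlyOn_iff]
  intro ε hε
  have hlim := tendsto_one_div_add_atTop_nhds_zero_nat.const_mul (K * ‖v‖ * ‖v‖)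
  rw [mul_zero] at hlim
  filter_upwards [hlim.eventually_lt_const hε] with n hn y hy
  have hmean := norm_sub_sub_fderiv_le_of_lipschitzOnWith (convex_ball x R)
    (fun w hw => hf.differentiableAt (Metric.isOpen_ball.mem_nhds hw)) hK
    (Metric.ball_subset_ball (by linarith [norm_nonneg v]) hy)
    (add_inv_natCast_add_one_smul_mem_ball hv hy n)
  rw [add_sub_cancel_left, norm_inv_natCast_add_one_smul] at hmean
  have hc : ‖((n : ℂ) + 1)‖ = n + 1 := by exact_mod_cast Complex.norm_natCast (n + 1)
  set c : ℂ := (n : ℂ) + 1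
  have hrescale : c • (f (y + c⁻¹ • v) - f y) - fderiv ℂ f y v =
      c • (f (y + c⁻¹ • v) - f y - fderiv ℂ f y (c⁻¹ • v)) := by
    rw [map_smul, smul_sub c (_ - f y), smul_inv_smul₀ (Nat.cast_add_one_ne_zero n)]
  rw [dist_comm, dist_eq_norm, hrescale, norm_smul, hc]
  calc ((n : ℝ) + 1) * _
      ≤ (n + 1) * (K * (1 / (n + 1) * ‖v‖) * (1 / (n + 1) * ‖v‖)) := by gcongr
    _ = K * ‖v‖ * ‖v‖ * (1 / (n + 1)) := by field_simp
    _ < ε := hn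

theorem differentiableOn_fderiv_apply_of_holomorphic [CompleteSpace F] {f : E → F} {U : Set E}
    (hU : IsOpen U) (hf : DifferentiableOn ℂ f U) (v : E) :
    DifferentiableOn ℂ (fun m => fderiv ℂ f m v) U := by
  intro m hm
  obtain ⟨R, hR, hRU, K, hK⟩ := exists_lipschitzOnWith_fderiv_ball hU hf hm
  obtain ⟨s, hs, hsv⟩ : ∃ s : ℂ, s ≠ 0 ∧ ‖s • v‖ < R / 2 := by
    have hsmall : ∀ᶠ s : ℂ in nhds 0, ‖s • v‖ < R / 2 :=
      (by fun_prop : Continuous fun s : ℂ => ‖s • v‖).continuousAt.eventually_lt_const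
        (by simpa using hR)
    exact ((eventually_nhdsWithin_of_forall fun s hs => hs).and
      (hsmall.filter_mono (nhdsWithin_le_nhds (s := {0}ᶜ)))).exists
  have hdiff : DifferentiableAt ℂ (fun y => fderiv ℂ f y (s • v)) m := by
    refine differentiableAt_of_tendstoUniformlyOn_ball (half_pos hR) (fun n => ?_)
      (tendstoUniformlyOn_smul_sub_fderiv (hf.mono hRU) hK hsv)
    exact DifferentiableOn.const_smul ((hf.mono hRU).comp (by fun_prop) (fun y hy =>
      add_inv_natCast_add_one_smul_mem_ball hsv hy n) |>.sub
        (hf.mono ((Metric.ball_subset_ball (by linarith)).trans hRU))) _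
  have hscale : (fun y => fderiv ℂ f y v) = fun y => s⁻¹ • fderiv ℂ f y (s • v) := by
    ext y
    rw [map_smul, inv_smul_smul₀ hs]
  rw [hscale]
  exact (hdiff.const_smul s⁻¹).differentiableWithinAt

theorem differentiableOn_fderiv_of_holomorphic [FiniteDimensional ℂ E] [CompleteSpace F]
    {f : E → F} {U : Set E} (hU : IsOpen U) (hf : DifferentiableOn ℂ f U) :
    DifferentiableOn ℂ (fderiv ℂ f) U := by
  let b := Module.finBasis ℂ E
  have hsum : fderiv ℂ f = fun m => ∑ i,
      (LinearMap.toContinuousLinearMap (b.coord i)).smulRight (fderiv ℂ f m (b i)) := by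
    ext m v
    conv_lhs => rw [← b.sum_repr v, map_sum]
    simp
  rw [hsum]
  exact DifferentiableOn.fun_sum fun i _ => ((ContinuousLinearMap.smulRightL ℂ E F
    (LinearMap.toContinuousLinearMap (b.coord i))).differentiable.comp_differentiableOn
      (differentiableOn_fderiv_apply_of_holomorphic hU hf (b i)))

end HolomorphicCalculus

/-! ## Cubic forms and the quadrics through their adjoints -/

section SymmetricCubics

variable {W : Type*} [AddCommGroup W] [Module ℂ W] {C : W →ₗ[ℂ] W →ₗ[ℂ] W →ₗ[ℂ] ℂ}
  {Q : (W →ₗ[ℂ] ℂ) →ₗ[ℂ] (W →ₗ[ℂ] ℂ) →ₗ[ℂ] ℂ}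

/-- The trilinear form `C` is symmetric, that is, `C ∈ S³ W*`. -/
structure IsSymmetricCubic (C : W →ₗ[ℂ] W →ₗ[ℂ] W →ₗ[ℂ] ℂ) : Prop where
  swap_left : ∀ r s t, C r s t = C s r t
  swap_right : ∀ r s t, C r s t = C r t s

/-- The quadratic form on the dual of `W` with polar form `Q` vanishes at all adjoints
`C t t = 𝔠(t², ·)`. -/
structure VanishesOnAdjoints (C : W →ₗ[ℂ] W →ₗ[ℂ] W →ₗ[ℂ] ℂ)
    (Q : (W →ₗ[ℂ] ℂ) →ₗ[ℂ] (W →ₗ[ℂ] ℂ) →ₗ[ℂ] ℂ) : Prop where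
  symm : ∀ φ ψ, Q φ ψ = Q ψ φ
  vanishes : ∀ t, Q (C t t) (C t t) = 0

/-- The adjoints `C t t` of the elements of `W` lie on no quadric of the dual of `W`. Through this
property the cubic forms of Jordan algebras enter the computation of the symmetries. -/
structure AdjointsOnNoQuadric (C : W →ₗ[ℂ] W →ₗ[ℂ] W →ₗ[ℂ] ℂ) : Prop
    extends IsSymmetricCubic C where
  eq_zero : ∀ Q, VanishesOnAdjoints C Q → ∀ φ ψ, Q φ ψ = 0

theorem IsSymmetricCubic.comm (hC : IsSymmetricCubic C) (r s : W) : C r s = C s r :=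
  LinearMap.ext fun t => hC.swap_left r s t

theorem IsSymmetricCubic.polarization (hC : IsSymmetricCubic C) {N : W → ℂ}
    (hN : ∀ t, C t t t = N t) (r s t : W) :
    6 * C r s t = N (r + s + t) - N (r + s) - N (s + t) - N (r + t) + N r + N s + N t := by
  simp only [← hN, map_add, LinearMap.add_apply]
  have hl := hC.swap_left
  have hr := hC.swap_right
  simp only [hl s r, hl t r, hl t s, hr r t r, hr r t s, hr s s r, hr s t r, hr t t r,
    hr s t s, hr t t s]
  ring

namespace VanishesOnAdjoints

theorem two_two (hQ : VanishesOnAdjoints C Q) (hC : IsSymmetricCubic C) (t s : W) :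
    Q (C t t) (C s s) + 2 * Q (C t s) (C t s) = 0 := by
  have hadd := hQ.vanishes (t + s)
  have hsub := hQ.vanishes (t - s)
  simp only [map_add, map_sub, LinearMap.add_apply, LinearMap.sub_apply, hC.comm s t,
    hQ.symm (C t s) (C t t), hQ.symm (C s s) (C t t), hQ.symm (C s s) (C t s)] at hadd hsub
  linear_combination (hadd + hsub - 2 * hQ.vanishes t - 2 * hQ.vanishes s) / 4

theorem two_one_one (hQ : VanishesOnAdjoints C Q) (hC : IsSymmetricCubic C) (t u s : W) :
    Q (C t u) (C s s) + 2 * Q (C t s) (C u s) = 0 := by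
  have hadd := hQ.two_two hC (t + u) s
  simp only [map_add, LinearMap.add_apply, hC.comm u t, hQ.symm (C u s) (C t s)] at hadd
  linear_combination (hadd - hQ.two_two hC t s - hQ.two_two hC u s) / 2

theorem polarized (hQ : VanishesOnAdjoints C Q) (hC : IsSymmetricCubic C) (t u s r : W) :
    Q (C t u) (C s r) + Q (C t s) (C u r) + Q (C t r) (C u s) = 0 := by
  have hadd := hQ.two_one_one hC t u (s + r)
  simp only [map_add, LinearMap.add_apply, hC.comm r s] at hadd
  linear_combination (hadd - hQ.two_one_one hC t u s - hQ.two_one_one hC t u r) / 2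

theorem eq_zero_of_apply_self_eq_zero (hQ : VanishesOnAdjoints C Q) (hC : IsSymmetricCubic C)
    {t : W} (ht : C t t = 0) (u s : W) : Q (C t u) (C t s) = 0 := by
  have hpol := hQ.polarized hC t u t s
  rw [ht, map_zero, LinearMap.zero_apply, hC.comm u t, hQ.symm (C t s)] at hpol
  linear_combination hpol / 2

end VanishesOnAdjoints

end SymmetricCubics

section Line

variable {W : Type*} [AddCommGroup W] [Module ℂ W] {C : W →ₗ[ℂ] W →ₗ[ℂ] W →ₗ[ℂ] ℂ}
  {Q : (W →ₗ[ℂ] ℂ) →ₗ[ℂ] (W →ₗ[ℂ] ℂ) →ₗ[ℂ] ℂ}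

theorem VanishesOnAdjoints.eq_zero_of_line (hQ : VanishesOnAdjoints C Q)
    (e : W ≃ₗ[ℂ] ℂ) (h : ∀ t, C t t t = (e t) ^ 3 / 3) (φ ψ : W →ₗ[ℂ] ℂ) : Q φ ψ = 0 := by
  have hspan : ∀ t : W, t = e t • e.symm 1 := fun t => by
    apply e.injective; simp
  have hadjoint : ∀ χ : W →ₗ[ℂ] ℂ, χ = (3 * χ (e.symm 1)) • C (e.symm 1) (e.symm 1) := fun χ => by
    ext t
    rw [hspan t]
    simp only [map_smul, LinearMap.smul_apply, h, smul_eq_mul, LinearEquiv.apply_symm_apply]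
    ring
  rw [hadjoint φ, hadjoint ψ]
  simp [hQ.vanishes]

end Line

section Spin

variable {W E : Type*} [AddCommGroup W] [Module ℂ W] [AddCommGroup E] [Module ℂ E]
  {C : W →ₗ[ℂ] W →ₗ[ℂ] W →ₗ[ℂ] ℂ} {Q : (W →ₗ[ℂ] ℂ) →ₗ[ℂ] (W →ₗ[ℂ] ℂ) →ₗ[ℂ] ℂ}
  {B : LinearMap.BilinForm ℂ E} {e : W ≃ₗ[ℂ] E × ℂ}

/-- The linear form `(v, μ) ↦ μ` on a spin factor. -/
def spinScalar (e : W ≃ₗ[ℂ] E × ℂ) : W →ₗ[ℂ] ℂ := LinearMap.snd ℂ E ℂ ∘ₗ e.toLinearMap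

/-- The linear form `(v, μ) ↦ ⟨z, v⟩` on a spin factor. -/
def spinVector (B : LinearMap.BilinForm ℂ E) (e : W ≃ₗ[ℂ] E × ℂ) (z : E) : W →ₗ[ℂ] ℂ :=
  B z ∘ₗ LinearMap.fst ℂ E ℂ ∘ₗ e.toLinearMap

theorem three_mul_apply_spin (hC : IsSymmetricCubic C) (hB : B.IsSymm)
    (h : ∀ t, C t t t = B (e t).1 (e t).1 * (e t).2) (r s t : W) :
    3 * C r s t = B (e r).1 (e s).1 * (e t).2 + B (e s).1 (e t).1 * (e r).2
      + B (e r).1 (e t).1 * (e s).2 := by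
  have hpol := hC.polarization h r s t
  simp only [map_add, Prod.fst_add, Prod.snd_add, LinearMap.add_apply] at hpol
  rw [hB.eq (e t).1 (e r).1, hB.eq (e t).1 (e s).1, hB.eq (e s).1 (e r).1] at hpol
  linear_combination hpol / 2

theorem apply_spin_unit_unit (hC : IsSymmetricCubic C) (hB : B.IsSymm)
    (h : ∀ t, C t t t = B (e t).1 (e t).1 * (e t).2) :
    C (e.symm (0, 1)) (e.symm (0, 1)) = 0 := by
  ext t
  simpa using three_mul_apply_spin hC hB h (e.symm (0, 1)) (e.symm (0, 1)) t

theorem apply_spin_vec_vec (hC : IsSymmetricCubic C) (hB : B.IsSymm)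
    (h : ∀ t, C t t t = B (e t).1 (e t).1 * (e t).2) (v w : E) :
    C (e.symm (v, 0)) (e.symm (w, 0)) = (B v w / 3) • spinScalar e := by
  ext t
  have ht := three_mul_apply_spin hC hB h (e.symm (v, 0)) (e.symm (w, 0)) t
  simp only [LinearEquiv.apply_symm_apply, mul_zero, add_zero] at ht
  change _ = B v w / 3 * (e t).2
  linear_combination ht / 3

theorem apply_spin_unit_vec (hC : IsSymmetricCubic C) (hB : B.IsSymm)
    (h : ∀ t, C t t t = B (e t).1 (e t).1 * (e t).2) (v : E) :
    C (e.symm (0, 1)) (e.symm (v, 0)) = (1 / 3 : ℂ) • spinVector B e v := by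
  ext t
  have ht := three_mul_apply_spin hC hB h (e.symm (0, 1)) (e.symm (v, 0)) t
  simp only [LinearEquiv.apply_symm_apply, mul_zero, add_zero, map_zero, LinearMap.zero_apply,
    zero_mul, zero_add, mul_one] at ht
  change _ = 1 / 3 * B v (e t).1
  linear_combination ht / 3

theorem exists_eq_spinVector_add_smul_spinScalar [FiniteDimensional ℂ E] (hB : B.Nondegenerate)
    (e : W ≃ₗ[ℂ] E × ℂ) (χ : W →ₗ[ℂ] ℂ) :
    ∃ (z : E) (μ : ℂ), χ = spinVector B e z + μ • spinScalar e := by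
  let χ' : E →ₗ[ℂ] ℂ := χ ∘ₗ e.symm.toLinearMap ∘ₗ LinearMap.inl ℂ E ℂ
  refine ⟨(B.toDual hB).symm χ', χ (e.symm (0, 1)), LinearMap.ext fun t => ?_⟩
  have hz : spinVector B e ((B.toDual hB).symm χ') t = χ (e.symm ((e t).1, 0)) :=
    LinearMap.BilinForm.apply_toDual_symm_apply (hB := hB) χ' (e t).1
  have ht : t = e.symm ((e t).1, 0) + (e t).2 • e.symm (0, 1) := by
    apply e.injective
    simp
  rw [LinearMap.add_apply, hz]
  conv_lhs => rw [ht]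
  simp [spinScalar, mul_comm]

theorem VanishesOnAdjoints.eq_zero_of_spin [FiniteDimensional ℂ E] [Nontrivial E]
    (hQ : VanishesOnAdjoints C Q) (hC : IsSymmetricCubic C) (hB : B.IsSymm)
    (hB' : B.Nondegenerate) (h : ∀ t, C t t t = B (e t).1 (e t).1 * (e t).2)
    (φ ψ : W →ₗ[ℂ] ℂ) : Q φ ψ = 0 := by
  obtain ⟨v₁, hv₁⟩ := LinearMap.BilinForm.exists_bilinForm_self_ne_zero
    (B := B) (fun h0 => by
      obtain ⟨v, hv⟩ := exists_ne (0 : E)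
      exact hv (hB'.1 v fun y => by simp [h0])) ⟨hB.eq⟩
  have hv₁ : B v₁ v₁ ≠ 0 := hv₁
  have hscalar : spinScalar e = (3 / B v₁ v₁) • C (e.symm (v₁, 0)) (e.symm (v₁, 0)) := by
    rw [apply_spin_vec_vec hC hB h, smul_smul, div_mul_div_cancel₀ hv₁, div_self three_ne_zero,
      one_smul]
  have hvector : ∀ v, spinVector B e v = (3 : ℂ) • C (e.symm (0, 1)) (e.symm (v, 0)) := fun v => by
    rw [apply_spin_unit_vec hC hB h, smul_smul, mul_one_div_cancel three_ne_zero, one_smul]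
  have hvecvec : ∀ v w, Q (spinVector B e v) (spinVector B e w) = 0 := fun v w => by
    simp only [hvector, map_smul, LinearMap.smul_apply,
      hQ.eq_zero_of_apply_self_eq_zero hC (apply_spin_unit_unit hC hB h), smul_zero]
  have hscalsc : Q (spinScalar e) (spinScalar e) = 0 := by
    simp only [hscalar, map_smul, LinearMap.smul_apply, hQ.vanishes, smul_zero]
  have hvecsc : ∀ v, Q (spinVector B e v) (spinScalar e) = 0 := fun v => by
    have hpol : ∀ u, B v₁ v₁ * Q (spinVector B e u) (spinScalar e)
        + 2 * B u v₁ * Q (spinVector B e v₁) (spinScalar e) = 0 := fun u => by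
      have hu := hQ.two_one_one hC (e.symm (0, 1)) (e.symm (u, 0)) (e.symm (v₁, 0))
      simp only [apply_spin_unit_vec hC hB h, apply_spin_vec_vec hC hB h, map_smul,
        LinearMap.smul_apply, smul_eq_mul] at hu
      linear_combination 9 * hu
    have hself : Q (spinVector B e v₁) (spinScalar e) = 0 :=
      mul_left_cancel₀ hv₁ (by linear_combination hpol v₁ / 3)
    exact mul_left_cancel₀ hv₁ (by linear_combination hpol v - 2 * B v v₁ * hself)
  obtain ⟨v, μ, rfl⟩ := exists_eq_spinVector_add_smul_spinScalar hB' e φ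
  obtain ⟨w, ν, rfl⟩ := exists_eq_spinVector_add_smul_spinScalar hB' e ψ
  simp [hvecvec, hscalsc, hvecsc, hQ.symm (spinScalar e) (spinVector B e _)]

end Spin

/-! ## Cubic forms of Jordan algebras -/

section Composition

/-- The product of `A` is bilinear, and its conjugation and scalar part are linear. -/
structure IsBilinearConjAlgebra (A : Type) [AddCommGroup A] [Module ℂ A] [ConjAlgebra A] :
    Prop where
  mul_add : ∀ x y z : A, ConjAlgebra.mul x (y + z) = ConjAlgebra.mul x y + ConjAlgebra.mul x z
  add_mul : ∀ x y z : A, ConjAlgebra.mul (x + y) z = ConjAlgebra.mul x z + ConjAlgebra.mul y z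
  mul_smul : ∀ (a : ℂ) (x y : A), ConjAlgebra.mul x (a • y) = a • ConjAlgebra.mul x y
  smul_mul : ∀ (a : ℂ) (x y : A), ConjAlgebra.mul (a • x) y = a • ConjAlgebra.mul x y
  conj_add : ∀ x y : A, ConjAlgebra.conj (x + y) = ConjAlgebra.conj x + ConjAlgebra.conj y
  conj_smul : ∀ (a : ℂ) (x : A), ConjAlgebra.conj (a • x) = a • ConjAlgebra.conj x
  re_add : ∀ x y : A, ConjAlgebra.re (x + y) = ConjAlgebra.re x + ConjAlgebra.re y
  re_smul : ∀ (a : ℂ) (x : A), ConjAlgebra.re (a • x) = a * ConjAlgebra.re x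

/-- `re (x ȳ)` is a nondegenerate symmetric bilinear form, equal to `re (x̄ y)`. Multiplicativity of
the norm `x x̄` is not part of this notion. -/
structure HasCompositionForm (A : Type) [AddCommGroup A] [Module ℂ A] [ConjAlgebra A] : Prop
    extends IsBilinearConjAlgebra A where
  re_symm : ∀ x y : A, ConjAlgebra.re (ConjAlgebra.mul x (ConjAlgebra.conj y)) =
    ConjAlgebra.re (ConjAlgebra.mul y (ConjAlgebra.conj x))
  re_conj : ∀ x y : A, ConjAlgebra.re (ConjAlgebra.mul (ConjAlgebra.conj x) y) =
    ConjAlgebra.re (ConjAlgebra.mul x (ConjAlgebra.conj y))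
  nondegenerate : ∀ x : A,
    (∀ y : A, ConjAlgebra.re (ConjAlgebra.mul x (ConjAlgebra.conj y)) = 0) → x = 0

theorem hasCompositionForm_trivial : HasCompositionForm PUnit.{1} := by
  constructor <;> (try constructor) <;> intros <;> first | rfl | simp [ConjAlgebra.re]

theorem hasCompositionForm_complex : HasCompositionForm ℂ where
  mul_add := _root_.mul_add
  add_mul := _root_.add_mul
  mul_smul a x y := mul_left_comm x a y
  smul_mul a x y := mul_assoc a x y
  conj_add _ _ := rfl
  conj_smul _ _ := rfl
  re_add _ _ := rfl
  re_smul _ _ := rfl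
  re_symm x y := mul_comm x y
  re_conj _ _ := rfl
  nondegenerate x h := by simpa using (mul_one x).symm.trans (h 1)

instance finite_cayleyDickson (A : Type) [AddCommGroup A] [Module ℂ A] [Module.Finite ℂ A] :
    Module.Finite ℂ (CayleyDickson A) :=
  inferInstanceAs (Module.Finite ℂ (A × A))

variable {A : Type} [AddCommGroup A] [Module ℂ A] [ConjAlgebra A]

namespace IsBilinearConjAlgebra

variable (hA : IsBilinearConjAlgebra A)
include hA

theorem mul_neg (x y : A) : ConjAlgebra.mul x (-y) = -ConjAlgebra.mul x y := by
  simpa using hA.mul_smul (-1) x y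

theorem conj_neg (x : A) : ConjAlgebra.conj (-x) = -ConjAlgebra.conj x := by
  simpa using hA.conj_smul (-1) x

theorem neg_mul (x y : A) : ConjAlgebra.mul (-x) y = -ConjAlgebra.mul x y := by
  simpa using hA.smul_mul (-1) x y

theorem mul_zero (x : A) : ConjAlgebra.mul x (0 : A) = 0 := by
  simpa using hA.mul_smul 0 x 0

theorem zero_mul (x : A) : ConjAlgebra.mul (0 : A) x = 0 := by
  simpa using hA.smul_mul 0 0 x

theorem cayleyDickson : IsBilinearConjAlgebra (CayleyDickson A) where
  mul_add x y z := Prod.ext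
    (by
      change ConjAlgebra.mul x.1 (y.1 + z.1) - ConjAlgebra.mul (ConjAlgebra.conj (y.2 + z.2)) x.2 =
        (_ - _) + (_ - _)
      rw [hA.mul_add, hA.conj_add, hA.add_mul]; abel)
    (by
      change ConjAlgebra.mul (y.2 + z.2) x.1 + ConjAlgebra.mul x.2 (ConjAlgebra.conj (y.1 + z.1)) =
        (_ + _) + (_ + _)
      rw [hA.add_mul, hA.conj_add, hA.mul_add]; abel)
  add_mul x y z := Prod.ext
    (by
      change ConjAlgebra.mul (x.1 + y.1) z.1 - ConjAlgebra.mul (ConjAlgebra.conj z.2) (x.2 + y.2) =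
        (_ - _) + (_ - _)
      rw [hA.add_mul, hA.mul_add]; abel)
    (by
      change ConjAlgebra.mul z.2 (x.1 + y.1) + ConjAlgebra.mul (x.2 + y.2) (ConjAlgebra.conj z.1) =
        (_ + _) + (_ + _)
      rw [hA.add_mul, hA.mul_add]; abel)
  mul_smul a x y := Prod.ext
    ((congrArg₂ (· - ·) (hA.mul_smul a x.1 y.1)
      ((congrArg (ConjAlgebra.mul · x.2) (hA.conj_smul a y.2)).trans
        (hA.smul_mul a _ x.2))).trans (smul_sub a _ _).symm)
    ((congrArg₂ (· + ·) (hA.smul_mul a y.2 x.1)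
      ((congrArg (ConjAlgebra.mul x.2) (hA.conj_smul a y.1)).trans
        (hA.mul_smul a x.2 _))).trans (smul_add a _ _).symm)
  smul_mul a x y := Prod.ext
    ((congrArg₂ (· - ·) (hA.smul_mul a x.1 y.1) (hA.mul_smul a _ x.2)).trans (smul_sub a _ _).symm)
    ((congrArg₂ (· + ·) (hA.mul_smul a y.2 x.1) (hA.smul_mul a x.2 _)).trans (smul_add a _ _).symm)
  conj_add x y := Prod.ext (hA.conj_add x.1 y.1) (neg_add x.2 y.2)
  conj_smul a x := Prod.ext (hA.conj_smul a x.1) (smul_neg a x.2).symm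
  re_add x y := hA.re_add x.1 y.1
  re_smul a x := hA.re_smul a x.1

end IsBilinearConjAlgebra

namespace HasCompositionForm

/-- The symmetric bilinear form `re (x ȳ)`. -/
def form (hA : HasCompositionForm A) : LinearMap.BilinForm ℂ A :=
  LinearMap.mk₂ ℂ (fun x y => ConjAlgebra.re (ConjAlgebra.mul x (ConjAlgebra.conj y)))
    (fun x y z => by rw [hA.add_mul, hA.re_add])
    (fun a x y => by rw [hA.smul_mul, hA.re_smul, smul_eq_mul])
    (fun x y z => by rw [hA.conj_add, hA.mul_add, hA.re_add])
    (fun a x y => by rw [hA.conj_smul, hA.mul_smul, hA.re_smul, smul_eq_mul])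

variable (hA : HasCompositionForm A)

theorem form_apply (x y : A) :
    hA.form x y = ConjAlgebra.re (ConjAlgebra.mul x (ConjAlgebra.conj y)) := rfl

theorem compNorm_eq (x : A) : compNorm x = hA.form x x := rfl

theorem form_comm (x y : A) : hA.form x y = hA.form y x := hA.re_symm x y

theorem exists_form_eq [Module.Finite ℂ A] (χ : A →ₗ[ℂ] ℂ) : ∃ z, hA.form z = χ := by
  have hinj : Function.Injective hA.form :=
    (injective_iff_map_eq_zero _).2 fun x hx => hA.nondegenerate x fun y => LinearMap.congr_fun hx y
  exact (LinearMap.injective_iff_surjective_of_finrank_eq_finrank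
    (Subspace.dual_finrank_eq (K := ℂ) (V := A)).symm).1 hinj χ

include hA in
theorem re_mul_conj_cayleyDickson (x y : CayleyDickson A) :
    ConjAlgebra.re (ConjAlgebra.mul x (ConjAlgebra.conj y)) =
      ConjAlgebra.re (ConjAlgebra.mul x.1 (ConjAlgebra.conj y.1))
        + ConjAlgebra.re (ConjAlgebra.mul x.2 (ConjAlgebra.conj y.2)) := by
  change ConjAlgebra.re (ConjAlgebra.mul x.1 (ConjAlgebra.conj y.1)
    - ConjAlgebra.mul (ConjAlgebra.conj (-y.2)) x.2) = _
  rw [hA.conj_neg, hA.neg_mul, sub_neg_eq_add, hA.re_add, hA.re_conj, hA.re_symm y.2]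

include hA in
theorem cayleyDickson : HasCompositionForm (CayleyDickson A) where
  toIsBilinearConjAlgebra := hA.toIsBilinearConjAlgebra.cayleyDickson
  re_symm x y := by
    rw [hA.re_mul_conj_cayleyDickson, hA.re_mul_conj_cayleyDickson, hA.re_symm x.1, hA.re_symm x.2]
  re_conj x y := by
    rw [hA.re_mul_conj_cayleyDickson]
    change ConjAlgebra.re (ConjAlgebra.mul (ConjAlgebra.conj x.1) y.1
        - ConjAlgebra.mul (ConjAlgebra.conj y.2) (-x.2)) = _
    rw [hA.mul_neg, sub_neg_eq_add, hA.re_add, hA.re_conj, hA.re_conj, hA.re_symm y.2]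
  nondegenerate x h := by
    have hsum : ∀ y : A × A, ConjAlgebra.re (ConjAlgebra.mul x.1 (ConjAlgebra.conj y.1))
        + ConjAlgebra.re (ConjAlgebra.mul x.2 (ConjAlgebra.conj y.2)) = 0 := fun y =>
      (hA.re_mul_conj_cayleyDickson x y).symm.trans (h y)
    have hzero : ∀ z : A, ConjAlgebra.re (ConjAlgebra.mul z (ConjAlgebra.conj (0 : A))) = 0 :=
      fun z => map_zero (hA.form z)
    exact Prod.ext
      (hA.nondegenerate x.1 fun y => by simpa only [hzero, add_zero] using hsum (y, 0))
      (hA.nondegenerate x.2 fun y => by simpa only [hzero, zero_add] using hsum (0, y))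

end HasCompositionForm

end Composition

section Hermitian

variable {W : Type*} [AddCommGroup W] [Module ℂ W] {C : W →ₗ[ℂ] W →ₗ[ℂ] W →ₗ[ℂ] ℂ}
  {Q : (W →ₗ[ℂ] ℂ) →ₗ[ℂ] (W →ₗ[ℂ] ℂ) →ₗ[ℂ] ℂ}

/-- A Peirce frame of `C`: the diagonal elements `D i` and the off-diagonal elements `X i x` behave
under `C` like those of the `3 × 3` hermitian matrices, where `X i x` has the entry `x` at the
position in the two rows other than `i`. The indices of `D` in `exists_eq_sum` are taken
modulo `3`. -/
structure PeirceFrame {A : Type*} (C : W →ₗ[ℂ] W →ₗ[ℂ] W →ₗ[ℂ] ℂ) (D : Fin 3 → W)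
    (X : Fin 3 → A → W) : Prop where
  diag_diag : ∀ i, C (D i) (D i) = 0
  diag_off : ∀ {i j}, i ≠ j → ∀ x, C (D i) (X j x) = 0
  exists_eq_sum : ∀ χ : W →ₗ[ℂ] ℂ, ∃ (a : Fin 3 → ℂ) (z : Fin 3 → A),
    χ = ∑ i, (a i • C (D (i + 1)) (D (i + 2)) + C (D i) (X i (z i)))

namespace PeirceFrame

variable {A : Type*} {D : Fin 3 → W} {X : Fin 3 → A → W} (hDX : PeirceFrame C D X)
  (hC : IsSymmetricCubic C) (hQ : VanishesOnAdjoints C Q)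
include hDX hC hQ

theorem eq_zero_diag_diag (i j k l : Fin 3) : Q (C (D i) (D j)) (C (D k) (D l)) = 0 := by
  have hshared := fun i => hQ.eq_zero_of_apply_self_eq_zero hC (hDX.diag_diag i)
  have hindex : i = j ∨ k = l ∨ i = k ∨ i = l ∨ j = k ∨ j = l := by decide +revert
  rcases hindex with rfl | rfl | rfl | rfl | rfl | rfl
  · rw [hDX.diag_diag, map_zero, LinearMap.zero_apply]
  · rw [hDX.diag_diag, map_zero]
  · exact hshared i _ _
  · rw [hC.comm (D k)]
    exact hshared i _ _
  · rw [hC.comm (D i)]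
    exact hshared j _ _
  · rw [hC.comm (D i), hC.comm (D k)]
    exact hshared j _ _

theorem eq_zero_diag_off (i j k : Fin 3) (x : A) : Q (C (D i) (D j)) (C (D k) (X k x)) = 0 := by
  have hshared := fun i => hQ.eq_zero_of_apply_self_eq_zero hC (hDX.diag_diag i)
  by_cases hik : i = k
  · rw [hik]
    exact hshared k _ _
  by_cases hjk : j = k
  · rw [hjk, hC.comm (D i)]
    exact hshared k _ _
  have hpol := hQ.polarized hC (D i) (D j) (D k) (X k x)
  rwa [hDX.diag_off hik, hDX.diag_off hjk, map_zero, map_zero, LinearMap.zero_apply, add_zero,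
    add_zero] at hpol

theorem eq_zero_diag (i j : Fin 3) (χ : W →ₗ[ℂ] ℂ) : Q (C (D i) (D j)) χ = 0 := by
  obtain ⟨a, z, rfl⟩ := hDX.exists_eq_sum χ
  simp [hDX.eq_zero_diag_diag hC hQ, hDX.eq_zero_diag_off hC hQ]

theorem eq_zero_off_off (i j : Fin 3) (x y : A) :
    Q (C (D i) (X i x)) (C (D j) (X j y)) = 0 := by
  by_cases hij : i = j
  · rw [hij]
    exact hQ.eq_zero_of_apply_self_eq_zero hC (hDX.diag_diag j) _ _
  have hpol := hQ.polarized hC (D i) (X i x) (D j) (X j y)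
  rwa [hDX.eq_zero_diag hC hQ, hDX.diag_off hij, map_zero, LinearMap.zero_apply, add_zero,
    add_zero] at hpol

theorem eq_zero (φ ψ : W →ₗ[ℂ] ℂ) : Q φ ψ = 0 := by
  obtain ⟨a, z, rfl⟩ := hDX.exists_eq_sum φ
  obtain ⟨b, y, rfl⟩ := hDX.exists_eq_sum ψ
  simp [hDX.eq_zero_diag hC hQ, hDX.eq_zero_off_off hC hQ, hQ.symm _ (C (D (_ + 1)) (D (_ + 2)))]

end PeirceFrame

variable {A : Type} [AddCommGroup A] [Module ℂ A]

/-- The diagonal idempotents of the hermitian matrices. -/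
def hermDiag (A : Type) [AddCommGroup A] (i : Fin 3) : Herm3 A := (Pi.single i 1, 0)

/-- The off-diagonal element with entry `x` in the two rows other than `i`; in `Herm3` this entry
has the index `i.rev = 2 - i`. -/
def hermOff (i : Fin 3) (x : A) : Herm3 A := (0, Pi.single i.rev x)

theorem herm_decomposition (t : Herm3 A) :
    t = ∑ i, (t.1 i • hermDiag A i + hermOff i (t.2 i.rev)) := by
  refine Prod.ext (funext fun j => ?_) (funext fun j => ?_)
  · fin_cases j <;> simp [Fin.sum_univ_three, hermDiag, hermOff]
  · fin_cases j <;> simp [Fin.sum_univ_three, hermDiag, hermOff, Fin.rev]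

variable [ConjAlgebra A]

theorem hermDet_polarization (hA : HasCompositionForm A) (hC : IsSymmetricCubic C)
    (e : W ≃ₗ[ℂ] Herm3 A) (h : ∀ t, C t t t = hermDet (e t)) (r s t : Herm3 A) :
    6 * C (e.symm r) (e.symm s) (e.symm t) =
      r.1 0 * (s.1 1 * t.1 2 + t.1 1 * s.1 2 - 2 * hA.form (s.2 2) (t.2 2))
      + r.1 1 * (s.1 0 * t.1 2 + t.1 0 * s.1 2 - 2 * hA.form (s.2 1) (t.2 1))
      + r.1 2 * (s.1 0 * t.1 1 + t.1 0 * s.1 1 - 2 * hA.form (s.2 0) (t.2 0))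
      - 2 * (s.1 0 * hA.form (r.2 2) (t.2 2) + t.1 0 * hA.form (r.2 2) (s.2 2))
      - 2 * (s.1 1 * hA.form (r.2 1) (t.2 1) + t.1 1 * hA.form (r.2 1) (s.2 1))
      - 2 * (s.1 2 * hA.form (r.2 0) (t.2 0) + t.1 2 * hA.form (r.2 0) (s.2 0))
      + 2 * (hA.form (ConjAlgebra.mul (r.2 0) (s.2 2)) (t.2 1)
        + hA.form (ConjAlgebra.mul (r.2 0) (t.2 2)) (s.2 1)
        + hA.form (ConjAlgebra.mul (s.2 0) (r.2 2)) (t.2 1)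
        + hA.form (ConjAlgebra.mul (s.2 0) (t.2 2)) (r.2 1)
        + hA.form (ConjAlgebra.mul (t.2 0) (r.2 2)) (s.2 1)
        + hA.form (ConjAlgebra.mul (t.2 0) (s.2 2)) (r.2 1)) := by
  have := hC.polarization h (e.symm r) (e.symm s) (e.symm t)
  simp only [map_add, LinearEquiv.apply_symm_apply] at this
  rw [this]
  simp only [hermDet, hA.compNorm_eq, ← hA.form_apply]
  simp only [Prod.fst_add, Prod.snd_add, Pi.add_apply,
    map_add, LinearMap.add_apply, hA.mul_add, hA.add_mul, hA.form_comm (s.2 _) (r.2 _),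
    hA.form_comm (t.2 _) (r.2 _), hA.form_comm (t.2 _) (s.2 _)]
  ring

section

variable (hA : HasCompositionForm A) (hC : IsSymmetricCubic C) (e : W ≃ₗ[ℂ] Herm3 A)
  (h : ∀ t, C t t t = hermDet (e t))
include hA hC h

theorem apply_hermDiag_self (i : Fin 3) :
    C (e.symm (hermDiag A i)) (e.symm (hermDiag A i)) = 0 := by
  ext t
  obtain ⟨t, rfl⟩ := e.symm.surjective t
  have hpol := hermDet_polarization hA hC e h (hermDiag A i) (hermDiag A i) t
  fin_cases i <;> simpa [hermDiag, hA.mul_zero] using hpol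

theorem apply_hermDiag_hermDiag (i : Fin 3) (t : Herm3 A) :
    6 * C (e.symm (hermDiag A (i + 1))) (e.symm (hermDiag A (i + 2))) (e.symm t) = t.1 i := by
  rw [hermDet_polarization hA hC e h]
  fin_cases i <;> simp [hermDiag, hA.mul_zero, hA.zero_mul]

theorem apply_hermDiag_hermOff (i j : Fin 3) (x : A) (t : Herm3 A) :
    6 * C (e.symm (hermDiag A i)) (e.symm (hermOff j x)) (e.symm t) =
      if i = j then -2 * hA.form x (t.2 i.rev) else 0 := by
  rw [hermDet_polarization hA hC e h]
  fin_cases i <;> fin_cases j <;> simp [hermDiag, hermOff, Fin.rev, hA.mul_zero, hA.zero_mul]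

theorem peirceFrame_herm [Module.Finite ℂ A] :
    PeirceFrame C (fun i => e.symm (hermDiag A i)) (fun i x => e.symm (hermOff i x)) where
  diag_diag := apply_hermDiag_self hA hC e h
  diag_off {i j} hij x := by
    ext t
    obtain ⟨t, rfl⟩ := e.symm.surjective t
    simpa [hij] using apply_hermDiag_hermOff hA hC e h i j x t
  exists_eq_sum χ := by
    have hz : ∀ i, ∃ z, ∀ x, hA.form z x = -3 * χ (e.symm (hermOff i x)) := fun i => by
      let χ' : A →ₗ[ℂ] ℂ := (-3 : ℂ) • χ ∘ₗ e.symm.toLinearMap ∘ₗ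
        LinearMap.inr ℂ _ _ ∘ₗ LinearMap.single ℂ (fun _ => A) i.rev
      exact (hA.exists_form_eq χ').imp fun z hz => LinearMap.congr_fun hz
    choose z hz using hz
    refine ⟨fun i => 6 * χ (e.symm (hermDiag A i)), z, LinearMap.ext fun t => ?_⟩
    obtain ⟨t, rfl⟩ := e.symm.surjective t
    conv_lhs => rw [herm_decomposition t, map_sum, map_sum]
    rw [LinearMap.sum_apply]
    refine Finset.sum_congr rfl fun i _ => ?_
    have hoff := apply_hermDiag_hermOff hA hC e h i i (z i) t
    rw [if_pos rfl] at hoff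
    simp only [LinearMap.add_apply, LinearMap.smul_apply, smul_eq_mul, map_add, map_smul]
    linear_combination -χ (e.symm (hermDiag A i)) * apply_hermDiag_hermDiag hA hC e h i t
      - hoff / 6 + hz i (t.2 i.rev) / 3

end

end Hermitian

section JordanCubics

variable {W : Type*} [AddCommGroup W] [Module ℂ W] {C : W →ₗ[ℂ] W →ₗ[ℂ] W →ₗ[ℂ] ℂ}

theorem IsJordanCubicForm.adjointsOnNoQuadric (hC : IsJordanCubicForm C) :
    AdjointsOnNoQuadric C := by
  have hsymm : IsSymmetricCubic C := ⟨hC.swap_left, hC.swap_right⟩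
  have hherm : ∀ {A : Type} [AddCommGroup A] [Module ℂ A] [ConjAlgebra A] [Module.Finite ℂ A],
      HasCompositionForm A → ∀ e : W ≃ₗ[ℂ] Herm3 A, (∀ t, C t t t = hermDet (e t)) →
      AdjointsOnNoQuadric C := fun hA e h =>
    ⟨hsymm, fun _ hQ => (peirceFrame_herm hA hsymm e h).eq_zero hsymm hQ⟩
  have hcomplex := hasCompositionForm_complex
  rcases hC.cubic with
    ⟨e, h⟩ | ⟨m, hm, B, hB, hB', e, h⟩ | ⟨e, h⟩ | ⟨e, h⟩ | ⟨e, h⟩ | ⟨e, h⟩ | ⟨e, h⟩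
  · exact ⟨hsymm, fun _ hQ => hQ.eq_zero_of_line e h⟩
  · have : Nontrivial (Fin m → ℂ) := have : NeZero m := ⟨by lia⟩; inferInstance
    exact ⟨hsymm, fun _ hQ => hQ.eq_zero_of_spin hsymm hB hB' h⟩
  · exact hherm hasCompositionForm_trivial e h
  · exact hherm hcomplex e h
  · exact hherm hcomplex.cayleyDickson e h
  · exact hherm hcomplex.cayleyDickson.cayleyDickson e h
  · exact hherm hcomplex.cayleyDickson.cayleyDickson.cayleyDickson e h

end JordanCubics

namespace AdjointsOnNoQuadric

variable {W : Type*} [AddCommGroup W] [Module ℂ W] {C : W →ₗ[ℂ] W →ₗ[ℂ] W →ₗ[ℂ] ℂ}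

theorem nondegenerate (hC : AdjointsOnNoQuadric C) {w : W} (hw : ∀ t, C t t w = 0) : w = 0 := by
  let ev : (W →ₗ[ℂ] ℂ) →ₗ[ℂ] ℂ := Module.Dual.eval ℂ W w
  have hQ : VanishesOnAdjoints C (ev.smulRight ev) := ⟨fun φ ψ => mul_comm _ _, fun t => by
    change C t t w * C t t w = 0
    rw [hw, mul_zero]⟩
  exact (Module.forall_dual_apply_eq_zero_iff ℂ w).1 fun φ =>
    mul_self_eq_zero.1 (hC.eq_zero _ hQ φ φ)

theorem exists_ne_zero (hC : AdjointsOnNoQuadric C) [Nontrivial W] : ∃ t, C t t t ≠ 0 := by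
  by_contra! h
  obtain ⟨w, hw⟩ := exists_ne (0 : W)
  exact hw (hC.nondegenerate fun t => by simpa using hC.polarization h t t w)

variable [Module.Finite ℂ W] {H : Type*} [AddCommGroup H] [Module ℂ H]
  {L : (W →ₗ[ℂ] ℂ) →ₗ[ℂ] H}

theorem linearMap_ext (hC : AdjointsOnNoQuadric C) (hL : ∀ t, L (C t t) = 0)
    (φ : W →ₗ[ℂ] ℂ) : L φ = 0 := by
  rw [← Module.forall_dual_apply_eq_zero_iff ℂ]
  intro χ
  obtain ⟨w, hw⟩ := (Module.evalEquiv ℂ W).surjective (χ ∘ₗ L)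
  have hχL : ∀ φ : W →ₗ[ℂ] ℂ, φ w = χ (L φ) := LinearMap.congr_fun hw
  have hw0 : w = 0 := hC.nondegenerate fun t => by rw [hχL, hL, map_zero]
  rw [← hχL, hw0, map_zero]

theorem linearMap_ext_of_smul (hC : AdjointsOnNoQuadric C) [Nontrivial W]
    (hL : ∀ t, C t t t • L (C t t) = 0) (φ : W →ₗ[ℂ] ℂ) : L φ = 0 := by
  obtain ⟨t₀, ht₀⟩ := hC.exists_ne_zero
  refine hC.linearMap_ext (fun t => (Module.forall_dual_apply_eq_zero_iff ℂ _).1 fun χ => ?_) φ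
  -- On the line through `t` and `t₀`, the product of the cubic `p` and the quadric `q` vanishes.
  let p : Cubic ℂ := ⟨C t₀ t₀ t₀, 3 * C t t₀ t₀, 3 * C t t t₀, C t t t⟩
  let q : Cubic ℂ := ⟨0, χ (L (C t₀ t₀)), 2 * χ (L (C t t₀)), χ (L (C t t))⟩
  have hpq : p.toPoly * q.toPoly = 0 := Polynomial.funext fun l => by
    have hl := congrArg χ (hL (t + l • t₀))
    simp only [map_add, map_smul, LinearMap.add_apply, LinearMap.smul_apply, hC.comm t₀ t,
      hC.swap_right t t₀ t, hC.swap_right t₀ t₀ t, smul_eq_mul, map_zero] at hl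
    simp only [p, q, Cubic.toPoly, Polynomial.eval_mul, Polynomial.eval_add, Polynomial.eval_C,
      Polynomial.eval_X, Polynomial.eval_pow, Polynomial.eval_zero]
    linear_combination hl
  have hq : q.toPoly = 0 := (mul_eq_zero.1 hpq).resolve_left (Cubic.ne_zero_of_a_ne_zero ht₀)
  exact congrArg Cubic.d ((Cubic.toPoly_eq_zero_iff q).1 hq)

end AdjointsOnNoQuadric

/-! ## The equation of the generating functions -/

section Polynomials

theorem eq_zero_of_forall_sum_pow_smul_eq_zero {H : Type*} [AddCommGroup H] [Module ℂ H] {n : ℕ}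
    {a : Fin n → H} (h : ∀ l : ℂ, ∑ i : Fin n, l ^ (i : ℕ) • a i = 0) (i : Fin n) : a i = 0 := by
  rw [← Module.forall_dual_apply_eq_zero_iff ℂ]
  intro χ
  let p : Polynomial ℂ := ∑ j : Fin n, Polynomial.C (χ (a j)) * Polynomial.X ^ (j : ℕ)
  have hp : p = 0 := Polynomial.funext fun l => by
    have := congrArg χ (h l)
    simp only [map_sum, map_smul, map_zero, smul_eq_mul] at this
    simp only [p, Polynomial.eval_finsetSum, Polynomial.eval_mul, Polynomial.eval_C,
      Polynomial.eval_pow, Polynomial.eval_X, Polynomial.eval_zero]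
    rw [← this]
    exact Finset.sum_congr rfl fun j _ => mul_comm _ _
  have hc : p.coeff i = χ (a i) := by
    simp only [p, Polynomial.finsetSum_coeff, Polynomial.coeff_C_mul, Polynomial.coeff_X_pow]
    rw [Finset.sum_eq_single i]
    · simp
    · intro j _ hj
      simp [Fin.val_inj, hj.symm]
    · simp
  rw [← hc, hp, Polynomial.coeff_zero]

end Polynomials

section Frame

variable {W : Type*} [AddCommGroup W] [Module ℂ W]

theorem nontrivial_of_apply_eq_one {κ : W →ₗ[ℂ] ℂ} {e : W} (he : κ e = 1) : Nontrivial W :=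
  ⟨e, 0, fun h => by simp [h] at he⟩

/-- Operators on a complex vector space with the commutation relations of the frame
`X_0, X_a, ∂_{u_0}, ∂_{u_a}, ∂_u`. -/
structure ContactFrame (κ : W →ₗ[ℂ] ℂ) (H : Type*) [AddCommGroup H] [Module ℂ H] where
  X0 : H →ₗ[ℂ] H
  U0 : H →ₗ[ℂ] H
  Z : H →ₗ[ℂ] H
  X : W →ₗ[ℂ] H →ₗ[ℂ] H
  U : (W →ₗ[ℂ] ℂ) →ₗ[ℂ] H →ₗ[ℂ] H
  X_X0 : ∀ t h, X t (X0 h) = X0 (X t h) + κ t • U0 h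
  U0_X0 : ∀ h, U0 (X0 h) = X0 (U0 h) + Z h
  U_X : ∀ φ t h, U φ (X t h) = X t (U φ h) + φ t • Z h
  X_X : ∀ s t h, X s (X t h) = X t (X s h)
  U_U : ∀ φ ψ h, U φ (U ψ h) = U ψ (U φ h)
  U0_U : ∀ φ h, U0 (U φ h) = U φ (U0 h)
  U_X0 : ∀ φ h, U φ (X0 h) = X0 (U φ h)
  U0_X : ∀ t h, U0 (X t h) = X t (U0 h)
  Z_X0 : ∀ h, Z (X0 h) = X0 (Z h)
  Z_X : ∀ t h, Z (X t h) = X t (Z h)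
  Z_U0 : ∀ h, Z (U0 h) = U0 (Z h)
  Z_U : ∀ φ h, Z (U φ h) = U φ (Z h)

namespace ContactFrame

section Operators

variable {κ : W →ₗ[ℂ] ℂ} {H : Type*} [AddCommGroup H] [Module ℂ H] (𝓕 : ContactFrame κ H)

/-- The operator of the vector field `V(l, t)`. -/
noncomputable def V (C : W →ₗ[ℂ] W →ₗ[ℂ] W →ₗ[ℂ] ℂ) (l : ℂ) (t : W) : H →ₗ[ℂ] H :=
  l ^ 3 • 𝓕.X0 - l ^ 2 • 𝓕.X t - (1 / 2 * C t t t) • 𝓕.U0 - (3 / 2 * l) • 𝓕.U (C t t)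

/-- The equation of the generating functions of symmetries. -/
def IsSolution (C : W →ₗ[ℂ] W →ₗ[ℂ] W →ₗ[ℂ] ℂ) (f : H) : Prop :=
  ∀ l t, 𝓕.V C l t (𝓕.V C l t f) + (l ^ 5 * κ t) • 𝓕.U0 f + l ^ 6 • 𝓕.U κ f = 0

/-- The vertical second derivatives of `f`, seen through the functional `χ`, as a bilinear form on
the dual space of `W`. -/
def hessian (χ : H →ₗ[ℂ] ℂ) (f : H) : (W →ₗ[ℂ] ℂ) →ₗ[ℂ] (W →ₗ[ℂ] ℂ) →ₗ[ℂ] ℂ :=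
  LinearMap.mk₂ ℂ (fun φ ψ => χ (𝓕.U φ (𝓕.U ψ f))) (by simp) (by simp) (by simp) (by simp)

theorem hessian_apply (χ : H →ₗ[ℂ] ℂ) (f : H) (φ ψ : W →ₗ[ℂ] ℂ) :
    𝓕.hessian χ f φ ψ = χ (𝓕.U φ (𝓕.U ψ f)) := rfl

theorem hessian_comm (χ : H →ₗ[ℂ] ℂ) (f : H) (φ ψ : W →ₗ[ℂ] ℂ) :
    𝓕.hessian χ f φ ψ = 𝓕.hessian χ f ψ φ := congrArg χ (𝓕.U_U φ ψ f)

end Operators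

end ContactFrame

theorem IsSymmetricCubic.eq_zero_of_forall_form [Module.Finite ℂ W]
    {C : W →ₗ[ℂ] W →ₗ[ℂ] W →ₗ[ℂ] ℂ} (hC : IsSymmetricCubic C) {κ : W →ₗ[ℂ] ℂ} {e : W}
    (he : κ e = 1) {Q : (W →ₗ[ℂ] ℂ) →ₗ[ℂ] (W →ₗ[ℂ] ℂ) →ₗ[ℂ] ℂ} (hQ : ∀ φ ψ, Q φ ψ = Q ψ φ)
    {σ : ℂ} (hκ : ∀ s t, 3 * Q (C s t) κ = κ s * κ t * σ)
    (hdiag : ∀ t, C t t t * κ t * σ + 9 / 4 * Q (C t t) (C t t) = 0) : σ = 0 := by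
  -- The functional `3 Q(·, κ)` is the evaluation at some `w`; compare `hdiag` along `e + a w`.
  obtain ⟨w, hw⟩ : ∃ w : W, ∀ φ : W →ₗ[ℂ] ℂ, φ w = 3 * Q φ κ := by
    obtain ⟨w, hw⟩ := (Module.evalEquiv ℂ W).surjective ((3 : ℂ) • Q.flip κ)
    exact ⟨w, LinearMap.congr_fun hw⟩
  have hCw : ∀ t, C t w = (σ * κ t) • κ := fun t => by
    ext s
    rw [hC.swap_right, hw, hκ, LinearMap.smul_apply, smul_eq_mul]
    ring
  have hQκ : Q κ κ = κ w / 3 := by rw [hw]; ring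
  have hQe : Q (C e e) κ = σ / 3 := by
    have h := hκ e e
    rw [he] at h
    linear_combination h / 3
  have hCe : C e e w = σ := by rw [hw, hQe]; ring
  have hσw : σ * κ w = 0 := by
    have h := hdiag w
    simp only [hCw, map_smul, LinearMap.smul_apply, smul_eq_mul, hQκ] at h
    rcases mul_eq_zero.1 (show σ ^ 2 * κ w ^ 3 = 0 by linear_combination 4 / 7 * h) with h | h
    · rw [pow_eq_zero_iff two_ne_zero |>.1 h, zero_mul]
    · rw [pow_eq_zero_iff three_ne_zero |>.1 h, mul_zero]
  have hline : ∀ a : ℂ, C e e e * σ + 9 / 4 * Q (C e e) (C e e) + 6 * a * σ ^ 2 = 0 := fun a => by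
    have h := hdiag (e + a • w)
    simp only [map_add, map_smul, LinearMap.add_apply, LinearMap.smul_apply, hC.comm w, hCw, hCe,
      smul_eq_mul, hQ κ (C e e), hQκ, hQe, he] at h
    linear_combination h - (C e e e * a + (3 * a ^ 2 + a ^ 3 * κ w) * (1 + a * κ w) * σ
      + 9 / 2 * a ^ 2 * σ + 3 / 4 * (2 * a + a ^ 2 * κ w) ^ 2 * σ) * hσw
  have h : σ ^ 2 = 0 := by linear_combination (hline 1 - hline 0) / 6
  exact pow_eq_zero_iff two_ne_zero |>.1 h

namespace ContactFrame.IsSolution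

variable {κ : W →ₗ[ℂ] ℂ} {H : Type*} [AddCommGroup H] [Module ℂ H] {𝓕 : ContactFrame κ H}
  {C : W →ₗ[ℂ] W →ₗ[ℂ] W →ₗ[ℂ] ℂ} {f : H}

section Coefficients

variable (hf : 𝓕.IsSolution C f)
include hf

theorem coefficients (t : W) (i : Fin 7) :
    ![(1 / 4 * (C t t t) ^ 2) • 𝓕.U0 (𝓕.U0 f), (3 / 2 * C t t t) • 𝓕.U (C t t) (𝓕.U0 f),
      C t t t • 𝓕.X t (𝓕.U0 f) + (9 / 4 : ℂ) • 𝓕.U (C t t) (𝓕.U (C t t) f),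
      (3 : ℂ) • 𝓕.X t (𝓕.U (C t t) f) - C t t t • (𝓕.X0 (𝓕.U0 f) - 𝓕.Z f),
      𝓕.X t (𝓕.X t f) - (3 : ℂ) • 𝓕.X0 (𝓕.U (C t t) f),
      -(2 : ℂ) • 𝓕.X0 (𝓕.X t f), 𝓕.X0 (𝓕.X0 f) + 𝓕.U κ f] i = 0 := by
  refine eq_zero_of_forall_sum_pow_smul_eq_zero (fun l => ?_) i
  rw [← hf l t]
  simp only [V, LinearMap.sub_apply, LinearMap.smul_apply, map_sub, map_smul, 𝓕.X_X0, 𝓕.U0_X0,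
    𝓕.U_X, 𝓕.U0_U, 𝓕.U_X0, 𝓕.U0_X, Fin.sum_univ_succ, Fin.sum_univ_zero, Matrix.cons_val_zero,
    Matrix.cons_val_succ, Fin.val_zero, Fin.val_succ]
  module

theorem X0_X0 : 𝓕.X0 (𝓕.X0 f) = -𝓕.U κ f :=
  eq_neg_of_add_eq_zero_left (hf.coefficients 0 6)

theorem X0_X (t : W) : 𝓕.X0 (𝓕.X t f) = 0 :=
  (smul_eq_zero.1 (hf.coefficients t 5)).resolve_left (neg_ne_zero.2 two_ne_zero)

theorem X_X_self (t : W) : 𝓕.X t (𝓕.X t f) = (3 : ℂ) • 𝓕.X0 (𝓕.U (C t t) f) :=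
  sub_eq_zero.1 (hf.coefficients t 4)

theorem X_U_self (t : W) :
    (3 : ℂ) • 𝓕.X t (𝓕.U (C t t) f) = C t t t • (𝓕.X0 (𝓕.U0 f) - 𝓕.Z f) :=
  sub_eq_zero.1 (hf.coefficients t 3)

theorem X_U0_add_U_U_self (t : W) :
    C t t t • 𝓕.X t (𝓕.U0 f) + (9 / 4 : ℂ) • 𝓕.U (C t t) (𝓕.U (C t t) f) = 0 :=
  hf.coefficients t 2

theorem smul_U_U0_self (t : W) : C t t t • 𝓕.U (C t t) (𝓕.U0 f) = 0 := by
  have h : (3 / 2 * C t t t) • 𝓕.U (C t t) (𝓕.U0 f) = 0 := hf.coefficients t 1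
  rw [mul_smul] at h
  exact (smul_eq_zero.1 h).resolve_left (by norm_num)

theorem smul_U0_U0 (t : W) : C t t t ^ 2 • 𝓕.U0 (𝓕.U0 f) = 0 := by
  have h : (1 / 4 * C t t t ^ 2) • 𝓕.U0 (𝓕.U0 f) = 0 := hf.coefficients t 0
  rw [mul_smul] at h
  exact (smul_eq_zero.1 h).resolve_left (by norm_num)

theorem X_X0 (t : W) : 𝓕.X t (𝓕.X0 f) = κ t • 𝓕.U0 f := by
  rw [𝓕.X_X0, hf.X0_X, zero_add]

theorem X_U0_eq {e : W} (he : κ e = 1) (s : W) : 𝓕.X s (𝓕.U0 f) = κ s • 𝓕.X e (𝓕.U0 f) := by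
  have h := 𝓕.X_X s e (𝓕.X0 f)
  rwa [hf.X_X0, hf.X_X0, map_smul, map_smul, he, one_smul] at h

theorem X_Uκ (t : W) :
    𝓕.X t (𝓕.U κ f) = -(κ t • ((2 : ℂ) • 𝓕.X0 (𝓕.U0 f) + 𝓕.Z f)) := by
  have h := congrArg (𝓕.X t) hf.X0_X0
  rw [𝓕.X_X0, 𝓕.U0_X0, hf.X_X0, map_smul, map_neg] at h
  linear_combination (norm := module) h

end Coefficients

section Polarized

variable (hC : IsSymmetricCubic C) (hf : 𝓕.IsSolution C f)
include hC hf

theorem X_X (s t : W) : 𝓕.X s (𝓕.X t f) = (3 : ℂ) • 𝓕.X0 (𝓕.U (C s t) f) := by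
  have h := hf.X_X_self (s + t)
  simp only [map_add, LinearMap.add_apply, hC.comm t s, 𝓕.X_X t s] at h
  linear_combination (norm := module) (1 / 2 : ℂ) • (h - hf.X_X_self s - hf.X_X_self t)

theorem U_U_eq {e : W} (he : κ e = 1) (s t : W) :
    (3 : ℂ) • 𝓕.U (C s t) (𝓕.U κ f) = (κ s * κ t) • 𝓕.X e (𝓕.U0 f) := by
  have h := congrArg 𝓕.X0 (hf.X_X hC s t)
  have hXX : 𝓕.X0 (𝓕.X s (𝓕.X t f)) = -((κ s * κ t) • 𝓕.X e (𝓕.U0 f)) := by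
    have hcomm := 𝓕.X_X0 s (𝓕.X t f)
    rw [hf.X0_X, map_zero, 𝓕.U0_X, hf.X_U0_eq he t, smul_smul] at hcomm
    exact eq_neg_of_add_eq_zero_left hcomm.symm
  rw [hXX, map_smul, ← 𝓕.U_X0, ← 𝓕.U_X0, hf.X0_X0, map_neg] at h
  linear_combination (norm := module) h

theorem X_U_polarized (r s t : W) :
    𝓕.X r (𝓕.U (C s t) f) + 𝓕.X s (𝓕.U (C r t) f) + 𝓕.X t (𝓕.U (C r s) f) =
      C r s t • (𝓕.X0 (𝓕.U0 f) - 𝓕.Z f) := by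
  have key : ∀ s t, (2 : ℂ) • 𝓕.X t (𝓕.U (C t s) f) + 𝓕.X s (𝓕.U (C t t) f) =
      C t t s • (𝓕.X0 (𝓕.U0 f) - 𝓕.Z f) := fun s t => by
    have h1 := hf.X_U_self (t + s)
    have h2 := hf.X_U_self (t - s)
    have h3 := hf.X_U_self s
    simp only [map_add, map_sub, LinearMap.add_apply, LinearMap.sub_apply, hC.comm s t,
      hC.swap_right t s t, hC.swap_right s s t] at h1 h2
    linear_combination (norm := module) (1 / 6 : ℂ) • h1 - (1 / 6 : ℂ) • h2 - (1 / 3 : ℂ) • h3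
  have h1 := key t (r + s)
  have h2 := key t r
  have h3 := key t s
  simp only [map_add, LinearMap.add_apply, hC.comm s r] at h1
  linear_combination (norm := module) (1 / 2 : ℂ) • h1 - (1 / 2 : ℂ) • h2 - (1 / 2 : ℂ) • h3

end Polarized

variable (hC : AdjointsOnNoQuadric C) {e : W} (he : κ e = 1) (hf : 𝓕.IsSolution C f)
include hC he hf

theorem U0_U0 : 𝓕.U0 (𝓕.U0 f) = 0 := by
  have := nontrivial_of_apply_eq_one he
  obtain ⟨t, ht⟩ := hC.exists_ne_zero
  exact (smul_eq_zero.1 (hf.smul_U0_U0 t)).resolve_left (pow_ne_zero 2 ht)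

variable [Module.Finite ℂ W]

theorem U_U0 (φ : W →ₗ[ℂ] ℂ) : 𝓕.U φ (𝓕.U0 f) = 0 := by
  have := nontrivial_of_apply_eq_one he
  exact hC.linearMap_ext_of_smul (L := 𝓕.U.flip (𝓕.U0 f)) hf.smul_U_U0_self φ

theorem X_U0 (s : W) : 𝓕.X s (𝓕.U0 f) = 0 := by
  rw [hf.X_U0_eq he, (Module.forall_dual_apply_eq_zero_iff ℂ (𝓕.X e (𝓕.U0 f))).1, smul_zero]
  refine fun χ => hC.eq_zero_of_forall_form he (𝓕.hessian_comm χ f) (fun s t => ?_) fun t => ?_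
  · simpa [hessian_apply] using congrArg χ (hf.U_U_eq hC.toIsSymmetricCubic he s t)
  · have h := congrArg χ (hf.X_U0_add_U_U_self t)
    rw [hf.X_U0_eq he t, smul_smul] at h
    simpa [hessian_apply] using h

theorem Z_U0 : 𝓕.Z (𝓕.U0 f) = 0 := by
  have h := 𝓕.U_X κ e (𝓕.U0 f)
  rw [hf.X_U0 hC he, hf.U_U0 hC he, map_zero, map_zero, he, one_smul, zero_add] at h
  exact h.symm

theorem U_Uκ (φ : W →ₗ[ℂ] ℂ) : 𝓕.U φ (𝓕.U κ f) = 0 := by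
  refine hC.linearMap_ext (L := 𝓕.U.flip (𝓕.U κ f)) (fun t => ?_) φ
  have h := hf.U_U_eq hC.toIsSymmetricCubic he t t
  rw [hf.X_U0 hC he, smul_zero] at h
  exact (smul_eq_zero.1 h).resolve_left three_ne_zero

theorem Z_U (φ : W →ₗ[ℂ] ℂ) : 𝓕.Z (𝓕.U φ f) = 0 := by
  refine hC.linearMap_ext (L := 𝓕.Z ∘ₗ 𝓕.U.flip f) (fun t => ?_) φ
  have h := congrArg 𝓕.U0 (hf.X_X hC.toIsSymmetricCubic t t)
  rw [𝓕.U0_X, 𝓕.U0_X, hf.X_U0 hC he, map_zero, map_smul, 𝓕.U0_X0, 𝓕.U0_U, hf.U_U0 hC he,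
    map_zero, zero_add] at h
  exact (smul_eq_zero.1 h.symm).resolve_left three_ne_zero

theorem U_U (φ ψ : W →ₗ[ℂ] ℂ) : 𝓕.U φ (𝓕.U ψ f) = 0 := by
  rw [← Module.forall_dual_apply_eq_zero_iff ℂ]
  intro χ
  refine hC.eq_zero (𝓕.hessian χ f) ⟨𝓕.hessian_comm χ f, fun t => ?_⟩ φ ψ
  have h := hf.X_U0_add_U_U_self t
  rw [hf.X_U0 hC he, smul_zero, zero_add] at h
  rw [hessian_apply, (smul_eq_zero.1 h).resolve_left (by norm_num), map_zero]

theorem U0_Z : 𝓕.U0 (𝓕.Z f) = 0 := by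
  rw [← 𝓕.Z_U0, hf.Z_U0 hC he]

theorem U_Z (φ : W →ₗ[ℂ] ℂ) : 𝓕.U φ (𝓕.Z f) = 0 := by
  rw [← 𝓕.Z_U, hf.Z_U hC he]

theorem Z_Z : 𝓕.Z (𝓕.Z f) = 0 := by
  have := nontrivial_of_apply_eq_one he
  obtain ⟨t, ht⟩ := hC.exists_ne_zero
  have h := congrArg 𝓕.Z (hf.X_U_self t)
  rw [map_smul, map_smul, 𝓕.Z_X, hf.Z_U hC he, map_zero, smul_zero, map_sub, 𝓕.Z_X0,
    hf.Z_U0 hC he, map_zero, zero_sub, smul_neg, eq_comm, neg_eq_zero] at h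
  exact (smul_eq_zero.1 h).resolve_left ht

theorem X_Z (t : W) : 𝓕.X t (𝓕.Z f) = 0 := by
  have h := congrArg 𝓕.U0 (hf.X0_X t)
  rwa [𝓕.U0_X0, 𝓕.U0_X, hf.X_U0 hC he, map_zero, map_zero, 𝓕.Z_X, zero_add] at h

theorem X0_X0_U0_eq : 𝓕.X0 (𝓕.X0 (𝓕.U0 f)) + (2 : ℂ) • 𝓕.X0 (𝓕.Z f) = 0 := by
  have h := congrArg 𝓕.U0 hf.X0_X0
  rw [𝓕.U0_X0, 𝓕.U0_X0, map_add, map_neg, 𝓕.U0_U, hf.U_U0 hC he, 𝓕.Z_X0, neg_zero] at h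
  linear_combination (norm := module) h

theorem X0_Z : 𝓕.X0 (𝓕.Z f) = 0 := by
  have h1 := congrArg 𝓕.X0 (hf.X_Uκ e)
  have h2 := congrArg (𝓕.U κ) (hf.X0_X e)
  rw [𝓕.U_X0, 𝓕.U_X, map_add, map_zero, he, one_smul] at h2
  rw [he, one_smul, map_neg, map_add, map_smul] at h1
  have h3 := hf.X0_X0_U0_eq hC he
  have h4 : (4 : ℂ) • 𝓕.X0 (𝓕.Z f) = 0 := by
    linear_combination (norm := module) h2 - h1 + (2 : ℂ) • h3
  exact (smul_eq_zero.1 h4).resolve_left (by norm_num)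

theorem X0_X0_U0 : 𝓕.X0 (𝓕.X0 (𝓕.U0 f)) = 0 := by
  simpa [hf.X0_Z hC he] using hf.X0_X0_U0_eq hC he

theorem X0_X_U (t : W) (φ : W →ₗ[ℂ] ℂ) : 𝓕.X0 (𝓕.X t (𝓕.U φ f)) = 0 := by
  have h := congrArg (𝓕.U φ) (hf.X0_X t)
  rwa [𝓕.U_X0, 𝓕.U_X, map_add, map_smul, hf.X0_Z hC he, smul_zero, add_zero, map_zero] at h

theorem X0_X0_U (φ : W →ₗ[ℂ] ℂ) : 𝓕.X0 (𝓕.X0 (𝓕.U φ f)) = 0 := by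
  have h := congrArg (𝓕.U φ) hf.X0_X0
  rwa [𝓕.U_X0, 𝓕.U_X0, map_neg, hf.U_Uκ hC he, neg_zero] at h

theorem X_X_U (s t : W) (φ : W →ₗ[ℂ] ℂ) : 𝓕.X s (𝓕.X t (𝓕.U φ f)) = 0 := by
  have h := congrArg (𝓕.U φ) (hf.X_X hC.toIsSymmetricCubic s t)
  rwa [𝓕.U_X, 𝓕.U_X, map_add, map_smul, map_smul, 𝓕.Z_X, hf.X_Z hC he, smul_zero, add_zero,
    hf.X_Z hC he, smul_zero, add_zero, 𝓕.U_X0, hf.U_U hC he, map_zero, smul_zero] at h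

theorem X_X0_U (t : W) (φ : W →ₗ[ℂ] ℂ) : 𝓕.X t (𝓕.X0 (𝓕.U φ f)) = 0 := by
  rw [𝓕.X_X0, hf.X0_X_U hC he, 𝓕.U0_U, hf.U_U0 hC he, smul_zero, zero_add]

end ContactFrame.IsSolution

end Frame

/-! ## Derivations of the holomorphic functions on the jet space -/

open TopologicalSpace (Opens)

section Holomorphic

variable {E : Type*} [NormedAddCommGroup E] [NormedSpace ℂ E]

/-- The algebra of holomorphic functions on an open set. -/
def HolFun (U : Opens E) : Subalgebra ℂ (U → ℂ) where
  carrier := {F | ∃ f : E → ℂ, DifferentiableOn ℂ f U ∧ ∀ m : U, F m = f m}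
  mul_mem' := by
    rintro F G ⟨f, hf, hF⟩ ⟨g, hg, hG⟩
    exact ⟨fun m => f m * g m, hf.fun_mul hg, fun m => by rw [Pi.mul_apply, hF, hG]⟩
  add_mem' := by
    rintro F G ⟨f, hf, hF⟩ ⟨g, hg, hG⟩
    exact ⟨fun m => f m + g m, hf.fun_add hg, fun m => by rw [Pi.add_apply, hF, hG]⟩
  algebraMap_mem' a := ⟨fun _ => a, differentiableOn_const a, fun _ => rfl⟩

namespace HolFun

variable {U : Opens E}

/-- The restriction to `U` of a function that is holomorphic on `U`. -/
def mk (f : E → ℂ) (hf : DifferentiableOn ℂ f U) : HolFun U := ⟨fun m => f m, f, hf, fun _ => rfl⟩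

@[simp] theorem mk_apply (f : E → ℂ) (hf : DifferentiableOn ℂ f U) (m : U) :
    (mk f hf).1 m = f m := rfl

theorem exists_eq_mk (F : HolFun U) : ∃ f, ∃ hf : DifferentiableOn ℂ f U, F = mk f hf := by
  obtain ⟨F, f, hf, h⟩ := F
  exact ⟨f, hf, Subtype.ext (funext h)⟩

/-- The extension by zero. -/
noncomputable def extend (F : HolFun U) : E → ℂ := Function.extend Subtype.val F.1 0

theorem extend_apply (F : HolFun U) (m : U) : (extend F) m = F.1 m :=
  Subtype.val_injective.extend_apply _ _ _

theorem fderiv_extend_mk {f : E → ℂ} (hf : DifferentiableOn ℂ f U) {m : E} (hm : m ∈ U) :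
    fderiv ℂ (extend (mk f hf)) m = fderiv ℂ f m := by
  refine Filter.EventuallyEq.fderiv_eq ?_
  filter_upwards [U.isOpen.mem_nhds hm] with x hx using extend_apply (mk f hf) ⟨x, hx⟩

theorem differentiableOn_extend (F : HolFun U) : DifferentiableOn ℂ (extend F) U := by
  obtain ⟨f, hf, rfl⟩ := exists_eq_mk F
  exact hf.congr fun x hx => extend_apply (mk f hf) ⟨x, hx⟩

/-- The evaluation at a point. -/
def evalAt (m : U) : HolFun U →ₐ[ℂ] ℂ := (Pi.evalAlgHom ℂ (fun _ : U => ℂ) m).comp (HolFun U).val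

theorem evalAt_eq (m : U) (F : HolFun U) : evalAt m F = F.1 m := rfl

@[simp] theorem evalAt_mk (m : U) {f : E → ℂ} (hf : DifferentiableOn ℂ f U) :
    evalAt m (mk f hf) = f m := rfl

theorem ext_evalAt {F G : HolFun U} (h : ∀ m, evalAt m F = evalAt m G) : F = G :=
  Subtype.ext (funext h)

theorem evalAt_deriv_deriv_mul (D : Derivation ℂ (HolFun U) (HolFun U)) (F G : HolFun U) (m : U) :
    evalAt m (D (D (F * G))) = evalAt m F * evalAt m (D (D G))
      + 2 * (evalAt m (D F) * evalAt m (D G)) + evalAt m (D (D F)) * evalAt m G := by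
  simp only [Derivation.leibniz, map_add, map_mul, smul_eq_mul]
  ring

theorem exists_eq_algebraMap {F : HolFun U} (hU : IsPreconnected (U : Set E))
    (h : ∀ m : U, fderiv ℂ (extend F) m = 0) : ∃ a : ℂ, F = algebraMap ℂ _ a := by
  obtain ⟨a, ha⟩ := U.isOpen.exists_is_const_of_fderiv_eq_zero hU (differentiableOn_extend F)
    fun x hx => h ⟨x, hx⟩
  exact ⟨a, Subtype.ext (funext fun m => (extend_apply F m).symm.trans (ha m m.2))⟩

variable [FiniteDimensional ℂ E]

theorem differentiableOn_fderiv_field {f : E → ℂ} (hf : DifferentiableOn ℂ f U) {v : E → E}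
    (hv : Differentiable ℂ v) : DifferentiableOn ℂ (fun m => fderiv ℂ f m (v m)) U :=
  (differentiableOn_fderiv_of_holomorphic U.isOpen hf).clm_apply hv.differentiableOn

/-- The derivative along a holomorphic vector field. -/
noncomputable def along (U : Opens E) (v : E → E) (hv : Differentiable ℂ v) :
    Derivation ℂ (HolFun U) (HolFun U) :=
  Derivation.mk'
    { toFun := fun F => mk (fun m => fderiv ℂ (extend F) m (v m))
        (differentiableOn_fderiv_field (differentiableOn_extend F) hv)
      map_add' := fun F G => by
        obtain ⟨f, hf, rfl⟩ := exists_eq_mk F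
        obtain ⟨g, hg, rfl⟩ := exists_eq_mk G
        refine Subtype.ext (funext fun m => ?_)
        have h : mk f hf + mk g hg = mk (fun m => f m + g m) (hf.fun_add hg) := rfl
        have hm := U.isOpen.mem_nhds m.2
        simp only [h, mk_apply, fderiv_extend_mk _ m.2, Subalgebra.coe_add, Pi.add_apply]
        rw [fderiv_fun_add (hf.differentiableAt hm) (hg.differentiableAt hm)]
        rfl
      map_smul' := fun a F => by
        obtain ⟨f, hf, rfl⟩ := exists_eq_mk F
        refine Subtype.ext (funext fun m => ?_)
        have h : a • mk f hf = mk (fun m => a • f m) (hf.fun_const_smul a) := rfl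
        have hm := U.isOpen.mem_nhds m.2
        simp only [h, mk_apply, fderiv_extend_mk _ m.2, Subalgebra.coe_smul, Pi.smul_apply,
          RingHom.id_apply]
        rw [fderiv_fun_const_smul (hf.differentiableAt hm)]
        rfl }
    fun F G => by
      obtain ⟨f, hf, rfl⟩ := exists_eq_mk F
      obtain ⟨g, hg, rfl⟩ := exists_eq_mk G
      refine Subtype.ext (funext fun m => ?_)
      have h : mk f hf * mk g hg = mk (fun m => f m * g m) (hf.fun_mul hg) := rfl
      have hm := U.isOpen.mem_nhds m.2
      simp only [h, LinearMap.coe_mk, AddHom.coe_mk, mk_apply, fderiv_extend_mk _ m.2,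
        Subalgebra.coe_add, Pi.add_apply, smul_eq_mul, Subalgebra.coe_mul, Pi.mul_apply]
      rw [fderiv_fun_mul (hf.differentiableAt hm) (hg.differentiableAt hm)]
      rfl

theorem along_mk {v : E → E} (hv : Differentiable ℂ v) {f : E → ℂ} (hf : DifferentiableOn ℂ f U) :
    along U v hv (mk f hf) =
      mk (fun m => fderiv ℂ f m (v m)) (differentiableOn_fderiv_field hf hv) := by
  refine Subtype.ext (funext fun m => ?_)
  change fderiv ℂ (extend (mk f hf)) m (v m) = fderiv ℂ f m (v m)
  rw [fderiv_extend_mk hf m.2]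

theorem along_mk_apply {v : E → E} (hv : Differentiable ℂ v) {f : E → ℂ}
    (hf : DifferentiableOn ℂ f U) (m : U) :
    (along U v hv (mk f hf)).1 m = fderiv ℂ f m (v m) := by
  rw [along_mk, mk_apply]

theorem along_along {u v w : E → E} (hu : Differentiable ℂ u) (hv : Differentiable ℂ v)
    (hw : Differentiable ℂ w) (a : ℂ) (h : ∀ m, VectorField.lieBracket ℂ u v m = a • w m)
    (F : HolFun U) :
    along U u hu (along U v hv F) = along U v hv (along U u hu F) + a • along U w hw F := by
  obtain ⟨f, hf, rfl⟩ := exists_eq_mk F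
  simp only [along_mk]
  refine Subtype.ext (funext fun m => ?_)
  have hm := U.isOpen.mem_nhds m.2
  have hd : DifferentiableAt ℂ (fderiv ℂ f) m :=
    (differentiableOn_fderiv_of_holomorphic U.isOpen hf).differentiableAt hm
  have hsymm := second_derivative_symmetric_of_eventually (𝕜 := ℂ) (f := f) (f' := fderiv ℂ f)
    (by filter_upwards [hm] with y hy using
          (hf.differentiableAt (U.isOpen.mem_nhds hy)).hasFDerivAt) hd.hasFDerivAt (u m) (v m)
  simp only [mk_apply, Subalgebra.coe_add, Pi.add_apply, Subalgebra.coe_smul, Pi.smul_apply,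
    ← map_smul]
  rw [fderiv_clm_apply hd (hv m), fderiv_clm_apply hd (hu m)]
  simp only [_root_.add_apply, ContinuousLinearMap.comp_apply,
    ContinuousLinearMap.flip_apply, hsymm, ← h, VectorField.lieBracket, map_sub]
  ring

theorem along_eq_add {u v w : E → E} (hu : Differentiable ℂ u) (hv : Differentiable ℂ v)
    (hw : Differentiable ℂ w) (h : ∀ m, w m = u m + v m) (F : HolFun U) :
    along U w hw F = along U u hu F + along U v hv F :=
  Subtype.ext (funext fun m => (congrArg (fderiv ℂ (extend F) m) (h m)).trans (map_add _ _ _))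

theorem along_eq_smul {u v : E → E} (hu : Differentiable ℂ u) (hv : Differentiable ℂ v) (a : ℂ)
    (h : ∀ m, v m = a • u m) (F : HolFun U) : along U v hv F = a • along U u hu F :=
  Subtype.ext (funext fun m => (congrArg (fderiv ℂ (extend F) m) (h m)).trans (map_smul _ _ _))

theorem along_comm {u v : E → E} (hu : Differentiable ℂ u) (hv : Differentiable ℂ v)
    (h : ∀ m, VectorField.lieBracket ℂ u v m = 0) (F : HolFun U) :
    along U u hu (along U v hv F) = along U v hv (along U u hu F) := by
  rw [along_along hu hv hu 0 (by simpa using h), zero_smul, add_zero]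

end HolFun

end Holomorphic

section JetFrame

variable {d : ℕ} {W : Type*} [AddCommGroup W] [Module ℂ W] (w : Module.Basis (Fin d) ℂ W)
  (c : Fin d)

/-- The vector field `t^a X_a`. -/
noncomputable def fieldX (t : W) (m : J1 d) : J1 d := ∑ a, w.repr t a • frameX a m

/-- The vector field `φ(w_a) ∂_{u_a}`. -/
noncomputable def fieldU (φ : W →ₗ[ℂ] ℂ) (_ : J1 d) : J1 d := ∑ a, φ (w a) • ddp a.succ

theorem fieldX_eq (t : W) (m : J1 d) : fieldX w t m =
    (Fin.cons 0 (w.repr t), ∑ a, w.repr t a * m.2.2 a.succ, 0) := by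
  refine Prod.ext (funext fun i => ?_) (Prod.ext ?_ (funext fun i => ?_))
  · refine Fin.cases ?_ (fun a => ?_) i
    · simp [fieldX, frameX, ddx, ddu, Prod.fst_sum]
    · simp [fieldX, frameX, ddx, ddu, Prod.fst_sum, Pi.single_apply]
  · simp [fieldX, frameX, ddx, ddu, Prod.fst_sum, Prod.snd_sum]
  · simp [fieldX, frameX, ddx, ddu, Prod.snd_sum]

theorem fieldU_eq (φ : W →ₗ[ℂ] ℂ) (m : J1 d) : fieldU w φ m =
    (0, 0, Fin.cons 0 fun a => φ (w a)) := by
  refine Prod.ext (funext fun i => ?_) (Prod.ext ?_ (funext fun i => ?_))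
  · simp [fieldU, ddp, Prod.fst_sum]
  · simp [fieldU, ddp, Prod.snd_sum, Prod.fst_sum]
  · refine Fin.cases ?_ (fun a => ?_) i
    · simp [fieldU, ddp, Prod.snd_sum]
    · simp [fieldU, ddp, Prod.snd_sum, Pi.single_apply]

theorem frameX0_eq (m : J1 d) :
    frameX0 c m = (Pi.single 0 1, m.2.2 0, Pi.single 0 (m.1 c.succ)) := by
  refine Prod.ext ?_ (Prod.ext ?_ (funext fun i => ?_))
  · simp [frameX0, ddx, ddu, ddp]
  · simp [frameX0, ddx, ddu, ddp]
  · refine Fin.cases ?_ (fun a => ?_) i <;> simp [frameX0, ddx, ddu, ddp]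

/-- The linear part of the affine vector field `X_0`. -/
noncomputable def frameX0Linear : J1 d →L[ℂ] J1 d := LinearMap.toContinuousLinearMap
  { toFun := fun v => (0, v.2.2 0, Pi.single 0 (v.1 c.succ))
    map_add' := fun u v => by ext <;> simp [Pi.single_add]
    map_smul' := fun a v =>
      Prod.ext (by simp) (Prod.ext (by simp) (Pi.single_smul' 0 a (v.1 c.succ))) }

/-- The linear part of the affine vector field `t^a X_a`. -/
noncomputable def fieldXLinear (t : W) : J1 d →L[ℂ] J1 d := LinearMap.toContinuousLinearMap
  { toFun := fun v => (0, ∑ a, w.repr t a * v.2.2 a.succ, 0)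
    map_add' := fun u v => by ext <;> simp [mul_add, Finset.sum_add_distrib]
    map_smul' := fun a v => by ext <;> simp [Finset.mul_sum, mul_left_comm] }

theorem hasFDerivAt_frameX0 (m : J1 d) : HasFDerivAt (frameX0 c) (frameX0Linear c) m := by
  have h : frameX0 c = fun m => (Pi.single 0 1, 0, 0) + frameX0Linear c m := by
    funext m
    rw [frameX0_eq]
    refine Prod.ext ?_ (Prod.ext ?_ ?_) <;> simp [frameX0Linear]
  rw [h]
  exact (frameX0Linear c).hasFDerivAt.const_add _

theorem hasFDerivAt_fieldX (t : W) (m : J1 d) :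
    HasFDerivAt (fieldX w t) (fieldXLinear w t) m := by
  have h : fieldX w t = fun m => (Fin.cons 0 (w.repr t), 0, 0) + fieldXLinear w t m := by
    funext m
    rw [fieldX_eq]
    refine Prod.ext ?_ (Prod.ext ?_ ?_) <;> simp [fieldXLinear]
  rw [h]
  exact (fieldXLinear w t).hasFDerivAt.const_add _

theorem hasFDerivAt_fieldU (φ : W →ₗ[ℂ] ℂ) (m : J1 d) :
    HasFDerivAt (fieldU w φ) (0 : J1 d →L[ℂ] J1 d) m :=
  hasFDerivAt_const (∑ a, φ (w a) • ddp a.succ) m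

theorem fderiv_frameX0 (m v : J1 d) :
    fderiv ℂ (frameX0 c) m v = (0, v.2.2 0, Pi.single 0 (v.1 c.succ)) := by
  rw [(hasFDerivAt_frameX0 c m).fderiv]
  rfl

theorem fderiv_fieldX (t : W) (m v : J1 d) :
    fderiv ℂ (fieldX w t) m v = (0, ∑ a, w.repr t a * v.2.2 a.succ, 0) := by
  rw [(hasFDerivAt_fieldX w t m).fderiv]
  rfl

theorem fderiv_fieldU (φ : W →ₗ[ℂ] ℂ) (m v : J1 d) : fderiv ℂ (fieldU w φ) m v = 0 := by
  rw [(hasFDerivAt_fieldU w φ m).fderiv]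
  rfl

theorem differentiable_frameX0 : Differentiable ℂ (frameX0 c) :=
  fun m => (hasFDerivAt_frameX0 c m).differentiableAt

theorem differentiable_fieldX (t : W) : Differentiable ℂ (fieldX w t) :=
  fun m => (hasFDerivAt_fieldX w t m).differentiableAt

theorem differentiable_fieldU (φ : W →ₗ[ℂ] ℂ) : Differentiable ℂ (fieldU w φ) :=
  fun m => (hasFDerivAt_fieldU w φ m).differentiableAt

theorem fieldX_add (s t : W) (m : J1 d) : fieldX w (s + t) m = fieldX w s m + fieldX w t m := by
  simp [fieldX, add_smul, Finset.sum_add_distrib]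

theorem fieldX_smul (a : ℂ) (t : W) (m : J1 d) : fieldX w (a • t) m = a • fieldX w t m := by
  simp [fieldX, mul_smul, Finset.smul_sum]

theorem fieldU_add (φ ψ : W →ₗ[ℂ] ℂ) (m : J1 d) :
    fieldU w (φ + ψ) m = fieldU w φ m + fieldU w ψ m := by
  simp [fieldU, add_smul, Finset.sum_add_distrib]

theorem fieldU_smul (a : ℂ) (φ : W →ₗ[ℂ] ℂ) (m : J1 d) :
    fieldU w (a • φ) m = a • fieldU w φ m := by
  simp [fieldU, mul_smul, Finset.smul_sum]

theorem sum_repr_mul (φ : W →ₗ[ℂ] ℂ) (t : W) : ∑ a, w.repr t a * φ (w a) = φ t := by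
  conv_rhs => rw [← w.sum_repr t, map_sum]
  simp

theorem lieBracket_fieldX_frameX0 (t : W) (m : J1 d) :
    VectorField.lieBracket ℂ (fieldX w t) (frameX0 c) m = w.coord c t • ddp 0 := by
  simp only [VectorField.lieBracket, fderiv_frameX0, fderiv_fieldX]
  simp [fieldX_eq, frameX0_eq, ddp, ← Pi.single_smul']

theorem lieBracket_ddp_zero_frameX0 (m : J1 d) :
    VectorField.lieBracket ℂ (fun _ => ddp 0) (frameX0 c) m = ddu := by
  simp only [VectorField.lieBracket, fderiv_frameX0, fderiv_fun_const]
  simp [ddp, ddu]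

theorem lieBracket_fieldU_fieldX (φ : W →ₗ[ℂ] ℂ) (t : W) (m : J1 d) :
    VectorField.lieBracket ℂ (fieldU w φ) (fieldX w t) m = φ t • ddu := by
  simp only [VectorField.lieBracket, fderiv_fieldX, fderiv_fieldU, fieldU_eq, Fin.cons_succ,
    sum_repr_mul]
  simp [ddu]

theorem lieBracket_fieldX_fieldX (s t : W) (m : J1 d) :
    VectorField.lieBracket ℂ (fieldX w s) (fieldX w t) m = 0 := by
  simp only [VectorField.lieBracket, fderiv_fieldX, fieldX_eq]
  simp

theorem lieBracket_fieldU_frameX0 (φ : W →ₗ[ℂ] ℂ) (m : J1 d) :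
    VectorField.lieBracket ℂ (fieldU w φ) (frameX0 c) m = 0 := by
  simp only [VectorField.lieBracket, fderiv_fieldU, fderiv_frameX0, fieldU_eq]
  simp

theorem lieBracket_ddp_zero_fieldX (t : W) (m : J1 d) :
    VectorField.lieBracket ℂ (fun _ => ddp 0) (fieldX w t) m = 0 := by
  simp only [VectorField.lieBracket, fderiv_fieldX, fderiv_fun_const]
  simp [ddp]

theorem lieBracket_ddu_frameX0 (m : J1 d) :
    VectorField.lieBracket ℂ (fun _ => ddu) (frameX0 c) m = 0 := by
  simp only [VectorField.lieBracket, fderiv_frameX0, fderiv_fun_const]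
  simp [ddu]

theorem lieBracket_ddu_fieldX (t : W) (m : J1 d) :
    VectorField.lieBracket ℂ (fun _ => ddu) (fieldX w t) m = 0 := by
  simp only [VectorField.lieBracket, fderiv_fieldX, fderiv_fun_const]
  simp [ddu]

theorem lieBracket_const_fieldU (v : J1 d) (φ : W →ₗ[ℂ] ℂ) (m : J1 d) :
    VectorField.lieBracket ℂ (fun _ => v) (fieldU w φ) m = 0 := by
  simp [VectorField.lieBracket, fderiv_fieldU]

theorem lieBracket_fieldU_fieldU (φ ψ : W →ₗ[ℂ] ℂ) (m : J1 d) :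
    VectorField.lieBracket ℂ (fieldU w φ) (fieldU w ψ) m = 0 := by
  simp only [VectorField.lieBracket, fderiv_fieldU, sub_zero]

variable (U : Opens (J1 d))

/-- The derivation `X_0`. -/
noncomputable def derivX0 : Derivation ℂ (HolFun U) (HolFun U) :=
  HolFun.along U (frameX0 c) (differentiable_frameX0 c)

/-- The derivation `t^a X_a`. -/
noncomputable def derivX (t : W) : Derivation ℂ (HolFun U) (HolFun U) :=
  HolFun.along U (fieldX w t) (differentiable_fieldX w t)

/-- The derivation `∂/∂u_0`. -/
noncomputable def derivU0 : Derivation ℂ (HolFun U) (HolFun U) :=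
  HolFun.along U (fun _ => ddp 0) (differentiable_const _)

/-- The derivation `φ(w_a) ∂/∂u_a`. -/
noncomputable def derivU (φ : W →ₗ[ℂ] ℂ) : Derivation ℂ (HolFun U) (HolFun U) :=
  HolFun.along U (fieldU w φ) (differentiable_fieldU w φ)

/-- The derivation `∂/∂u`. -/
noncomputable def derivZ : Derivation ℂ (HolFun U) (HolFun U) :=
  HolFun.along U (fun _ => ddu) (differentiable_const _)

/-- The derivations along the frame of the first jet space. -/
noncomputable def jetFrame : ContactFrame (w.coord c) (HolFun U) where
  X0 := derivX0 c U
  U0 := derivU0 U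
  Z := derivZ U
  X :=
    { toFun := fun t => derivX w U t
      map_add' := fun s t => LinearMap.ext <| HolFun.along_eq_add (differentiable_fieldX w s)
        (differentiable_fieldX w t) (differentiable_fieldX w (s + t)) (fieldX_add w s t)
      map_smul' := fun a t => LinearMap.ext <| HolFun.along_eq_smul (differentiable_fieldX w t)
        (differentiable_fieldX w (a • t)) a (fieldX_smul w a t) }
  U :=
    { toFun := fun φ => derivU w U φ
      map_add' := fun φ ψ => LinearMap.ext <| HolFun.along_eq_add (differentiable_fieldU w φ)
        (differentiable_fieldU w ψ) (differentiable_fieldU w (φ + ψ)) (fieldU_add w φ ψ)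
      map_smul' := fun a φ => LinearMap.ext <| HolFun.along_eq_smul (differentiable_fieldU w φ)
        (differentiable_fieldU w (a • φ)) a (fieldU_smul w a φ) }
  X_X0 t := HolFun.along_along (differentiable_fieldX w t) (differentiable_frameX0 c)
    (differentiable_const (ddp 0)) _ (lieBracket_fieldX_frameX0 w c t)
  U0_X0 F := by
    have h := HolFun.along_along (U := U) (differentiable_const (ddp 0))
      (differentiable_frameX0 c) (differentiable_const ddu) 1
      (fun m => (lieBracket_ddp_zero_frameX0 c m).trans (one_smul ℂ ddu).symm) F
    rwa [one_smul] at h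
  U_X φ t := HolFun.along_along (differentiable_fieldU w φ) (differentiable_fieldX w t)
    (differentiable_const ddu) _ (lieBracket_fieldU_fieldX w φ t)
  X_X s t := HolFun.along_comm (differentiable_fieldX w s) (differentiable_fieldX w t)
    (lieBracket_fieldX_fieldX w s t)
  U_U φ ψ := HolFun.along_comm (differentiable_fieldU w φ) (differentiable_fieldU w ψ)
    (lieBracket_fieldU_fieldU w φ ψ)
  U0_U φ := HolFun.along_comm (differentiable_const (ddp 0)) (differentiable_fieldU w φ)
    (lieBracket_const_fieldU w (ddp 0) φ)
  U_X0 φ := HolFun.along_comm (differentiable_fieldU w φ) (differentiable_frameX0 c)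
    (lieBracket_fieldU_frameX0 w c φ)
  U0_X t := HolFun.along_comm (differentiable_const (ddp 0)) (differentiable_fieldX w t)
    (lieBracket_ddp_zero_fieldX w t)
  Z_X0 := HolFun.along_comm (differentiable_const ddu) (differentiable_frameX0 c)
    (lieBracket_ddu_frameX0 c)
  Z_X t := HolFun.along_comm (differentiable_const ddu) (differentiable_fieldX w t)
    (lieBracket_ddu_fieldX w t)
  Z_U0 := HolFun.along_comm (differentiable_const ddu) (differentiable_const (ddp 0)) fun m => by
    simp [VectorField.lieBracket]
  Z_U φ := HolFun.along_comm (differentiable_const ddu) (differentiable_fieldU w φ)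
    (lieBracket_const_fieldU w ddu φ)

variable {w c U}

theorem jetFrame_X0 (F : HolFun U) : (jetFrame w c U).X0 F = derivX0 c U F := rfl
theorem jetFrame_X (t : W) (F : HolFun U) : (jetFrame w c U).X t F = derivX w U t F := rfl
theorem jetFrame_U0 (F : HolFun U) : (jetFrame w c U).U0 F = derivU0 U F := rfl
theorem jetFrame_U (φ : W →ₗ[ℂ] ℂ) (F : HolFun U) :
    (jetFrame w c U).U φ F = derivU w U φ F := rfl
theorem jetFrame_Z (F : HolFun U) : (jetFrame w c U).Z F = derivZ U F := rfl

variable (w c U) (C : W →ₗ[ℂ] W →ₗ[ℂ] W →ₗ[ℂ] ℂ)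

theorem fieldV_eq (hC : IsSymmetricCubic C) (l : ℂ) (t : W) (m : J1 d) :
    fieldV C w c l t m =
      l ^ 3 • frameX0 c m - l ^ 2 • fieldX w t m - (1 / 2 * C t t t) • ddp 0
        - (3 / 2 * l) • fieldU w (C t t) m := by
  have hsymm : ∀ a, C (w a) t t = C t t (w a) := fun a => by rw [hC.swap_left, hC.swap_right]
  simp [fieldV, fieldX, fieldU, hsymm]

/-- The derivation along the vector field `V(l, t)`. -/
noncomputable def derivV (l : ℂ) (t : W) : Derivation ℂ (HolFun U) (HolFun U) :=
  l ^ 3 • derivX0 c U - l ^ 2 • derivX w U t - (1 / 2 * C t t t) • derivU0 U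
    - (3 / 2 * l) • derivU w U (C t t)

theorem jetFrame_V (l : ℂ) (t : W) (F : HolFun U) :
    (jetFrame w c U).V C l t F = derivV w c U C l t F := rfl

end JetFrame

/-! ## The listed solutions -/

namespace HolFun

section Coordinates

variable {d : ℕ} (U : Opens (J1 d))

/-- The coordinate function `x^i`. -/
noncomputable def cx (i : Fin (d + 1)) : HolFun U := mk (fun m => m.1 i) (by fun_prop)

/-- The coordinate function `u`. -/
noncomputable def cu : HolFun U := mk (fun m => m.2.1) (by fun_prop)

/-- The coordinate function `u_i`. -/
noncomputable def cp (i : Fin (d + 1)) : HolFun U := mk (fun m => m.2.2 i) (by fun_prop)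

variable {U}

@[simp] theorem evalAt_cx (m : U) (i : Fin (d + 1)) : evalAt m (cx U i) = m.1.1 i := rfl
@[simp] theorem evalAt_cu (m : U) : evalAt m (cu U) = m.1.2.1 := rfl
@[simp] theorem evalAt_cp (m : U) (i : Fin (d + 1)) : evalAt m (cp U i) = m.1.2.2 i := rfl

theorem evalAt_along_cx {v : J1 d → J1 d} (hv : Differentiable ℂ v) (m : U) (i : Fin (d + 1)) :
    evalAt m (along U v hv (cx U i)) = (v m).1 i := by
  rw [evalAt_eq, cx, along_mk_apply]
  let L : J1 d →L[ℂ] ℂ := ContinuousLinearMap.proj i ∘L ContinuousLinearMap.fst ℂ _ _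
  exact congrArg (fun L' : J1 d →L[ℂ] ℂ => L' (v m)) L.hasFDerivAt.fderiv

theorem evalAt_along_cu {v : J1 d → J1 d} (hv : Differentiable ℂ v) (m : U) :
    evalAt m (along U v hv (cu U)) = (v m).2.1 := by
  rw [evalAt_eq, cu, along_mk_apply]
  let L : J1 d →L[ℂ] ℂ := ContinuousLinearMap.fst ℂ _ _ ∘L ContinuousLinearMap.snd ℂ _ _
  exact congrArg (fun L' : J1 d →L[ℂ] ℂ => L' (v m)) L.hasFDerivAt.fderiv

theorem evalAt_along_cp {v : J1 d → J1 d} (hv : Differentiable ℂ v) (m : U) (i : Fin (d + 1)) :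
    evalAt m (along U v hv (cp U i)) = (v m).2.2 i := by
  rw [evalAt_eq, cp, along_mk_apply]
  let L : J1 d →L[ℂ] ℂ := ContinuousLinearMap.proj i ∘L
    (ContinuousLinearMap.snd ℂ _ _ ∘L ContinuousLinearMap.snd ℂ _ _)
  exact congrArg (fun L' : J1 d →L[ℂ] ℂ => L' (v m)) L.hasFDerivAt.fderiv

end Coordinates

end HolFun

open HolFun

namespace AnnihilatesCubic

variable {d : ℕ} {W : Type*} [AddCommGroup W] [Module ℂ W] {w : Module.Basis (Fin d) ℂ W}
  {C : W →ₗ[ℂ] W →ₗ[ℂ] W →ₗ[ℂ] ℂ} {A : Matrix (Fin d) (Fin d) ℂ}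

theorem add_add_apply_toLin (hA : AnnihilatesCubic C w A) (r s t : W) :
    C s t (Matrix.toLin w w A r) + C r t (Matrix.toLin w w A s)
      + C r s (Matrix.toLin w w A t) = 0 := by
  have hext : ∀ g : W → ℂ, IsLinearMap ℂ g → (∀ b, g (w b) = 0) → ∀ r, g r = 0 :=
    fun g hg h r => LinearMap.congr_fun (w.ext (f₁ := hg.mk' g) (f₂ := 0) (by simpa using h)) r
  let T : W → W → W → ℂ := fun r s t =>
    C s t (Matrix.toLin w w A r) + C r t (Matrix.toLin w w A s) + C r s (Matrix.toLin w w A t)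
  have hbasis : ∀ b e h, T (w b) (w e) (w h) = 0 := fun b e h => by
    simpa only [T, Matrix.toLin_self, map_sum, map_smul, smul_eq_mul, ← Finset.sum_add_distrib]
      using hA b e h
  refine hext (T r s) ⟨fun x y => ?_, fun x y => ?_⟩ (fun h =>
    hext (T r · (w h)) ⟨fun x y => ?_, fun x y => ?_⟩ (fun e =>
      hext (T · (w e) (w h)) ⟨fun x y => ?_, fun x y => ?_⟩ (fun b => hbasis b e h) r) s) t
  all_goals
    simp only [T, map_add, map_smul, LinearMap.add_apply, LinearMap.smul_apply, smul_eq_mul]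
    ring

theorem sum_sum_mul_eq_zero (hA : AnnihilatesCubic C w A) (t : W) :
    ∑ a, ∑ b, A a b * (w.repr t b * C t t (w a)) = 0 := by
  have hself : C t t (Matrix.toLin w w A t) = 0 := by
    linear_combination hA.add_add_apply_toLin t t t / 3
  rw [← hself, Matrix.toLin_apply]
  simp only [map_sum, map_smul, smul_eq_mul, Matrix.mulVec, dotProduct, Finset.sum_mul, mul_assoc]

end AnnihilatesCubic

section FrameDerivations

variable {d : ℕ} {W : Type*} [AddCommGroup W] [Module ℂ W] {w : Module.Basis (Fin d) ℂ W}
  {c : Fin d} {U : Opens (J1 d)}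

theorem derivX0_cx_zero : derivX0 c U (cx U 0) = 1 := ext_evalAt fun m => by
  simp [derivX0, evalAt_along_cx, frameX0_eq]

theorem derivX0_cx_succ (a : Fin d) : derivX0 c U (cx U a.succ) = 0 := ext_evalAt fun m => by
  simp [derivX0, evalAt_along_cx, frameX0_eq]

theorem derivX_cx_zero (t : W) : derivX w U t (cx U 0) = 0 := ext_evalAt fun m => by
  simp [derivX, evalAt_along_cx, fieldX_eq]

theorem derivX_cx_succ (t : W) (a : Fin d) :
    derivX w U t (cx U a.succ) = algebraMap ℂ _ (w.repr t a) := ext_evalAt fun m => by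
  simp [derivX, evalAt_along_cx, fieldX_eq]

theorem derivU0_cx (i : Fin (d + 1)) : derivU0 U (cx U i) = 0 := ext_evalAt fun m => by
  simp [derivU0, evalAt_along_cx, ddp]

theorem derivU0_cu : derivU0 U (cu U) = 0 := ext_evalAt fun m => by
  simp [derivU0, evalAt_along_cu, ddp]

theorem derivU0_cp_zero : derivU0 U (cp U 0) = 1 := ext_evalAt fun m => by
  simp [derivU0, evalAt_along_cp, ddp]

theorem derivU0_cp_succ (a : Fin d) : derivU0 U (cp U a.succ) = 0 := ext_evalAt fun m => by
  simp [derivU0, evalAt_along_cp, ddp]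

theorem derivU_cx (φ : W →ₗ[ℂ] ℂ) (i : Fin (d + 1)) : derivU w U φ (cx U i) = 0 :=
  ext_evalAt fun m => by simp [derivU, evalAt_along_cx, fieldU_eq]

theorem derivU_cu (φ : W →ₗ[ℂ] ℂ) : derivU w U φ (cu U) = 0 :=
  ext_evalAt fun m => by simp [derivU, evalAt_along_cu, fieldU_eq]

theorem derivU_cp_zero (φ : W →ₗ[ℂ] ℂ) : derivU w U φ (cp U 0) = 0 :=
  ext_evalAt fun m => by simp [derivU, evalAt_along_cp, fieldU_eq]

theorem derivU_cp_succ (φ : W →ₗ[ℂ] ℂ) (a : Fin d) :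
    derivU w U φ (cp U a.succ) = algebraMap ℂ _ (φ (w a)) :=
  ext_evalAt fun m => by simp [derivU, evalAt_along_cp, fieldU_eq]

theorem derivZ_cx (i : Fin (d + 1)) : derivZ U (cx U i) = 0 := ext_evalAt fun m => by
  simp [derivZ, evalAt_along_cx, ddu]

theorem derivZ_cu : derivZ U (cu U) = 1 := ext_evalAt fun m => by
  simp [derivZ, evalAt_along_cu, ddu]

theorem derivZ_cp (i : Fin (d + 1)) : derivZ U (cp U i) = 0 := ext_evalAt fun m => by
  simp [derivZ, evalAt_along_cp, ddu]

variable {C : W →ₗ[ℂ] W →ₗ[ℂ] W →ₗ[ℂ] ℂ}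

section
variable (l : ℂ) (t : W)

theorem derivV_cx_zero : derivV w c U C l t (cx U 0) = algebraMap ℂ _ (l ^ 3) :=
  ext_evalAt fun m => by
    simp [derivV, derivX0, derivX, derivU0, derivU, evalAt_along_cx, fieldU_eq, fieldX_eq,
      frameX0_eq, ddp]

theorem derivV_cx_succ (a : Fin d) :
    derivV w c U C l t (cx U a.succ) = algebraMap ℂ _ (-(l ^ 2 * w.repr t a)) :=
  ext_evalAt fun m => by
    simp [derivV, derivX0, derivX, derivU0, derivU, evalAt_along_cx, fieldU_eq, fieldX_eq,
      frameX0_eq, ddp]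

theorem derivV_cp_zero : derivV w c U C l t (cp U 0) =
    l ^ 3 • cx U c.succ - algebraMap ℂ _ (1 / 2 * C t t t) :=
  ext_evalAt fun m => by
    simp [derivV, derivX0, derivX, derivU0, derivU, evalAt_along_cp, fieldU_eq, fieldX_eq,
      frameX0_eq, ddp]

theorem derivV_cp_succ (a : Fin d) : derivV w c U C l t (cp U a.succ) =
    algebraMap ℂ _ (-(3 / 2 * l * C t t (w a))) :=
  ext_evalAt fun m => by
    simp [derivV, derivX0, derivX, derivU0, derivU, evalAt_along_cp, fieldU_eq, fieldX_eq,
      frameX0_eq, ddp]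

theorem derivV_cu : derivV w c U C l t (cu U) =
    l ^ 3 • cp U 0 - l ^ 2 • ∑ a, w.repr t a • cp U a.succ :=
  ext_evalAt fun m => by
    simp [derivV, derivX0, derivX, derivU0, derivU, evalAt_along_cu, fieldU_eq, fieldX_eq,
      frameX0_eq, ddp]

theorem derivV_derivV_cx (i : Fin (d + 1)) :
    derivV w c U C l t (derivV w c U C l t (cx U i)) = 0 := by
  refine Fin.cases ?_ (fun a => ?_) i
  · rw [derivV_cx_zero, Derivation.map_algebraMap]
  · rw [derivV_cx_succ, Derivation.map_algebraMap]

theorem derivV_derivV_cp_zero : derivV w c U C l t (derivV w c U C l t (cp U 0)) =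
    algebraMap ℂ _ (-(l ^ 5 * w.repr t c)) := by
  rw [derivV_cp_zero, map_sub, Derivation.map_smul, derivV_cx_succ, Derivation.map_algebraMap,
    sub_zero, Algebra.smul_def, ← map_mul]
  congr 1
  ring

theorem derivV_derivV_cu : derivV w c U C l t (derivV w c U C l t (cu U)) =
    l ^ 6 • cx U c.succ + algebraMap ℂ _ (l ^ 3 * C t t t) := by
  rw [derivV_cu, map_sub, Derivation.map_smul, Derivation.map_smul, derivV_cp_zero, map_sum]
  simp only [Derivation.map_smul, derivV_cp_succ]
  refine ext_evalAt fun m => ?_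
  have h := sum_repr_mul w (C t t) t
  simp only [map_add, map_sub, map_smul, map_sum, AlgHom.commutes, evalAt_cx, smul_eq_mul,
    Algebra.algebraMap_self, RingHom.id_apply]
  have h2 : ∑ a, w.repr t a * -(3 / 2 * l * C t t (w a)) = -(3 / 2 * l) * C t t t := by
    rw [← h, Finset.mul_sum]
    exact Finset.sum_congr rfl fun a _ => by ring
  rw [h2]
  ring

end

theorem isSolution_iff {F : HolFun U} : (jetFrame w c U).IsSolution C F ↔
    ∀ l t m, evalAt m (derivV w c U C l t (derivV w c U C l t F))
      + l ^ 5 * w.repr t c * evalAt m (derivU0 U F)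
      + l ^ 6 * evalAt m (derivU w U (w.coord c) F) = 0 := by
  refine forall_congr' fun l => forall_congr' fun t => ?_
  rw [jetFrame_V, jetFrame_V, jetFrame_U0, jetFrame_U, Module.Basis.coord_apply]
  refine ⟨fun h m => ?_, fun h => ext_evalAt fun m => ?_⟩
  · have := congrArg (evalAt m) h
    simpa only [map_add, map_smul, map_zero, smul_eq_mul] using this
  · simpa only [map_add, map_smul, map_zero, smul_eq_mul] using h m

theorem isSolution_algebraMap (a : ℂ) :
    (jetFrame w c U).IsSolution C (algebraMap ℂ (HolFun U) a) :=
  isSolution_iff.2 fun l t m => by simp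

theorem isSolution_cx (i : Fin (d + 1)) : (jetFrame w c U).IsSolution C (cx U i) :=
  isSolution_iff.2 fun l t m => by simp [derivV_derivV_cx, derivU0_cx, derivU_cx]

theorem isSolution_cp_zero : (jetFrame w c U).IsSolution C (cp U 0) :=
  isSolution_iff.2 fun l t m => by
    simp [derivV_derivV_cp_zero, derivU0_cp_zero, derivU_cp_zero]

variable (c U) in
/-- The functions `u_a - δ_a^c (x⁰)² / 2`. -/
noncomputable def holMomentum (a : Fin d) : HolFun U :=
  cp U a.succ - (if a = c then (1 / 2 : ℂ) else 0) • (cx U 0 * cx U 0)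

variable (U) in
/-- The function `7 u - 2 x⁰ u_0 - 3 x^a u_a`. -/
noncomputable def holScaling : HolFun U :=
  (7 : ℂ) • cu U - (2 : ℂ) • (cx U 0 * cp U 0) - (3 : ℂ) • ∑ a : Fin d, cx U a.succ * cp U a.succ

variable (C w c U) in
/-- The functions `x⁰ u_a + (3/2) C_a(X²) - (1/6) δ_a^c (x⁰)³`. -/
noncomputable def holShear (a : Fin d) : HolFun U :=
  cx U 0 * cp U a.succ
    + (3 / 2 : ℂ) • ∑ b, ∑ e, C (w a) (w b) (w e) • (cx U b.succ * cx U e.succ)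
    - (if a = c then (1 / 6 : ℂ) else 0) • (cx U 0 * (cx U 0 * cx U 0))

variable (U) in
/-- The functions `7 A^a_b x^b u_a - k (3 x⁰ u_0 + x^a u_a)`. -/
noncomputable def holLinear (A : Matrix (Fin d) (Fin d) ℂ) (k : ℂ) : HolFun U :=
  (7 : ℂ) • ∑ a : Fin d, ∑ b : Fin d, A a b • (cx U b.succ * cp U a.succ)
    - k • ((3 : ℂ) • (cx U 0 * cp U 0) + ∑ a : Fin d, cx U a.succ * cp U a.succ)

theorem isSolution_holMomentum (a : Fin d) :
    (jetFrame w c U).IsSolution C (holMomentum c U a) :=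
  isSolution_iff.2 fun l t m => by
    simp only [holMomentum, map_sub, Derivation.map_smul, map_smul, evalAt_deriv_deriv_mul,
      derivV_cx_zero, derivV_cp_succ, Derivation.map_algebraMap]
    simp only [Derivation.leibniz, derivU0_cp_succ, derivU_cp_succ, derivU0_cx, derivU_cx,
      AlgHom.commutes, map_zero, smul_zero, map_add]
    simp only [Module.Basis.coord_apply, Module.Basis.repr_self, Finsupp.single_apply]
    split_ifs <;> simp
    ring

section
variable (l : ℂ) (t : W) (m : U)

theorem evalAt_derivV_derivV_sum :
    evalAt m (derivV w c U C l t (derivV w c U C l t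
      (∑ a : Fin d, cx U a.succ * cp U a.succ))) = 3 * l ^ 3 * C t t t := by
  simp only [map_sum, evalAt_deriv_deriv_mul, derivV_cx_succ, derivV_cp_succ,
    Derivation.map_algebraMap, map_zero, AlgHom.commutes, Algebra.algebraMap_self, RingHom.id_apply]
  rw [← sum_repr_mul w (C t t) t, Finset.mul_sum]
  exact Finset.sum_congr rfl fun a _ => by ring

theorem evalAt_derivV_derivV_mul :
    evalAt m (derivV w c U C l t (derivV w c U C l t (cx U 0 * cp U 0))) =
      -(l ^ 5 * w.repr t c) * m.1.1 0 + 2 * l ^ 6 * m.1.1 c.succ - l ^ 3 * C t t t := by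
  rw [evalAt_deriv_deriv_mul, derivV_derivV_cp_zero, derivV_derivV_cx, derivV_cx_zero,
    derivV_cp_zero]
  simp only [map_zero, AlgHom.commutes, Algebra.algebraMap_self,
    RingHom.id_apply, map_sub, map_smul, evalAt_cx, smul_eq_mul]
  ring

end

theorem isSolution_holScaling : (jetFrame w c U).IsSolution C (holScaling U) :=
  isSolution_iff.2 fun l t m => by
    simp only [holScaling, map_sub, Derivation.map_smul, map_smul, evalAt_derivV_derivV_sum,
      evalAt_derivV_derivV_mul, derivV_derivV_cu, derivU0_cu, derivU_cu]
    simp only [map_sum, Derivation.leibniz, derivU0_cx, derivU_cx, derivU0_cp_zero, derivU_cp_zero,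
      derivU0_cp_succ, derivU_cp_succ, map_add, map_smul, smul_eq_mul, map_mul,
      map_one, map_zero, AlgHom.commutes, evalAt_cx]
    simp only [Module.Basis.coord_apply, Module.Basis.repr_self, Finsupp.single_apply]
    simp
    ring

theorem isSolution_holShear (hC : IsSymmetricCubic C) (a : Fin d) :
    (jetFrame w c U).IsSolution C (holShear w c U C a) :=
  isSolution_iff.2 fun l t m => by
    have h : ∑ b, ∑ e, C (w a) (w b) (w e) * (2 * (l ^ 2 * w.repr t b * (l ^ 2 * w.repr t e))) =
        2 * l ^ 4 * C t t (w a) := by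
      have h1 : C t t (w a) = C (w a) t t := by rw [hC.swap_right, hC.swap_left]
      rw [h1, ← sum_repr_mul w (C (w a) t) t, Finset.mul_sum, Finset.sum_comm]
      refine Finset.sum_congr rfl fun e _ => ?_
      rw [hC.swap_right, ← sum_repr_mul w (C (w a) (w e)) t, Finset.mul_sum, Finset.mul_sum]
      refine Finset.sum_congr rfl fun b _ => ?_
      rw [hC.swap_right (w a) (w e) (w b)]
      ring
    simp only [holShear, map_sub, map_add, Derivation.map_smul, map_smul, map_sum,
      evalAt_deriv_deriv_mul, derivV_cx_zero, derivV_cx_succ, derivV_cp_succ,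
      Derivation.map_algebraMap, AlgHom.commutes]
    simp only [Derivation.leibniz, derivU0_cx, derivU_cx, derivU0_cp_succ, derivU_cp_succ,
      derivV_cx_zero, add_zero, map_add, smul_eq_mul, map_mul, map_zero,
      AlgHom.commutes, evalAt_cx, mul_zero, zero_mul, zero_add, Algebra.algebraMap_self,
      RingHom.id_apply, neg_mul_neg, h, Finset.sum_const_zero, sub_zero]
    simp only [Module.Basis.coord_apply, Module.Basis.repr_self, Finsupp.single_apply]
    split_ifs <;> ring

theorem isSolution_holLinear {A : Matrix (Fin d) (Fin d) ℂ} {k : ℂ}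
    (hA : AnnihilatesCubic C w A) (hk : ∀ b, A c b = if b = c then k else 0) :
    (jetFrame w c U).IsSolution C (holLinear U A k) :=
  isSolution_iff.2 fun l t m => by
    have h : ∑ a, ∑ b, A a b * (2 * (l ^ 2 * w.repr t b * (3 / 2 * l * C t t (w a)))) = 0 := by
      have h' := congrArg (fun z => 3 * l ^ 3 * z) (hA.sum_sum_mul_eq_zero t)
      simp only [mul_zero, Finset.mul_sum] at h'
      rw [← h']
      exact Finset.sum_congr rfl fun a _ => Finset.sum_congr rfl fun b _ => by ring
    simp only [holLinear, map_sub, Derivation.map_smul, map_add, map_smul,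
      evalAt_derivV_derivV_sum, evalAt_derivV_derivV_mul]
    simp only [map_sum, Derivation.map_smul, map_smul, evalAt_deriv_deriv_mul,
      derivV_cx_succ, derivV_cp_succ, Derivation.map_algebraMap]
    simp only [Derivation.leibniz, derivU0_cx, derivU_cx, derivU0_cp_zero, derivU_cp_zero,
      derivU0_cp_succ, derivU_cp_succ, add_zero, smul_eq_mul, map_mul,
      map_one, map_zero, AlgHom.commutes, evalAt_cx, mul_zero, zero_mul, zero_add,
      Algebra.algebraMap_self, RingHom.id_apply, neg_mul_neg, h, Finset.sum_const_zero]
    simp only [Module.Basis.coord_apply, Module.Basis.repr_self, Finsupp.single_apply]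
    simp [hk]
    ring

end FrameDerivations

namespace ContactFrame

variable {W : Type*} [AddCommGroup W] [Module ℂ W] {κ : W →ₗ[ℂ] ℂ} {H : Type*} [AddCommGroup H]
  [Module ℂ H] (𝓕 : ContactFrame κ H) (C : W →ₗ[ℂ] W →ₗ[ℂ] W →ₗ[ℂ] ℂ)

/-- The space of solutions of the equation of the generating functions. -/
def solutions : Submodule ℂ H where
  carrier := {f | 𝓕.IsSolution C f}
  zero_mem' := fun l t => by simp
  add_mem' := fun {f g} hf hg l t => by
    have h1 := hf l t
    have h2 := hg l t
    simp only [map_add]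
    linear_combination (norm := module) h1 + h2
  smul_mem' := fun a f hf l t => by
    have h1 := hf l t
    simp only [map_smul]
    linear_combination (norm := module) a • h1

/-- The elements that all operators of the frame annihilate, for functions the constants. -/
structure IsConstant (f : H) : Prop where
  X0 : 𝓕.X0 f = 0
  X : ∀ t, 𝓕.X t f = 0
  U0 : 𝓕.U0 f = 0
  U : ∀ φ, 𝓕.U φ f = 0
  Z : 𝓕.Z f = 0

namespace IsSolution

variable {𝓕 C} {f : H}

theorem isConstant_X0 (hf : 𝓕.IsSolution C f) (hU0 : 𝓕.U0 f = 0) (hU : ∀ φ, 𝓕.U φ f = 0)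
    (hZ : 𝓕.Z f = 0) : 𝓕.IsConstant (𝓕.X0 f) where
  X0 := by rw [hf.X0_X0, hU, neg_zero]
  X t := by rw [hf.X_X0, hU0, smul_zero]
  U0 := by rw [𝓕.U0_X0, hU0, hZ, map_zero, zero_add]
  U φ := by rw [𝓕.U_X0, hU, map_zero]
  Z := by rw [𝓕.Z_X0, hZ, map_zero]

theorem isConstant_X (hC : IsSymmetricCubic C) (hf : 𝓕.IsSolution C f) (hU0 : 𝓕.U0 f = 0)
    (hU : ∀ φ, 𝓕.U φ f = 0) (hZ : 𝓕.Z f = 0) (t : W) : 𝓕.IsConstant (𝓕.X t f) where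
  X0 := hf.X0_X t
  X s := by rw [hf.X_X hC, hU, map_zero, smul_zero]
  U0 := by rw [𝓕.U0_X, hU0, map_zero]
  U φ := by rw [𝓕.U_X, hU, hZ, map_zero, smul_zero, zero_add]
  Z := by rw [𝓕.Z_X, hZ, map_zero]

variable [Module.Finite ℂ W] (hC : AdjointsOnNoQuadric C) {e : W} (he : κ e = 1)
  (hf : 𝓕.IsSolution C f)
include hC he hf

theorem isConstant_Z : 𝓕.IsConstant (𝓕.Z f) :=
  ⟨hf.X0_Z hC he, hf.X_Z hC he, hf.U0_Z hC he, hf.U_Z hC he, hf.Z_Z hC he⟩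

theorem isConstant_X0_U0 : 𝓕.IsConstant (𝓕.X0 (𝓕.U0 f)) where
  X0 := hf.X0_X0_U0 hC he
  X t := by rw [𝓕.X_X0, hf.X_U0 hC he, hf.U0_U0 hC he, map_zero, smul_zero, zero_add]
  U0 := by rw [𝓕.U0_X0, hf.U0_U0 hC he, hf.Z_U0 hC he, map_zero, zero_add]
  U φ := by rw [𝓕.U_X0, hf.U_U0 hC he, map_zero]
  Z := by rw [𝓕.Z_X0, hf.Z_U0 hC he, map_zero]

theorem isConstant_X_U (t : W) (ψ : W →ₗ[ℂ] ℂ) : 𝓕.IsConstant (𝓕.X t (𝓕.U ψ f)) where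
  X0 := hf.X0_X_U hC he t ψ
  X s := hf.X_X_U hC he s t ψ
  U0 := by rw [𝓕.U0_X, 𝓕.U0_U, hf.U_U0 hC he, map_zero]
  U φ := by rw [𝓕.U_X, hf.U_U hC he, hf.Z_U hC he, map_zero, smul_zero, zero_add]
  Z := by rw [𝓕.Z_X, hf.Z_U hC he, map_zero]

theorem isConstant_X0_U (ψ : W →ₗ[ℂ] ℂ) : 𝓕.IsConstant (𝓕.X0 (𝓕.U ψ f)) where
  X0 := hf.X0_X0_U hC he ψ
  X t := hf.X_X0_U hC he t ψ
  U0 := by rw [𝓕.U0_X0, 𝓕.U0_U, hf.U_U0 hC he, hf.Z_U hC he, map_zero, zero_add]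
  U φ := by rw [𝓕.U_X0, hf.U_U hC he, map_zero]
  Z := by rw [𝓕.Z_X0, hf.Z_U hC he, map_zero]

end IsSolution

end ContactFrame

section Listed

variable {d : ℕ} {W : Type*} [AddCommGroup W] [Module ℂ W] (w : Module.Basis (Fin d) ℂ W)
  (c : Fin d) (U : Opens (J1 d)) (C : W →ₗ[ℂ] W →ₗ[ℂ] W →ₗ[ℂ] ℂ)

/-- The restrictions to `U` of the functions in the span of the listed ones. -/
def listedRestrictions : Submodule ℂ (HolFun U) where
  carrier := {F | ∃ g ∈ Submodule.span ℂ {g | ListedFunction C w c g}, ∀ m : U, evalAt m F = g m}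
  zero_mem' := ⟨0, Submodule.zero_mem _, fun m => map_zero _⟩
  add_mem' := by
    rintro F G ⟨f, hf, hF⟩ ⟨g, hg, hG⟩
    exact ⟨f + g, Submodule.add_mem _ hf hg, fun m => by rw [map_add, hF, hG, Pi.add_apply]⟩
  smul_mem' := by
    rintro a F ⟨f, hf, hF⟩
    exact ⟨a • f, Submodule.smul_mem _ _ hf, fun m => by rw [map_smul, hF, Pi.smul_apply]⟩

variable {w c U C}

theorem mem_listedRestrictions {F : HolFun U} {g : J1 d → ℂ} (hg : ListedFunction C w c g)
    (h : ∀ m : U, evalAt m F = g m) : F ∈ listedRestrictions w c U C :=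
  ⟨g, Submodule.subset_span hg, h⟩

theorem evalAt_holMomentum (a : Fin d) (m : U) : evalAt m (holMomentum c U a) =
    m.1.2.2 a.succ - if a.succ = c.succ then (m.1.1 0) ^ 2 / 2 else 0 := by
  simp only [holMomentum, map_sub, map_smul, map_mul, evalAt_cx, evalAt_cp, smul_eq_mul,
    Fin.succ_inj]
  split_ifs <;> ring

theorem evalAt_holScaling (m : U) : evalAt m (holScaling U) = 7 * m.1.2.1
    - 2 * (m.1.1 0 * m.1.2.2 0) - 3 * ∑ a : Fin d, m.1.1 a.succ * m.1.2.2 a.succ := by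
  simp [holScaling]

theorem evalAt_holShear (a : Fin d) (m : U) : evalAt m (holShear w c U C a) =
    m.1.1 0 * m.1.2.2 a.succ + 3 / 2 * C (w a) (pointX w m) (pointX w m)
      - if a = c then (m.1.1 0) ^ 3 / 6 else 0 := by
  simp only [holShear, map_sub, map_add, map_smul, map_sum, map_mul, evalAt_cx, evalAt_cp,
    smul_eq_mul, pointX, LinearMap.sum_apply, LinearMap.smul_apply, Finset.mul_sum]
  congr 1
  · congr 1
    rw [Finset.sum_comm]
    refine Finset.sum_congr rfl fun b _ => Finset.sum_congr rfl fun e _ => ?_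
    ring
  · split_ifs <;> ring

theorem evalAt_holLinear (A : Matrix (Fin d) (Fin d) ℂ) (k : ℂ) (m : U) :
    evalAt m (holLinear U A k) =
      7 * ∑ a : Fin d, ∑ b : Fin d, A a b * m.1.1 b.succ * m.1.2.2 a.succ
        - k * (3 * (m.1.1 0 * m.1.2.2 0) + ∑ a : Fin d, m.1.1 a.succ * m.1.2.2 a.succ) := by
  simp [holLinear, mul_assoc, mul_add]

theorem algebraMap_mem_listedRestrictions (a : ℂ) :
    algebraMap ℂ (HolFun U) a ∈ listedRestrictions w c U C := by
  rw [Algebra.algebraMap_eq_smul_one]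
  exact Submodule.smul_mem _ _ (mem_listedRestrictions .one fun m => map_one _)

theorem cx_mem_listedRestrictions (i : Fin (d + 1)) : cx U i ∈ listedRestrictions w c U C :=
  mem_listedRestrictions (.coord i) fun _ => rfl

theorem cp_zero_mem_listedRestrictions : cp U 0 ∈ listedRestrictions w c U C :=
  mem_listedRestrictions (.momentum 0) fun m => by simp [(Fin.succ_ne_zero c).symm]

theorem holMomentum_mem_listedRestrictions (a : Fin d) :
    holMomentum c U a ∈ listedRestrictions w c U C :=
  mem_listedRestrictions (.momentum a.succ) fun m => evalAt_holMomentum a m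

theorem holScaling_mem_listedRestrictions : holScaling U ∈ listedRestrictions w c U C :=
  mem_listedRestrictions .scaling fun m => evalAt_holScaling m

theorem holShear_mem_listedRestrictions (a : Fin d) :
    holShear w c U C a ∈ listedRestrictions w c U C :=
  mem_listedRestrictions (.shear a) fun m => evalAt_holShear a m

theorem holLinear_mem_listedRestrictions {A : Matrix (Fin d) (Fin d) ℂ} {k : ℂ}
    (hA : AnnihilatesCubic C w A) (hk : ∀ b, A c b = if b = c then k else 0) :
    holLinear U A k ∈ listedRestrictions w c U C :=
  mem_listedRestrictions (.linear A k hA hk) fun m => evalAt_holLinear A k m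

theorem ListedFunction.exists_solution (hC : IsSymmetricCubic C) {g : J1 d → ℂ}
    (hg : ListedFunction C w c g) :
    ∃ F : HolFun U, (jetFrame w c U).IsSolution C F ∧ ∀ m : U, evalAt m F = g m := by
  cases hg with
  | one => exact ⟨_, isSolution_algebraMap 1, fun m => by simp⟩
  | coord i => exact ⟨_, isSolution_cx i, fun _ => rfl⟩
  | momentum i =>
    refine Fin.cases ?_ (fun a => ?_) i
    · exact ⟨_, isSolution_cp_zero, fun m => by simp [(Fin.succ_ne_zero c).symm]⟩
    · exact ⟨_, isSolution_holMomentum a, fun m => evalAt_holMomentum a m⟩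
  | scaling => exact ⟨_, isSolution_holScaling, fun m => evalAt_holScaling m⟩
  | shear a => exact ⟨_, isSolution_holShear hC a, fun m => evalAt_holShear a m⟩
  | linear A k hA hk => exact ⟨_, isSolution_holLinear hA hk, fun m => evalAt_holLinear A k m⟩

theorem exists_solution_of_mem_span (hC : IsSymmetricCubic C) {g : J1 d → ℂ}
    (hg : g ∈ Submodule.span ℂ {g | ListedFunction C w c g}) :
    ∃ F ∈ (jetFrame w c U).solutions C, ∀ m : U, evalAt m F = g m := by
  induction hg using Submodule.span_induction with
  | mem g hg => exact ListedFunction.exists_solution hC hg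
  | zero => exact ⟨0, Submodule.zero_mem _, fun m => map_zero _⟩
  | add f g _ _ hf hg =>
    obtain ⟨F, hF, h1⟩ := hf
    obtain ⟨G, hG, h2⟩ := hg
    exact ⟨F + G, Submodule.add_mem _ hF hG, fun m => by rw [map_add, h1, h2, Pi.add_apply]⟩
  | smul a f _ hf =>
    obtain ⟨F, hF, h1⟩ := hf
    exact ⟨a • F, Submodule.smul_mem _ _ hF, fun m => by rw [map_smul, h1, Pi.smul_apply]⟩

section
variable {D : Derivation ℂ (HolFun U) (HolFun U)} (hD : ∀ i, D (cx U i) = 0)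
include hD

theorem deriv_holMomentum (a : Fin d) : D (holMomentum c U a) = D (cp U a.succ) := by
  simp only [holMomentum, map_sub, Derivation.map_smul, Derivation.leibniz, hD, smul_zero, add_zero,
    sub_zero]

theorem deriv_holShear (a : Fin d) : D (holShear w c U C a) = cx U 0 * D (cp U a.succ) := by
  simp only [holShear, map_sub, map_add, map_sum, Derivation.map_smul, Derivation.leibniz, hD,
    smul_zero, mul_zero, add_zero, sub_zero, Finset.sum_const_zero, smul_eq_mul]

theorem deriv_holScaling : D (holScaling U) = (7 : ℂ) • D (cu U)
    - (2 : ℂ) • (cx U 0 * D (cp U 0)) - (3 : ℂ) • ∑ a : Fin d, cx U a.succ * D (cp U a.succ) := by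
  simp [holScaling, hD]

theorem deriv_holLinear (A : Matrix (Fin d) (Fin d) ℂ) (k : ℂ) : D (holLinear U A k) =
    (7 : ℂ) • ∑ a : Fin d, ∑ b : Fin d, A a b • (cx U b.succ * D (cp U a.succ))
      - k • ((3 : ℂ) • (cx U 0 * D (cp U 0)) + ∑ a : Fin d, cx U a.succ * D (cp U a.succ)) := by
  simp [holLinear, hD]

end

theorem ContactFrame.IsConstant.exists_eq_algebraMap (hU : IsPreconnected (U : Set (J1 d)))
    {F : HolFun U} (hF : (jetFrame w c U).IsConstant F) : ∃ a : ℂ, F = algebraMap ℂ _ a := by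
  refine HolFun.exists_eq_algebraMap hU fun m => ContinuousLinearMap.ext fun v => ?_
  have hX0 : fderiv ℂ (extend F) m (frameX0 c m) = 0 := congrArg (evalAt m) hF.X0
  have hX : ∀ t, fderiv ℂ (extend F) m (fieldX w t m) = 0 := fun t => congrArg (evalAt m) (hF.X t)
  have hU0 : fderiv ℂ (extend F) m (ddp 0) = 0 := congrArg (evalAt m) hF.U0
  have hUφ : ∀ φ, fderiv ℂ (extend F) m (fieldU w φ m) = 0 := fun φ => congrArg (evalAt m) (hF.U φ)
  have hZ : fderiv ℂ (extend F) m ddu = 0 := congrArg (evalAt m) hF.Z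
  let t : W := ∑ a, v.1 a.succ • w a
  let φ : W →ₗ[ℂ] ℂ := ∑ a, v.2.2 a.succ • w.coord a
  have ht : ∀ a, w.repr t a = v.1 a.succ := fun a => by
    simp [t, Finsupp.single_apply]
  have hφ : ∀ a, φ (w a) = v.2.2 a.succ := fun a => by
    simp [φ, LinearMap.sum_apply, Finsupp.single_apply]
  have hv : v = v.1 0 • frameX0 c m + fieldX w t m + fieldU w φ m
      + (v.2.2 0 - v.1 0 * m.1.1 c.succ) • ddp 0
      + (v.2.1 - v.1 0 * m.1.2.2 0 - ∑ a, w.repr t a * m.1.2.2 a.succ) • ddu := by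
    refine Prod.ext (funext fun i => ?_) (Prod.ext ?_ (funext fun i => ?_))
    · refine Fin.cases ?_ (fun a => ?_) i <;>
        simp [frameX0_eq, fieldX_eq, fieldU_eq, ddp, ddu, ht]
    · simp [frameX0_eq, fieldX_eq, fieldU_eq, ddp, ddu]
    · refine Fin.cases ?_ (fun a => ?_) i <;>
        simp [frameX0_eq, fieldX_eq, fieldU_eq, ddp, ddu, hφ]
  rw [hv]
  simp [hX0, hX, hU0, hUφ, hZ]

end Listed

/-! ## Solutions with given vertical derivatives -/

section Reconstruction

variable {d : ℕ} {W : Type*} [AddCommGroup W] [Module ℂ W] {w : Module.Basis (Fin d) ℂ W}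
  {c : Fin d} {U : Opens (J1 d)} {C : W →ₗ[ℂ] W →ₗ[ℂ] W →ₗ[ℂ] ℂ}

theorem ContactFrame.X_eq_sum {κ : W →ₗ[ℂ] ℂ} {H : Type*} [AddCommGroup H] [Module ℂ H]
    (𝓕 : ContactFrame κ H) (w : Module.Basis (Fin d) ℂ W) (t : W) (f : H) :
    𝓕.X t f = ∑ a, w.repr t a • 𝓕.X (w a) f := by
  conv_lhs => rw [← w.sum_repr t]
  simp only [map_sum, map_smul, LinearMap.sum_apply, LinearMap.smul_apply]

theorem ContactFrame.U_eq_sum {κ : W →ₗ[ℂ] ℂ} {H : Type*} [AddCommGroup H] [Module ℂ H]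
    (𝓕 : ContactFrame κ H) (w : Module.Basis (Fin d) ℂ W) (φ : W →ₗ[ℂ] ℂ) (f : H) :
    𝓕.U φ f = ∑ a, φ (w a) • 𝓕.U (w.coord a) f := by
  conv_lhs => rw [← w.sum_dual_apply_smul_coord φ]
  simp only [map_sum, map_smul, LinearMap.sum_apply, LinearMap.smul_apply]

variable (U) in
/-- The linear function `q x⁰ + μ_b x^b` of the coordinates of the base. -/
noncomputable def baseLinear (q : ℂ) (μ : Fin d → ℂ) : HolFun U :=
  q • cx U 0 + ∑ b, μ b • cx U b.succ

section BaseLinear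

variable (q : ℂ) (μ : Fin d → ℂ)

theorem evalAt_baseLinear (m : U) :
    evalAt m (baseLinear U q μ) = q * m.1.1 0 + ∑ b, μ b * m.1.1 b.succ := by
  simp [baseLinear]

theorem deriv_baseLinear {D : Derivation ℂ (HolFun U) (HolFun U)} (hD : ∀ i, D (cx U i) = 0) :
    D (baseLinear U q μ) = 0 := by
  simp [baseLinear, hD]

theorem derivX0_baseLinear : derivX0 c U (baseLinear U q μ) = algebraMap ℂ _ q := by
  simp [baseLinear, derivX0_cx_zero, derivX0_cx_succ, Algebra.algebraMap_eq_smul_one]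

theorem derivX_baseLinear (b : Fin d) :
    derivX w U (w b) (baseLinear U q μ) = algebraMap ℂ _ (μ b) := by
  simp [baseLinear, derivX_cx_zero, derivX_cx_succ, Finsupp.single_apply,
    Algebra.algebraMap_eq_smul_one]

theorem baseLinear_mem_listedRestrictions : baseLinear U q μ ∈ listedRestrictions w c U C :=
  add_mem (Submodule.smul_mem _ _ (cx_mem_listedRestrictions 0)) <|
    Submodule.sum_mem _ fun b _ => Submodule.smul_mem _ _ (cx_mem_listedRestrictions b.succ)

theorem exists_eq_baseLinear_add_algebraMap (hU : IsPreconnected (U : Set (J1 d))) {q : ℂ}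
    {μ : Fin d → ℂ} {F : HolFun U} (hX0 : derivX0 c U F = algebraMap ℂ _ q)
    (hX : ∀ b, derivX w U (w b) F = algebraMap ℂ _ (μ b)) (hU0 : derivU0 U F = 0)
    (hUφ : ∀ φ, derivU w U φ F = 0) (hZ : derivZ U F = 0) :
    ∃ p : ℂ, F = baseLinear U q μ + algebraMap ℂ _ p := by
  have hconst : (jetFrame w c U).IsConstant (F - baseLinear U q μ) :=
    { X0 := by rw [jetFrame_X0, map_sub, hX0, derivX0_baseLinear, sub_self]
      X := fun t => by
        rw [ContactFrame.X_eq_sum _ w]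
        exact Finset.sum_eq_zero fun b _ => by
          rw [jetFrame_X, map_sub, hX, derivX_baseLinear, sub_self, smul_zero]
      U0 := by rw [jetFrame_U0, map_sub, hU0, deriv_baseLinear _ _ derivU0_cx, sub_zero]
      U := fun φ => by rw [jetFrame_U, map_sub, hUφ, deriv_baseLinear _ _ (derivU_cx φ), sub_zero]
      Z := by rw [jetFrame_Z, map_sub, hZ, deriv_baseLinear _ _ derivZ_cx, sub_zero] }
  obtain ⟨p, hp⟩ := hconst.exists_eq_algebraMap hU
  exact ⟨p, by rw [← hp, add_sub_cancel]⟩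

end BaseLinear

theorem ContactFrame.IsSolution.mem_listedRestrictions_of_vertical (hC : IsSymmetricCubic C)
    (hU : IsPreconnected (U : Set (J1 d))) {F : HolFun U} (hF : (jetFrame w c U).IsSolution C F)
    (hU0 : derivU0 U F = 0) (hUφ : ∀ φ, derivU w U φ F = 0) (hZ : derivZ U F = 0) :
    F ∈ listedRestrictions w c U C := by
  obtain ⟨q, hq⟩ := (hF.isConstant_X0 hU0 hUφ hZ).exists_eq_algebraMap hU
  choose μ hμ using fun b => (hF.isConstant_X hC hU0 hUφ hZ (w b)).exists_eq_algebraMap hU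
  obtain ⟨p, rfl⟩ := exists_eq_baseLinear_add_algebraMap hU hq hμ hU0 hUφ hZ
  exact add_mem (baseLinear_mem_listedRestrictions q μ) (algebraMap_mem_listedRestrictions p)

/-- The vertical derivatives of `F` are those of the combination of `u_0`, of the functions
`holMomentum`, `holShear`, `holScaling` and of `holLinear U A k` with coefficients
`α`, `p`, `q`, `ζ / 7` and `1`. -/
structure HasVerticalJet (w : Module.Basis (Fin d) ℂ W) (F : HolFun U) (α ζ : ℂ)
    (p q : Fin d → ℂ) (A : Matrix (Fin d) (Fin d) ℂ) (k : ℂ) : Prop where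
  derivU0 : derivU0 U F = baseLinear U (-(2 * ζ / 7 + 3 * k)) 0 + algebraMap ℂ _ α
  derivU : ∀ a, derivU w U (w.coord a) F =
    baseLinear U (q a) (((7 : ℂ) • A - (k + 3 * ζ / 7) • 1) a) + algebraMap ℂ _ (p a)
  derivZ : derivZ U F = algebraMap ℂ _ ζ

theorem ContactFrame.IsSolution.exists_hasVerticalJet (hC : AdjointsOnNoQuadric C)
    (hU : IsPreconnected (U : Set (J1 d))) {F : HolFun U} (hF : (jetFrame w c U).IsSolution C F) :
    ∃ α ζ p q A k, HasVerticalJet w F α ζ p q A k := by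
  have : Module.Finite ℂ W := Module.Finite.of_basis w
  have he : w.coord c (w c) = 1 := by simp
  obtain ⟨β, hβ⟩ := (hF.isConstant_X0_U0 hC he).exists_eq_algebraMap hU
  obtain ⟨ζ, hζ⟩ := (hF.isConstant_Z hC he).exists_eq_algebraMap hU
  choose q hq using fun a => (hF.isConstant_X0_U hC he (w.coord a)).exists_eq_algebraMap hU
  choose M hM using fun a b =>
    (hF.isConstant_X_U hC he (w b) (w.coord a)).exists_eq_algebraMap hU
  obtain ⟨α, hα⟩ := exists_eq_baseLinear_add_algebraMap hU (μ := 0) hβ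
    (fun b => (hF.X_U0 hC he (w b)).trans (map_zero _).symm) (hF.U0_U0 hC he) (hF.U_U0 hC he)
    (hF.Z_U0 hC he)
  choose p hp using fun a => exists_eq_baseLinear_add_algebraMap hU (hq a) (hM a)
    (((jetFrame w c U).U0_U _ F).trans (hF.U_U0 hC he _)) (hF.U_U hC he · _) (hF.Z_U hC he _)
  obtain ⟨k, hk⟩ : ∃ k, -(2 * ζ / 7 + 3 * k) = β := ⟨-(7 * β + 2 * ζ) / 21, by ring⟩
  obtain ⟨A, hA⟩ : ∃ A : Matrix (Fin d) (Fin d) ℂ,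
      (7 : ℂ) • A - (k + 3 * ζ / 7) • (1 : Matrix (Fin d) (Fin d) ℂ) = Matrix.of M :=
    ⟨(7 : ℂ)⁻¹ • (Matrix.of M + (k + 3 * ζ / 7) • 1), by
      rw [smul_inv_smul₀ (by norm_num), add_sub_cancel_right]⟩
  exact ⟨α, ζ, p, q, A, k, hk ▸ hα, fun a => hA ▸ hp a, hζ⟩

namespace HasVerticalJet

variable {F G : HolFun U} {α ζ k : ℂ} {p q : Fin d → ℂ} {A : Matrix (Fin d) (Fin d) ℂ}

theorem X0_U0 (hJ : HasVerticalJet w F α ζ p q A k) :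
    (jetFrame w c U).X0 ((jetFrame w c U).U0 F) = algebraMap ℂ _ (-(2 * ζ / 7 + 3 * k)) := by
  rw [jetFrame_U0, hJ.derivU0, jetFrame_X0, map_add, derivX0_baseLinear,
    Derivation.map_algebraMap, add_zero]

theorem X_U (hJ : HasVerticalJet w F α ζ p q A k) (φ : W →ₗ[ℂ] ℂ) (b : Fin d) :
    (jetFrame w c U).X (w b) ((jetFrame w c U).U φ F)
      = algebraMap ℂ _ (7 * ∑ a, A a b * φ (w a) - (k + 3 * ζ / 7) * φ (w b)) := by
  have hsum : 7 * ∑ a, A a b * φ (w a) - (k + 3 * ζ / 7) * φ (w b) =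
      ∑ a, φ (w a) * ((7 : ℂ) • A - (k + 3 * ζ / 7) • 1) a b := by
    simp only [Matrix.sub_apply, Matrix.smul_apply, Matrix.one_apply, smul_eq_mul, mul_ite,
      mul_one, mul_zero, sub_mul, ite_mul, zero_mul, Finset.sum_sub_distrib, Finset.sum_ite_eq',
      Finset.mem_univ, if_true, Finset.mul_sum, mul_comm (φ _), mul_assoc]
  rw [ContactFrame.U_eq_sum _ w, map_sum, hsum, map_sum]
  refine Finset.sum_congr rfl fun a _ => ?_
  rw [map_smul, jetFrame_U, hJ.derivU, jetFrame_X, map_add, derivX_baseLinear,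
    Derivation.map_algebraMap, add_zero, Algebra.smul_def, ← map_mul]

theorem annihilatesCubic (hC : IsSymmetricCubic C) (hU : (U : Set (J1 d)).Nonempty)
    (hJ : HasVerticalJet w F α ζ p q A k) (hF : (jetFrame w c U).IsSolution C F) :
    AnnihilatesCubic C w A := fun b e h => by
  obtain ⟨m, hm⟩ := hU
  have hpol := congrArg (evalAt ⟨m, hm⟩) (hF.X_U_polarized hC (w b) (w e) (w h))
  rw [hJ.X_U, hJ.X_U, hJ.X_U, hJ.X0_U0, jetFrame_Z, hJ.derivZ] at hpol
  simp only [map_add, map_sub, map_smul, AlgHom.commutes, Algebra.algebraMap_self_apply,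
    smul_eq_mul] at hpol
  rw [hC.swap_right (w e) (w h) (w b), hC.swap_left (w e) (w b) (w h),
    hC.swap_right (w b) (w h) (w e)] at hpol
  simp only [Finset.sum_add_distrib]
  linear_combination hpol / 7

theorem apply_eq_ite (hU : (U : Set (J1 d)).Nonempty) (hJ : HasVerticalJet w F α ζ p q A k)
    (hF : (jetFrame w c U).IsSolution C F) (b : Fin d) : A c b = if b = c then k else 0 := by
  obtain ⟨m, hm⟩ := hU
  have hκ := congrArg (evalAt ⟨m, hm⟩) (hF.X_Uκ (w b))
  rw [hJ.X_U, hJ.X0_U0, jetFrame_Z, hJ.derivZ] at hκ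
  simp only [map_neg, map_add, map_smul, AlgHom.commutes, Algebra.algebraMap_self_apply,
    smul_eq_mul, Module.Basis.coord_apply, Module.Basis.repr_self, Finsupp.single_apply, mul_ite,
    mul_one, mul_zero, Finset.sum_ite_eq', Finset.mem_univ, if_true] at hκ
  split_ifs at hκ ⊢ <;> linear_combination hκ / 7

theorem sub_mem_listedRestrictions (hC : IsSymmetricCubic C)
    (hU : IsPreconnected (U : Set (J1 d))) (hJF : HasVerticalJet w F α ζ p q A k)
    (hJG : HasVerticalJet w G α ζ p q A k) (hF : (jetFrame w c U).IsSolution C F)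
    (hG : (jetFrame w c U).IsSolution C G) : F - G ∈ listedRestrictions w c U C := by
  refine ContactFrame.IsSolution.mem_listedRestrictions_of_vertical hC hU
    (Submodule.sub_mem ((jetFrame w c U).solutions C) hF hG) ?_ (fun φ => ?_) ?_
  · rw [map_sub, hJF.derivU0, hJG.derivU0, sub_self]
  · rw [← jetFrame_U (c := c), ContactFrame.U_eq_sum _ w]
    exact Finset.sum_eq_zero fun a _ => by
      rw [jetFrame_U, map_sub, hJF.derivU, hJG.derivU, sub_self, smul_zero]
  · rw [map_sub, hJF.derivZ, hJG.derivZ, sub_self]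

end HasVerticalJet

section ListedCombination

variable (w c U C) in
/-- The combination of listed functions with the vertical derivatives of `HasVerticalJet`. -/
noncomputable def listedCombination (α ζ : ℂ) (p q : Fin d → ℂ) (A : Matrix (Fin d) (Fin d) ℂ)
    (k : ℂ) : HolFun U :=
  α • cp U 0 + ∑ a, p a • holMomentum c U a + ∑ a, q a • holShear w c U C a
    + (ζ / 7) • holScaling U + holLinear U A k

variable {α ζ k : ℂ} {p q : Fin d → ℂ} {A : Matrix (Fin d) (Fin d) ℂ}

theorem listedCombination_mem_listedRestrictions (hA : AnnihilatesCubic C w A)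
    (hk : ∀ b, A c b = if b = c then k else 0) :
    listedCombination w c U C α ζ p q A k ∈ listedRestrictions w c U C := by
  refine add_mem (add_mem (add_mem (add_mem ?_ (sum_mem fun a _ => ?_)) (sum_mem fun a _ => ?_))
    ?_) (holLinear_mem_listedRestrictions hA hk)
  · exact Submodule.smul_mem _ _ cp_zero_mem_listedRestrictions
  · exact Submodule.smul_mem _ _ (holMomentum_mem_listedRestrictions a)
  · exact Submodule.smul_mem _ _ (holShear_mem_listedRestrictions a)
  · exact Submodule.smul_mem _ _ holScaling_mem_listedRestrictions

theorem isSolution_of_mem_listedRestrictions (hC : IsSymmetricCubic C) {F : HolFun U}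
    (hF : F ∈ listedRestrictions w c U C) : (jetFrame w c U).IsSolution C F := by
  obtain ⟨g, hg, hFg⟩ := hF
  obtain ⟨G, hG, hGg⟩ := exists_solution_of_mem_span (U := U) hC hg
  rwa [ext_evalAt fun m => (hFg m).trans (hGg m).symm]

theorem derivU0_listedCombination : derivU0 U (listedCombination w c U C α ζ p q A k) =
    baseLinear U (-(2 * ζ / 7 + 3 * k)) 0 + algebraMap ℂ _ α := by
  simp only [listedCombination, map_add, map_sum, Derivation.map_smul,
    deriv_holMomentum derivU0_cx, deriv_holShear derivU0_cx, deriv_holScaling derivU0_cx,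
    deriv_holLinear derivU0_cx, derivU0_cp_zero, derivU0_cp_succ, derivU0_cu]
  refine ext_evalAt fun m => ?_
  simp only [map_add, map_sub, map_sum, map_smul, map_zero, map_one, AlgHom.commutes,
    smul_eq_mul, mul_zero, mul_one, Finset.sum_const_zero, add_zero, sub_zero, zero_sub, zero_mul,
    evalAt_cx, evalAt_baseLinear, Pi.zero_apply, Algebra.algebraMap_self_apply]
  ring

theorem derivU_listedCombination (a : Fin d) :
    derivU w U (w.coord a) (listedCombination w c U C α ζ p q A k) =
      baseLinear U (q a) (((7 : ℂ) • A - (k + 3 * ζ / 7) • 1) a) + algebraMap ℂ _ (p a) := by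
  have hd : ∀ i, derivU w U (w.coord a) (cx U i) = 0 := derivU_cx _
  simp only [listedCombination, map_add, map_sum, Derivation.map_smul, deriv_holMomentum hd,
    deriv_holShear hd, deriv_holScaling hd, deriv_holLinear hd, derivU_cp_zero, derivU_cp_succ,
    derivU_cu]
  refine ext_evalAt fun m => ?_
  have hA : ∑ x, ∑ b, (if x = a then A x b * m.1.1 b.succ else 0) =
      ∑ b, A a b * m.1.1 b.succ := by
    rw [Finset.sum_comm]
    exact Finset.sum_congr rfl fun b _ => by simp
  have hM : ∑ b, ((7 : ℂ) • A - (k + 3 * ζ / 7) • 1) a b * m.1.1 b.succ =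
      7 * ∑ b, A a b * m.1.1 b.succ - (k + 3 * ζ / 7) * m.1.1 a.succ := by
    simp [Matrix.one_apply, sub_mul, Finset.mul_sum, mul_assoc]
  simp only [map_add, map_sub, map_sum, map_smul, map_mul, map_zero, AlgHom.commutes,
    smul_eq_mul, mul_zero, mul_one, sub_zero, zero_sub, zero_add, evalAt_cx, evalAt_baseLinear,
    Algebra.algebraMap_self_apply, Module.Basis.coord_apply, Module.Basis.repr_self,
    Finsupp.single_apply, mul_ite, Finset.sum_ite_eq', Finset.mem_univ, if_true, hA, hM]
  ring

theorem derivZ_listedCombination :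
    derivZ U (listedCombination w c U C α ζ p q A k) = algebraMap ℂ _ ζ := by
  simp only [listedCombination, map_add, map_sum, Derivation.map_smul, deriv_holMomentum derivZ_cx,
    deriv_holShear derivZ_cx, deriv_holScaling derivZ_cx, deriv_holLinear derivZ_cx, derivZ_cp,
    derivZ_cu]
  exact ext_evalAt fun m => by simp

theorem hasVerticalJet_listedCombination :
    HasVerticalJet w (listedCombination w c U C α ζ p q A k) α ζ p q A k where
  derivU0 := derivU0_listedCombination
  derivU := derivU_listedCombination
  derivZ := derivZ_listedCombination

end ListedCombination

theorem ContactFrame.IsSolution.mem_listedRestrictions (hC : AdjointsOnNoQuadric C)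
    (hU : IsConnected (U : Set (J1 d))) {F : HolFun U} (hF : (jetFrame w c U).IsSolution C F) :
    F ∈ listedRestrictions w c U C := by
  have hsymm := hC.toIsSymmetricCubic
  obtain ⟨α, ζ, p, q, A, k, hJ⟩ := hF.exists_hasVerticalJet hC hU.isPreconnected
  have hP : listedCombination w c U C α ζ p q A k ∈ listedRestrictions w c U C :=
    listedCombination_mem_listedRestrictions (hJ.annihilatesCubic hsymm hU.nonempty hF)
      (hJ.apply_eq_ite hU.nonempty hF)
  have hsub := hJ.sub_mem_listedRestrictions hsymm hU.isPreconnected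
    hasVerticalJet_listedCombination hF (isSolution_of_mem_listedRestrictions hsymm hP)
  simpa only [sub_add_cancel] using add_mem hsub hP

end Reconstruction

/-! ## Contact vector fields -/

section ContactGeometry

variable {d : ℕ}

/-- The pairing of the momenta of a vector with the positions of another one. -/
noncomputable def momentumPairing (d : ℕ) : J1 d →L[ℂ] J1 d →L[ℂ] ℂ :=
  LinearMap.toContinuousBilinearMap (LinearMap.mk₂ ℂ (fun v v' => ∑ i, v.2.2 i * v'.1 i)
    (fun u v v' => by simp [add_mul, Finset.sum_add_distrib])
    (fun a v v' => by simp [mul_assoc, Finset.mul_sum])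
    (fun u v v' => by simp [mul_add, Finset.sum_add_distrib])
    (fun a v v' => by simp [mul_left_comm, Finset.mul_sum]))

theorem momentumPairing_apply (v v' : J1 d) : momentumPairing d v v' = ∑ i, v.2.2 i * v'.1 i := rfl

/-- The symplectic form on the contact distribution. -/
noncomputable def symplecticForm (d : ℕ) : J1 d →L[ℂ] J1 d →L[ℂ] ℂ :=
  (momentumPairing d).flip - momentumPairing d

theorem symplecticForm_eq (v v' : J1 d) :
    symplecticForm d v v' = momentumPairing d v' v - momentumPairing d v v' := rfl

theorem symplecticForm_apply (v v' : J1 d) :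
    symplecticForm d v v' = ∑ i, v'.2.2 i * v.1 i - ∑ i, v.2.2 i * v'.1 i := rfl

theorem symplecticForm_swap (v v' : J1 d) : symplecticForm d v v' = -symplecticForm d v' v := by
  rw [symplecticForm_eq, symplecticForm_eq, neg_sub]

theorem symplecticForm_self (v : J1 d) : symplecticForm d v v = 0 :=
  sub_self _

/-- The contact form `du - u_i dx^i`. -/
noncomputable def contactForm (m v : J1 d) : ℂ := v.2.1 - momentumPairing d m v

theorem mem_contactDist {m v : J1 d} : v ∈ contactDist m ↔ contactForm m v = 0 := sub_eq_zero.symm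

theorem contactForm_sub (m v v' : J1 d) :
    contactForm m (v - v') = contactForm m v - contactForm m v' := by
  simp only [contactForm, map_sub, Prod.snd_sub, Prod.fst_sub]
  ring

theorem hasFDerivAt_contactForm {Y : J1 d → J1 d} {m : J1 d} (hY : DifferentiableAt ℂ Y m) :
    ∃ L : J1 d →L[ℂ] ℂ, HasFDerivAt (fun x => contactForm x (Y x)) L m ∧
      ∀ v, L v = contactForm m (fderiv ℂ Y m v) - momentumPairing d v (Y m) := by
  have h1 := (momentumPairing d).hasFDerivAt_of_bilinear (hasFDerivAt_id m) hY.hasFDerivAt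
  have h2 := ((ContinuousLinearMap.fst ℂ ℂ (Fin (d + 1) → ℂ)).comp (ContinuousLinearMap.snd ℂ
    (Fin (d + 1) → ℂ) _)).hasFDerivAt.comp m hY.hasFDerivAt
  refine ⟨_, h2.sub h1, fun v => ?_⟩
  simp [contactForm, sub_sub]

theorem fderiv_contactForm {Y : J1 d → J1 d} {m : J1 d} (hY : DifferentiableAt ℂ Y m) (v : J1 d) :
    fderiv ℂ (fun x => contactForm x (Y x)) m v =
      contactForm m (fderiv ℂ Y m v) - momentumPairing d v (Y m) := by
  obtain ⟨L, hL, h⟩ := hasFDerivAt_contactForm hY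
  rw [hL.fderiv, h]

theorem contactForm_lieBracket {S Y : J1 d → J1 d} {m : J1 d} (hS : DifferentiableAt ℂ S m)
    (hY : DifferentiableAt ℂ Y m) : contactForm m (VectorField.lieBracket ℂ S Y m) =
      fderiv ℂ (fun x => contactForm x (Y x)) m (S m)
        - fderiv ℂ (fun x => contactForm x (S x)) m (Y m) + symplecticForm d (Y m) (S m) := by
  rw [fderiv_contactForm hS, fderiv_contactForm hY, symplecticForm_eq, VectorField.lieBracket,
    contactForm_sub]
  ring

theorem sum_smul_ddx (v : Fin (d + 1) → ℂ) : ∑ i, v i • ddx i = ((v, 0, 0) : J1 d) := by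
  refine Prod.ext ?_ (Prod.ext ?_ ?_)
  · ext j
    simp [ddx, Prod.fst_sum, Pi.single_apply]
  · simp [ddx, Prod.snd_sum]
  · simp [ddx, Prod.snd_sum]

theorem sum_smul_ddp (v : Fin (d + 1) → ℂ) : ∑ i, v i • ddp i = ((0, 0, v) : J1 d) := by
  refine Prod.ext ?_ (Prod.ext ?_ ?_)
  · simp [ddp, Prod.fst_sum]
  · simp [ddp, Prod.snd_sum, Prod.fst_sum]
  · ext j
    simp [ddp, Prod.snd_sum, Pi.single_apply]

theorem contactField_eq (f : J1 d → ℂ) (m : J1 d) : contactField f m =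
    (fun i => -fderiv ℂ f m (ddp i), f m - ∑ i, m.2.2 i * fderiv ℂ f m (ddp i),
      fun i => fderiv ℂ f m (ddx i) + m.2.2 i * fderiv ℂ f m ddu) := by
  rw [contactField, sum_smul_ddx, sum_smul_ddp]
  refine Prod.ext ?_ (Prod.ext ?_ ?_)
  · ext i
    simp [ddu]
  · simp [ddu]
  · simp [ddu]

theorem contactForm_contactField (f : J1 d → ℂ) (m : J1 d) :
    contactForm m (contactField f m) = f m := by
  simp [contactForm, momentumPairing_apply, contactField_eq]

theorem fderiv_apply_eq_sum (f : J1 d → ℂ) (m v : J1 d) : fderiv ℂ f m v =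
    ∑ i, v.1 i * fderiv ℂ f m (ddx i) + v.2.1 * fderiv ℂ f m ddu
      + ∑ i, v.2.2 i * fderiv ℂ f m (ddp i) := by
  have h : v = ∑ i, v.1 i • ddx i + v.2.1 • ddu + ∑ i, v.2.2 i • ddp i := by
    rw [sum_smul_ddx, sum_smul_ddp]
    refine Prod.ext ?_ (Prod.ext ?_ ?_) <;> simp [ddu]
  conv_lhs => rw [h]
  simp only [map_add, map_sum, map_smul, smul_eq_mul]

theorem fderiv_eq_symplecticForm (f : J1 d → ℂ) {m v : J1 d} (hv : v ∈ contactDist m) :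
    fderiv ℂ f m v = symplecticForm d v (contactField f m) := by
  rw [fderiv_apply_eq_sum, symplecticForm_apply, contactField_eq]
  have : v.2.1 = ∑ i, m.2.2 i * v.1 i := hv
  simp only [this, add_mul, mul_neg, Finset.sum_add_distrib, Finset.sum_neg_distrib,
    Finset.sum_mul, mul_comm (v.1 _), mul_right_comm]
  ring

theorem differentiableOn_contactField {U : Set (J1 d)} (hU : IsOpen U) {f : J1 d → ℂ}
    (hf : DifferentiableOn ℂ f U) : DifferentiableOn ℂ (contactField f) U := by
  have h : ∀ v, DifferentiableOn ℂ (fun m => fderiv ℂ f m v) U := fun v =>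
    (differentiableOn_fderiv_of_holomorphic hU hf).clm_apply (differentiableOn_const v)
  have h' := fun i => h (ddp i)
  have h'' := fun i => h (ddx i)
  have hp : ∀ i : Fin (d + 1), DifferentiableOn ℂ (fun m : J1 d => m.2.2 i) U := fun i => by
    fun_prop
  rw [funext (contactField_eq f)]
  refine (differentiableOn_pi.2 fun i => (h' i).neg).prodMk (DifferentiableOn.prodMk
    (hf.sub (DifferentiableOn.fun_sum fun i _ => (hp i).mul (h' i)))
    (differentiableOn_pi.2 fun i => (h'' i).add ((hp i).mul (h ddu))))

theorem isContactField_contactField {U : Set (J1 d)} (hU : IsOpen U) {f : J1 d → ℂ}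
    (hf : DifferentiableOn ℂ f U) : IsContactField U (contactField f) := by
  intro Y hY hY' m hm
  have hm' := hU.mem_nhds hm
  rw [mem_contactDist, contactForm_lieBracket
    ((differentiableOn_contactField hU hf).differentiableAt hm') (hY.differentiableAt hm')]
  have h0 : (fun x => contactForm x (Y x)) =ᶠ[nhds m] fun _ => 0 := by
    filter_upwards [hm'] with x hx using mem_contactDist.1 (hY' x hx)
  simp only [h0.fderiv_eq, contactForm_contactField, fderiv_eq_symplecticForm f (hY' m hm)]
  simp

theorem IsContactField.fderiv_contactForm_apply {U : Set (J1 d)} {S : J1 d → J1 d}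
    (h : IsContactField U S) {m v : J1 d} (hm : m ∈ U) (hS : DifferentiableAt ℂ S m)
    (hv : v ∈ contactDist m) :
    fderiv ℂ (fun x => contactForm x (S x)) m v = symplecticForm d v (S m) := by
  let Y : J1 d → J1 d := fun x => (v.1, momentumPairing d x v, v.2.2)
  have hY : Differentiable ℂ Y := by fun_prop
  have hY' : ∀ x, Y x ∈ contactDist x := fun x => rfl
  have hYm : Y m = v := Prod.ext rfl (Prod.ext hv.symm rfl)
  have h0 := mem_contactDist.1 (h Y hY.differentiableOn (fun x _ => hY' x) m hm)
  rw [contactForm_lieBracket hS (hY m), hYm] at h0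
  simp only [mem_contactDist.1 (hY' _), fderiv_fun_const, Pi.zero_apply, zero_apply,
    zero_sub] at h0
  linear_combination -h0

theorem contactField_eq_of_fderiv_eq_symplecticForm {f : J1 d → ℂ} {m v : J1 d}
    (hf : f m = contactForm m v)
    (h : ∀ y ∈ contactDist m, fderiv ℂ f m y = symplecticForm d y v) : contactField f m = v := by
  have hp : ∀ i, fderiv ℂ f m (ddp i) = -v.1 i := fun i => by
    rw [h _ (by simp [contactDist, ddp]), symplecticForm_apply]
    simp [ddp, Pi.single_apply]
  have hx : ∀ i, fderiv ℂ f m (ddx i) + m.2.2 i * fderiv ℂ f m ddu = v.2.2 i := fun i => by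
    rw [← smul_eq_mul, ← map_smul, ← map_add,
      h _ (by simp [contactDist, ddx, ddu, Pi.single_apply]), symplecticForm_apply]
    simp [ddx, ddu, Pi.single_apply]
  rw [contactField_eq]
  refine Prod.ext (funext fun i => ?_) (Prod.ext ?_ (funext hx))
  · simp only [hp, neg_neg]
  · simp [hf, hp, contactForm, momentumPairing_apply]

theorem IsContactField.exists_eqOn_contactField {U : Set (J1 d)} (hU : IsOpen U)
    {S : J1 d → J1 d} (hS : DifferentiableOn ℂ S U) (h : IsContactField U S) :
    ∃ f : J1 d → ℂ, DifferentiableOn ℂ f U ∧ Set.EqOn S (contactField f) U := by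
  have hS' : ∀ m ∈ U, DifferentiableAt ℂ S m := fun m hm => hS.differentiableAt (hU.mem_nhds hm)
  refine ⟨fun m => contactForm m (S m), fun m hm => ?_, fun m hm =>
    (contactField_eq_of_fderiv_eq_symplecticForm (f := fun m => contactForm m (S m)) rfl fun y hy =>
      h.fderiv_contactForm_apply hm (hS' m hm) hy).symm⟩
  obtain ⟨L, hL, -⟩ := hasFDerivAt_contactForm (hS' m hm)
  exact hL.differentiableAt.differentiableWithinAt

theorem symplecticForm_lieBracket {U : Set (J1 d)} (hU : IsOpen U) {f : J1 d → ℂ}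
    (hf : DifferentiableOn ℂ f U) {m : J1 d} (hm : m ∈ U) {Y Y' : J1 d → J1 d}
    (hY' : DifferentiableAt ℂ Y' m) (h' : ∀ x, Y' x ∈ contactDist x) :
    symplecticForm d (VectorField.lieBracket ℂ (contactField f) Y m) (Y' m) =
      fderiv ℂ (fun x => fderiv ℂ f x (Y' x)) m (Y m)
        + symplecticForm d (fderiv ℂ Y m (contactField f m)) (Y' m)
        - symplecticForm d (fderiv ℂ Y' m (Y m)) (contactField f m) := by
  have hS := (differentiableOn_contactField hU hf).differentiableAt (hU.mem_nhds hm)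
  simp only [fderiv_eq_symplecticForm f (h' _)]
  rw [((symplecticForm d).hasFDerivAt_of_bilinear hY'.hasFDerivAt hS.hasFDerivAt).fderiv]
  simp only [VectorField.lieBracket, map_sub, sub_apply, _root_.add_apply,
    ContinuousLinearMap.precompR_apply, ContinuousLinearMap.precompL_apply,
    ContinuousLinearMap.compL_apply, ContinuousLinearMap.comp_apply]
  rw [symplecticForm_swap (Y' m)]
  ring

end ContactGeometry

section TangentSpace

variable {E : Type*} [NormedAddCommGroup E] [NormedSpace ℂ E]

theorem bilinear_apply_of_mem_affineTangentSpace {s : Set E} {Q : E →L[ℂ] E →L[ℂ] ℂ}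
    (hQ : ∀ v ∈ s, Q v v = 0) {v y : E} (hv : v ∈ closure s)
    (hy : y ∈ affineTangentSpace (closure s) v) : Q y v + Q v y = 0 := by
  have hcl : ∀ x ∈ closure s, Q x x = 0 := fun x hx =>
    closure_minimal (t := {x | Q x x = 0}) hQ
      (isClosed_eq (by fun_prop) continuous_const) hx
  refine Submodule.span_induction (p := fun y _ => Q y v + Q v y = 0) ?_ (by simp)
    (fun x y _ _ hx hy => ?_) (fun a x _ hx => ?_) hy
  · rintro x (rfl | ⟨γ, hγ, rfl, hK, rfl⟩)
    · rw [hcl _ hv, add_zero]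
    · have h1 := Q.hasFDerivAt_of_bilinear hγ.differentiableAt.hasFDerivAt
        hγ.differentiableAt.hasFDerivAt
      have h2 : (fun z => Q (γ z) (γ z)) =ᶠ[nhds 0] fun _ => 0 := by
        filter_upwards [hK] with z hz using hcl _ hz
      have h3 := h1.fderiv
      rw [h2.fderiv_eq] at h3
      have h4 := congrArg (fun L : ℂ →L[ℂ] ℂ => L 1) h3
      simp only [fderiv_fun_const, Pi.zero_apply, zero_apply, _root_.add_apply,
        ContinuousLinearMap.precompR_apply, ContinuousLinearMap.precompL_apply,
        ContinuousLinearMap.compL_apply, ContinuousLinearMap.comp_apply,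
        fderiv_apply_one_eq_deriv] at h4
      rw [add_comm]
      exact h4.symm
  · simp only [map_add, _root_.add_apply]
    linear_combination hx + hy
  · simp only [map_smul, _root_.smul_apply, smul_eq_mul]
    linear_combination a * hx

theorem mem_affineTangentSpace_of_cubic [CompleteSpace E] {K : Set E} {v₀ v₁ v₂ v₃ : E}
    (h : ∀ z : ℂ, v₀ + z • v₁ + z ^ 2 • v₂ + z ^ 3 • v₃ ∈ K) : v₁ ∈ affineTangentSpace K v₀ := by
  refine Submodule.subset_span (Or.inr ⟨_, ?_, ?_, Filter.Eventually.of_forall h, ?_⟩)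
  · exact Differentiable.analyticAt (by fun_prop) 0
  · simp
  · have h1 : HasDerivAt (fun z : ℂ => z) 1 0 := hasDerivAt_id 0
    have h2 := (((h1.smul_const v₁).const_add v₀).add ((h1.pow 2).smul_const v₂)).add
      ((h1.pow 3).smul_const v₃)
    exact h2.deriv.trans (by simp)

theorem self_mem_affineTangentSpace (K : Set E) (v : E) : v ∈ affineTangentSpace K v :=
  Submodule.subset_span (Or.inl rfl)

end TangentSpace

/-! ## Brackets with the frame and the tangent spaces of the cone -/

/-- The components of a vector of the contact distribution in the frame that consists of `X_0`,
the `X_a`, `U^0` and the `U^a`; those along the `X_a` are collected in a vector of `W`, and those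
along the `U^a` in a linear form on `W`. -/
abbrev FrameVector (W : Type*) [AddCommGroup W] [Module ℂ W] : Type _ :=
  ℂ × W × ℂ × (W →ₗ[ℂ] ℂ)

section FrameFields

variable {d : ℕ} {W : Type*} [AddCommGroup W] [Module ℂ W] (w : Module.Basis (Fin d) ℂ W)
  (c : Fin d)

/-- The vector fields that are constant in the frame. -/
noncomputable def frameField : FrameVector W →ₗ[ℂ] (J1 d → J1 d) where
  toFun q m := q.1 • frameX0 c m + fieldX w q.2.1 m + q.2.2.1 • ddp 0 + fieldU w q.2.2.2 m
  map_add' q q' := funext fun m => by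
    simp only [Prod.fst_add, Prod.snd_add, fieldX_add, fieldU_add, Pi.add_apply]
    module
  map_smul' a q := funext fun m => by
    simp only [Prod.smul_fst, Prod.smul_snd, fieldX_smul, fieldU_smul, Pi.smul_apply,
      RingHom.id_apply, smul_eq_mul]
    module

variable {w c}

theorem frameField_apply (q : FrameVector W) (m : J1 d) : frameField w c q m =
    q.1 • frameX0 c m + fieldX w q.2.1 m + q.2.2.1 • ddp 0 + fieldU w q.2.2.2 m := rfl

theorem frameField_eq (q : FrameVector W) (m : J1 d) : frameField w c q m =
    (Fin.cons q.1 (w.repr q.2.1), q.1 * m.2.2 0 + ∑ a, w.repr q.2.1 a * m.2.2 a.succ,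
      Fin.cons (q.2.2.1 + q.1 * m.1 c.succ) fun a => q.2.2.2 (w a)) := by
  rw [frameField_apply, frameX0_eq, fieldX_eq, fieldU_eq]
  refine Prod.ext (funext fun i => ?_) (Prod.ext ?_ (funext fun i => ?_))
  · refine Fin.cases ?_ (fun a => ?_) i <;> simp [ddp]
  · simp [ddp]
  · refine Fin.cases ?_ (fun a => ?_) i <;> simp [ddp, add_comm]

theorem differentiable_frameField (q : FrameVector W) :
    Differentiable ℂ (frameField w c q) :=
  ((((differentiable_frameX0 c).const_smul q.1).add (differentiable_fieldX w q.2.1)).add_const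
    (q.2.2.1 • ddp 0)).add (differentiable_fieldU w q.2.2.2)

theorem fderiv_frameField (q : FrameVector W) (m v : J1 d) :
    fderiv ℂ (frameField w c q) m v =
      (0, q.1 * v.2.2 0 + ∑ a, w.repr q.2.1 a * v.2.2 a.succ,
        Pi.single 0 (q.1 * v.1 c.succ)) := by
  have h := (((((differentiable_frameX0 c) m).hasFDerivAt.const_smul q.1).add
    ((differentiable_fieldX w q.2.1) m).hasFDerivAt).add_const (q.2.2.1 • ddp 0)).add
    ((differentiable_fieldU w q.2.2.2) m).hasFDerivAt
  have h' := congrArg (fun L : J1 d →L[ℂ] J1 d => L v) h.fderiv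
  refine Eq.trans h' ?_
  simp only [_root_.add_apply, _root_.smul_apply, fderiv_frameX0, fderiv_fieldX, fderiv_fieldU]
  refine Prod.ext ?_ (Prod.ext ?_ ?_)
  · simp
  · simp
  · simp [← Pi.single_smul']

theorem frameField_mem_contactDist (q : FrameVector W) (m : J1 d) :
    frameField w c q m ∈ contactDist m := by
  simp [contactDist, frameField_eq, Fin.sum_univ_succ, mul_comm]

theorem exists_frameField_eq {m v : J1 d} (hv : v ∈ contactDist m) :
    ∃ q, frameField w c q m = v := by
  refine ⟨(v.1 0, pointX w v, v.2.2 0 - v.1 0 * m.1 c.succ, ∑ a, v.2.2 a.succ • w.coord a), ?_⟩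
  have hv' : v.2.1 = ∑ i, m.2.2 i * v.1 i := hv
  have hX : ∀ a, w.repr (pointX w v) a = v.1 a.succ := fun a => by
    simp [pointX, Finsupp.single_apply]
  rw [frameField_eq]
  refine Prod.ext (funext fun i => ?_) (Prod.ext ?_ (funext fun i => ?_))
  · refine Fin.cases ?_ (fun a => ?_) i <;> simp [hX]
  · simp [hX, hv', Fin.sum_univ_succ, mul_comm]
  · refine Fin.cases ?_ (fun a => ?_) i
    · simp
    · simp [LinearMap.sum_apply, Finsupp.single_apply]

theorem symplecticForm_frameField (q q' : FrameVector W) (m : J1 d) :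
    symplecticForm d (frameField w c q m) (frameField w c q' m) =
      q.1 * q'.2.2.1 + q'.2.2.2 q.2.1 - q'.1 * q.2.2.1 - q.2.2.2 q'.2.1 := by
  rw [symplecticForm_apply, frameField_eq, frameField_eq, ← sum_repr_mul w q'.2.2.2,
    ← sum_repr_mul w q.2.2.2]
  simp only [Fin.sum_univ_succ, Fin.cons_zero, Fin.cons_succ, mul_comm (q.2.2.2 _),
    mul_comm (q'.2.2.2 _)]
  ring

variable (w c)

/-- The symplectic products of the brackets of `S` and the frame with the frame. -/
noncomputable def bracketForm (S : J1 d → J1 d) (m : J1 d) :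
    FrameVector W →ₗ[ℂ] FrameVector W →ₗ[ℂ] ℂ :=
  LinearMap.mk₂ ℂ (fun q q' => symplecticForm d
      (VectorField.lieBracket ℂ S (frameField w c q) m) (frameField w c q' m))
    (fun q q' r => by
      rw [map_add, VectorField.lieBracket_add_right (differentiable_frameField q m)
        (differentiable_frameField q' m), map_add, _root_.add_apply])
    (fun a q r => by
      rw [map_smul, VectorField.lieBracket_const_smul_right (differentiable_frameField q m),
        map_smul, _root_.smul_apply])
    (fun q r r' => by rw [map_add, Pi.add_apply, map_add])
    (fun a q r => by rw [map_smul, Pi.smul_apply, map_smul])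

variable {w c}

theorem bracketForm_apply (S : J1 d → J1 d) (m : J1 d) (q q' : FrameVector W) :
    bracketForm w c S m q q' = symplecticForm d
      (VectorField.lieBracket ℂ S (frameField w c q) m) (frameField w c q' m) := rfl

variable {U : Set (J1 d)} (hU : IsOpen U) {f : J1 d → ℂ} (hf : DifferentiableOn ℂ f U) {m : J1 d}
  (hm : m ∈ U)
include hU hf hm

theorem bracketForm_contactField (q q' : FrameVector W) :
    bracketForm w c (contactField f) m q q' =
      fderiv ℂ (fun x => fderiv ℂ f x (frameField w c q' x)) m (frameField w c q m)
        + q.1 * q'.1 * fderiv ℂ f m (ddp c.succ)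
        - q'.1 * w.coord c q.2.1 * fderiv ℂ f m (ddp 0) := by
  rw [bracketForm_apply, symplecticForm_lieBracket hU hf hm (differentiable_frameField q' m)
    (frameField_mem_contactDist q'), fderiv_frameField, fderiv_frameField, symplecticForm_apply,
    symplecticForm_apply]
  simp only [frameField_eq, contactField_eq]
  simp [Pi.single_apply]
  ring

omit hU hf hm in
theorem fderiv_apply_fderiv_frameField (r r' : FrameVector W) :
    fderiv ℂ f m (fderiv ℂ (frameField w c r') m (frameField w c r m)) =
      (r'.1 * (r.2.2.1 + r.1 * m.1 c.succ) + r.2.2.2 r'.2.1) * fderiv ℂ f m ddu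
        + r'.1 * w.coord c r.2.1 * fderiv ℂ f m (ddp 0) := by
  rw [fderiv_frameField, fderiv_apply_eq_sum, frameField_eq, ← sum_repr_mul w r.2.2.2]
  simp [Pi.single_apply]

theorem bracketForm_swap (q q' : FrameVector W) :
    bracketForm w c (contactField f) m q q' - bracketForm w c (contactField f) m q' q =
      -symplecticForm d (frameField w c q m) (frameField w c q' m) * fderiv ℂ f m ddu := by
  have hd := (differentiableOn_fderiv_of_holomorphic hU hf).differentiableAt (hU.mem_nhds hm)
  have hsymm := second_derivative_symmetric_of_eventually (𝕜 := ℂ) (f := f) (f' := fderiv ℂ f)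
    (by filter_upwards [hU.mem_nhds hm] with y hy using
          (hf.differentiableAt (hU.mem_nhds hy)).hasFDerivAt) hd.hasFDerivAt
    (frameField w c q m) (frameField w c q' m)
  rw [bracketForm_contactField hU hf hm, bracketForm_contactField hU hf hm,
    fderiv_clm_apply hd (differentiable_frameField q' m),
    fderiv_clm_apply hd (differentiable_frameField q m)]
  simp only [_root_.add_apply, ContinuousLinearMap.comp_apply, ContinuousLinearMap.flip_apply,
    hsymm, fderiv_apply_fderiv_frameField, symplecticForm_frameField]
  ring

end FrameFields

section Cone

variable {d : ℕ} {W : Type*} [AddCommGroup W] [Module ℂ W] (w : Module.Basis (Fin d) ℂ W)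
  (c : Fin d) (C : W →ₗ[ℂ] W →ₗ[ℂ] W →ₗ[ℂ] ℂ)

/-- The components of `V(l, t)` in the frame. -/
noncomputable def coneVector (l : ℂ) (t : W) : FrameVector W :=
  (l ^ 3, -(l ^ 2) • t, -(1 / 2 * C t t t), -(3 / 2 * l) • C t t)

/-- The derivative of `V(l, t)` with respect to `t`. -/
noncomputable def coneTangent (l : ℂ) (t s : W) : FrameVector W :=
  (0, -(l ^ 2) • s, -(3 / 2 * C t t s), -(3 * l) • C t s)

theorem pointX_add (v v' : J1 d) : pointX w (v + v') = pointX w v + pointX w v' := by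
  simp [pointX, add_smul, Finset.sum_add_distrib]

theorem pointX_smul (a : ℂ) (v : J1 d) : pointX w (a • v) = a • pointX w v := by
  simp [pointX, mul_smul, Finset.smul_sum]

/-- The bilinear form of the equation `x⁰ u_a + (3/2) C_a(X²) = 0` of the cone. -/
noncomputable def coneEquation (a : Fin d) : J1 d →L[ℂ] J1 d →L[ℂ] ℂ :=
  LinearMap.toContinuousBilinearMap (LinearMap.mk₂ ℂ
    (fun v v' => v.1 0 * v'.2.2 a.succ + 3 / 2 * C (w a) (pointX w v) (pointX w v'))
    (fun u v v' => by
      simp only [pointX_add, map_add, LinearMap.add_apply, Prod.fst_add, Pi.add_apply]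
      ring)
    (fun a v v' => by
      simp only [pointX_smul, map_smul, LinearMap.smul_apply, Prod.smul_fst, Pi.smul_apply,
        smul_eq_mul]
      ring)
    (fun u v v' => by
      simp only [pointX_add, map_add, Prod.snd_add, Pi.add_apply]
      ring)
    (fun a v v' => by
      simp only [pointX_smul, map_smul, Prod.smul_snd, Pi.smul_apply, smul_eq_mul]
      ring))

/-- The bilinear form of the equation `3 x⁰ (u_0 - x⁰ m^c) + x^a u_a = 0` of the cone at `m`. -/
noncomputable def coneEquationZero (m : J1 d) : J1 d →L[ℂ] J1 d →L[ℂ] ℂ :=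
  LinearMap.toContinuousBilinearMap (LinearMap.mk₂ ℂ
    (fun v v' => 3 * (v.1 0 * (v'.2.2 0 - v'.1 0 * m.1 c.succ))
      + ∑ a : Fin d, v.1 a.succ * v'.2.2 a.succ)
    (fun u v v' => by
      simp only [Prod.fst_add, Pi.add_apply, add_mul, Finset.sum_add_distrib]
      ring)
    (fun a v v' => by
      simp only [Prod.smul_fst, Pi.smul_apply, smul_eq_mul, mul_assoc, ← Finset.mul_sum]
      ring)
    (fun u v v' => by
      simp only [Prod.fst_add, Prod.snd_add, Pi.add_apply, mul_add, Finset.sum_add_distrib]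
      ring)
    (fun a v v' => by
      simp only [Prod.smul_fst, Prod.smul_snd, Pi.smul_apply, smul_eq_mul,
        mul_left_comm _ a, ← Finset.mul_sum]
      ring))

variable {w c C}

theorem coneEquation_apply (a : Fin d) (v v' : J1 d) : coneEquation w C a v v' =
    v.1 0 * v'.2.2 a.succ + 3 / 2 * C (w a) (pointX w v) (pointX w v') := rfl

theorem coneEquationZero_apply (m v v' : J1 d) : coneEquationZero c m v v' =
    3 * (v.1 0 * (v'.2.2 0 - v'.1 0 * m.1 c.succ))
      + ∑ a : Fin d, v.1 a.succ * v'.2.2 a.succ := rfl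

theorem pointX_frameField (q : FrameVector W) (m : J1 d) :
    pointX w (frameField w c q m) = q.2.1 := by
  simp [pointX, frameField_eq, w.sum_repr]

theorem sum_mul_apply_pointX (B : W →ₗ[ℂ] W →ₗ[ℂ] W →ₗ[ℂ] ℂ) (v : J1 d) (s t : W) :
    ∑ a : Fin d, v.1 a.succ * B (w a) s t = B (pointX w v) s t := by
  simp [pointX, LinearMap.sum_apply]

theorem fieldV_eq_frameField (hC : IsSymmetricCubic C) (l : ℂ) (t : W) :
    fieldV C w c l t = frameField w c (coneVector C l t) := by
  funext m
  rw [fieldV_eq w c C hC, frameField_apply]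
  simp only [coneVector, fieldX_smul, fieldU_smul]
  module

theorem fieldV_mem_subadjointCone (l : ℂ) (t : W) (m : J1 d) :
    fieldV C w c l t m ∈ subadjointCone C w c m := subset_closure ⟨l, t, rfl⟩

theorem coneEquation_fieldV (hC : IsSymmetricCubic C) (a : Fin d) (l : ℂ) (t : W) (m : J1 d) :
    coneEquation w C a (fieldV C w c l t m) (fieldV C w c l t m) = 0 := by
  rw [fieldV_eq_frameField hC, coneEquation_apply, pointX_frameField, frameField_eq]
  simp only [coneVector, Fin.cons_zero, Fin.cons_succ, LinearMap.smul_apply, map_smul,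
    smul_eq_mul, hC.swap_left (w a) t t, hC.swap_right t (w a) t]
  ring

theorem coneEquationZero_fieldV (hC : IsSymmetricCubic C) (l : ℂ) (t : W) (m : J1 d) :
    coneEquationZero c m (fieldV C w c l t m) (fieldV C w c l t m) = 0 := by
  rw [fieldV_eq_frameField hC, coneEquationZero_apply, frameField_eq]
  simp only [Fin.cons_zero, Fin.cons_succ, sum_repr_mul]
  simp only [coneVector, LinearMap.smul_apply, map_smul, smul_eq_mul]
  ring

theorem symplecticForm_eq_zero_of_coneEquation (hC : IsSymmetricCubic C) {m v y : J1 d}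
    (hv : v.1 0 ≠ 0) (h : ∀ a, coneEquation w C a v v = 0) (h0 : coneEquationZero c m v v = 0)
    (hy : ∀ a, coneEquation w C a y v + coneEquation w C a v y = 0)
    (hy0 : coneEquationZero c m y v + coneEquationZero c m v y = 0) :
    symplecticForm d y v = 0 := by
  simp only [coneEquation_apply, coneEquationZero_apply] at h h0 hy hy0
  have hsum : ∑ a : Fin d, y.1 a.succ * (v.1 0 * v.2.2 a.succ
      + 3 / 2 * C (w a) (pointX w v) (pointX w v)) = 0 :=
    Finset.sum_eq_zero fun a _ => by rw [h, mul_zero]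
  have hsum' : ∑ a : Fin d, v.1 a.succ * (y.1 0 * v.2.2 a.succ
      + 3 / 2 * C (w a) (pointX w y) (pointX w v) + (v.1 0 * y.2.2 a.succ
      + 3 / 2 * C (w a) (pointX w v) (pointX w y))) = 0 :=
    Finset.sum_eq_zero fun a _ => by rw [hy, mul_zero]
  simp only [mul_add, Finset.sum_add_distrib, mul_left_comm _ (3 / 2 : ℂ),
    mul_left_comm _ (v.1 0), mul_left_comm _ (y.1 0), ← Finset.mul_sum,
    sum_mul_apply_pointX] at hsum hsum'
  rw [symplecticForm_apply, Fin.sum_univ_succ, Fin.sum_univ_succ]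
  refine (mul_eq_zero.1 ?_).resolve_left hv
  simp only [mul_comm (v.2.2 _), mul_comm (y.2.2 _)]
  linear_combination -(v.1 0 / 3) * hy0 - 2 / 3 * hsum' + 4 / 3 * hsum + 2 / 3 * y.1 0 * h0
    - hC.swap_right (pointX w v) (pointX w y) (pointX w v)
    + 2 * hC.swap_left (pointX w v) (pointX w y) (pointX w v)

theorem symplecticForm_eq_zero_of_mem_affineTangentSpace (hC : IsSymmetricCubic C) {l : ℂ}
    (hl : l ≠ 0) (t : W) {m y : J1 d}
    (hy : y ∈ affineTangentSpace (subadjointCone C w c m) (fieldV C w c l t m)) :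
    symplecticForm d y (fieldV C w c l t m) = 0 := by
  have hv := fieldV_mem_subadjointCone (C := C) (w := w) (c := c) l t m
  refine symplecticForm_eq_zero_of_coneEquation hC ?_ (coneEquation_fieldV hC · l t m)
    (coneEquationZero_fieldV hC l t m)
    (fun a => bilinear_apply_of_mem_affineTangentSpace ?_ hv hy)
    (bilinear_apply_of_mem_affineTangentSpace ?_ hv hy)
  · rw [fieldV_eq_frameField hC, frameField_eq]
    exact pow_ne_zero 3 hl
  · rintro _ ⟨l', t', rfl⟩
    exact coneEquation_fieldV hC a l' t' m
  · rintro _ ⟨l', t', rfl⟩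
    exact coneEquationZero_fieldV hC l' t' m

theorem coneVector_add (hC : IsSymmetricCubic C) (l z : ℂ) (t s : W) :
    coneVector C l (t + z • s) = coneVector C l t + z • coneTangent C l t s
      + z ^ 2 • ((0, 0, -(3 / 2 * C s s t), -(3 / 2 * l) • C s s) : FrameVector W)
      + z ^ 3 • ((0, 0, -(1 / 2 * C s s s), 0) : FrameVector W) := by
  refine Prod.ext ?_ (Prod.ext ?_ (Prod.ext ?_ ?_))
  · simp [coneVector, coneTangent]
  · simp only [coneVector, coneTangent, Prod.fst_add, Prod.snd_add, Prod.smul_fst, Prod.smul_snd]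
    module
  · simp only [coneVector, coneTangent, Prod.fst_add, Prod.snd_add, Prod.smul_fst, Prod.smul_snd,
      map_add, map_smul, LinearMap.add_apply, LinearMap.smul_apply, smul_eq_mul,
      hC.comm s t, hC.swap_right t s t, hC.swap_right s s t]
    ring
  · simp only [coneVector, coneTangent, Prod.snd_add, Prod.smul_snd,
      map_add, map_smul, LinearMap.add_apply, LinearMap.smul_apply, hC.comm s t]
    module

theorem frameField_coneTangent_mem_affineTangentSpace (hC : IsSymmetricCubic C) (l : ℂ) (t s : W)
    (m : J1 d) :
    frameField w c (coneTangent C l t s) m ∈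
      affineTangentSpace (subadjointCone C w c m) (fieldV C w c l t m) := by
  rw [fieldV_eq_frameField hC]
  refine mem_affineTangentSpace_of_cubic
    (v₂ := frameField w c (0, 0, -(3 / 2 * C s s t), -(3 / 2 * l) • C s s) m)
    (v₃ := frameField w c (0, 0, -(1 / 2 * C s s s), 0) m) fun z => ?_
  have h := fieldV_mem_subadjointCone (C := C) (w := w) (c := c) l (t + z • s) m
  rw [fieldV_eq_frameField hC, coneVector_add hC] at h
  simpa only [map_add, map_smul, Pi.add_apply, Pi.smul_apply] using h

theorem symplecticForm_coneTangent_coneVector (hC : IsSymmetricCubic C) (l : ℂ) (t s : W)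
    (m : J1 d) : symplecticForm d (frameField w c (coneTangent C l t s) m)
      (frameField w c (coneVector C l t) m) = 0 := by
  simp only [symplecticForm_frameField, coneVector, coneTangent, LinearMap.smul_apply, map_smul,
    smul_eq_mul, hC.swap_right t s t]
  ring

theorem symplecticForm_coneTangent_coneTangent (hC : IsSymmetricCubic C) (l : ℂ) (t s s' : W)
    (m : J1 d) : symplecticForm d (frameField w c (coneTangent C l t s) m)
      (frameField w c (coneTangent C l t s') m) = 0 := by
  simp only [symplecticForm_frameField, coneTangent, LinearMap.smul_apply, map_smul,
    smul_eq_mul, hC.swap_right t s s']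
  ring

-- The tangent space is Lagrangian: modulo the vectors spanned by the isotropic `V` and its
-- `t`-derivatives, `q` has no components along the `X_i`, and the pairings with `V` and its
-- `t`-derivatives detect the remaining ones.
theorem frameField_mem_affineTangentSpace (hC : IsSymmetricCubic C) {l : ℂ} (hl : l ≠ 0) (t : W)
    {m : J1 d} {q : FrameVector W}
    (h : symplecticForm d (frameField w c q m) (frameField w c (coneVector C l t) m) = 0)
    (h' : ∀ s, symplecticForm d (frameField w c q m) (frameField w c (coneTangent C l t s) m) = 0) :
    frameField w c q m ∈ affineTangentSpace (subadjointCone C w c m) (fieldV C w c l t m) := by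
  obtain ⟨r, hr⟩ : ∃ r, r * l ^ 3 = q.1 := ⟨q.1 / l ^ 3, div_mul_cancel₀ _ (pow_ne_zero 3 hl)⟩
  obtain ⟨s, hs⟩ : ∃ s, -(l ^ 2) • s = q.2.1 + (r * l ^ 2) • t :=
    ⟨(-(l ^ 2))⁻¹ • _, smul_inv_smul₀ (neg_ne_zero.2 (pow_ne_zero 2 hl)) _⟩
  obtain ⟨z, φ, hq⟩ : ∃ z φ,
      q = r • coneVector C l t + coneTangent C l t s + ((0, 0, z, φ) : FrameVector W) := by
    refine ⟨(q - r • coneVector C l t - coneTangent C l t s).2.2.1,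
      (q - r • coneVector C l t - coneTangent C l t s).2.2.2,
      Prod.ext ?_ (Prod.ext ?_ (Prod.ext ?_ ?_))⟩
    · simp [coneVector, coneTangent, hr]
    · simp [coneVector, coneTangent, hs, smul_smul]
    · simp
    · simp
  simp only [hq, map_add, map_smul, Pi.add_apply, Pi.smul_apply, _root_.add_apply,
    _root_.smul_apply, symplecticForm_coneTangent_coneVector hC,
    symplecticForm_coneTangent_coneTangent hC,
    symplecticForm_swap (frameField w c (coneVector C l t) m)
      (frameField w c (coneTangent C l t _) m), symplecticForm_self, neg_zero, smul_zero,
    zero_add, symplecticForm_frameField] at h h'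
  have hφ : φ = 0 := LinearMap.ext fun s' => by
    simpa [coneTangent, hl] using h' s'
  have hz : z = 0 := by simpa [coneVector, hφ, hl] using h
  rw [hq, hφ, hz, show ((0, 0, 0, 0) : FrameVector W) = 0 from rfl, add_zero, map_add, map_smul,
    Pi.add_apply, Pi.smul_apply]
  refine Submodule.add_mem _ (Submodule.smul_mem _ _ ?_)
    (frameField_coneTangent_mem_affineTangentSpace hC l t _ m)
  rw [← fieldV_eq_frameField hC]
  exact self_mem_affineTangentSpace _ _

end Cone

/-! ## Symmetries and their generating functions -/

section Symmetries

variable {d : ℕ} {W : Type*} [AddCommGroup W] [Module ℂ W] {w : Module.Basis (Fin d) ℂ W}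
  {c : Fin d} {C : W →ₗ[ℂ] W →ₗ[ℂ] W →ₗ[ℂ] ℂ}

theorem bilinear_apply_add_apply_eq_zero_of_cubic {M : Type*} [AddCommGroup M]
    [Module ℂ M] (Φ : M →ₗ[ℂ] M →ₗ[ℂ] ℂ) {q₀ q₁ q₂ q₃ : M}
    (h : ∀ z : ℂ, Φ (q₀ + z • q₁ + z ^ 2 • q₂ + z ^ 3 • q₃)
      (q₀ + z • q₁ + z ^ 2 • q₂ + z ^ 3 • q₃) = 0) : Φ q₀ q₁ + Φ q₁ q₀ = 0 := by
  have key := eq_zero_of_forall_sum_pow_smul_eq_zero (H := ℂ) (n := 7)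
    (a := ![Φ q₀ q₀, Φ q₀ q₁ + Φ q₁ q₀, Φ q₀ q₂ + Φ q₁ q₁ + Φ q₂ q₀,
      Φ q₀ q₃ + Φ q₁ q₂ + Φ q₂ q₁ + Φ q₃ q₀, Φ q₁ q₃ + Φ q₂ q₂ + Φ q₃ q₁,
      Φ q₂ q₃ + Φ q₃ q₂, Φ q₃ q₃]) fun z => by
    rw [← h z]
    simp only [map_add, map_smul, LinearMap.add_apply, LinearMap.smul_apply, Fin.sum_univ_succ,
      Fin.sum_univ_zero, Matrix.cons_val_zero, Matrix.cons_val_succ, Fin.val_zero, Fin.val_succ,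
      smul_eq_mul]
    ring
  exact key 1

theorem coneVector_zero (t : W) : coneVector C 0 t = (0, 0, -(1 / 2 * C t t t), 0) := by
  simp [coneVector]

theorem coneVector_eq_sum (l : ℂ) (t : W) : coneVector C l t =
    (0, 0, -(1 / 2 * C t t t), 0) + l • ((0, 0, 0, -(3 / 2 : ℂ) • C t t) : FrameVector W)
      + l ^ 2 • ((0, -t, 0, 0) : FrameVector W) + l ^ 3 • ((1, 0, 0, 0) : FrameVector W) := by
  refine Prod.ext ?_ (Prod.ext ?_ (Prod.ext ?_ ?_)) <;>
    simp [coneVector, smul_smul, mul_comm]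

theorem frameField_vertical_smul (a : ℂ) (φ : W →ₗ[ℂ] ℂ) (m : J1 d) :
    frameField w c (0, 0, 0, a • φ) m = a • frameField w c (0, 0, 0, φ) m := by
  rw [← Pi.smul_apply, ← map_smul]
  simp

section VerticalTangents

variable {t : W}

theorem frameField_smul_U0_mem_affineTangentSpace (hC : IsSymmetricCubic C) (ht : C t t t ≠ 0)
    (z : ℂ) (m : J1 d) : frameField w c (0, 0, z, 0) m ∈
      affineTangentSpace (subadjointCone C w c m) (fieldV C w c 0 t m) := by
  have h : ((0, 0, z, 0) : FrameVector W) = (-(2 * z / C t t t)) • coneVector C 0 t := by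
    rw [coneVector_zero]
    refine Prod.ext ?_ (Prod.ext ?_ (Prod.ext ?_ ?_)) <;> simp
    field_simp
  rw [h, map_smul, Pi.smul_apply, ← fieldV_eq_frameField hC]
  exact Submodule.smul_mem _ _ (self_mem_affineTangentSpace _ _)

-- `V(0, t)` depends on `t` only through `C t t t`, so it is the value at `z = 0` of all the curves
-- `V(z, t')` with `C t' t' t' = C t t t`.
theorem frameField_adjoint_mem_affineTangentSpace (hC : IsSymmetricCubic C) {t' : W}
    (h : C t' t' t' = C t t t) (m : J1 d) : frameField w c (0, 0, 0, C t' t') m ∈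
      affineTangentSpace (subadjointCone C w c m) (fieldV C w c 0 t m) := by
  have hv : frameField w c (0, 0, 0, -(3 / 2 : ℂ) • C t' t') m =
      (-(3 / 2) : ℂ) • frameField w c (0, 0, 0, C t' t') m :=
    frameField_vertical_smul _ _ m
  refine (Submodule.smul_mem_iff _ (show (-(3 / 2) : ℂ) ≠ 0 by norm_num)).1 (hv ▸ ?_)
  rw [fieldV_eq_frameField hC, coneVector_zero, ← h]
  refine mem_affineTangentSpace_of_cubic (v₂ := frameField w c (0, -t', 0, 0) m)
    (v₃ := frameField w c (1, 0, 0, 0) m) fun z => ?_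
  have hz := fieldV_mem_subadjointCone (C := C) (w := w) (c := c) z t' m
  rw [fieldV_eq_frameField hC, coneVector_eq_sum] at hz
  simpa only [map_add, map_smul, Pi.add_apply, Pi.smul_apply] using hz

theorem smul_frameField_adjoint_mem_affineTangentSpace (hC : IsSymmetricCubic C)
    (ht : C t t t ≠ 0) (t' : W) (m : J1 d) :
    C t' t' t' • frameField w c (0, 0, 0, C t' t') m ∈
      affineTangentSpace (subadjointCone C w c m) (fieldV C w c 0 t m) := by
  by_cases ht' : C t' t' t' = 0
  · rw [ht', zero_smul]
    exact Submodule.zero_mem _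
  obtain ⟨μ, hμ⟩ := IsAlgClosed.exists_pow_nat_eq (C t t t / C t' t' t') three_pos
  have hμ0 : μ ≠ 0 := by
    rintro rfl
    exact div_ne_zero ht ht' (hμ.symm.trans (zero_pow three_ne_zero))
  have h := frameField_adjoint_mem_affineTangentSpace (w := w) (c := c) (t := t) hC
    (t' := μ • t') (by
      simp only [map_smul, LinearMap.smul_apply, smul_eq_mul]
      rw [eq_div_iff ht'] at hμ
      linear_combination hμ) m
  have hsmul : frameField w c (0, 0, 0, C (μ • t') (μ • t')) m =
      (μ * μ) • frameField w c (0, 0, 0, C t' t') m := by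
    rw [← frameField_vertical_smul]
    simp [smul_smul]
  rw [hsmul, Submodule.smul_mem_iff _ (mul_ne_zero hμ0 hμ0)] at h
  exact Submodule.smul_mem _ _ h

theorem frameField_vertical_mem_affineTangentSpace (hC : AdjointsOnNoQuadric C)
    (ht : C t t t ≠ 0) (z : ℂ) (φ : W →ₗ[ℂ] ℂ) (m : J1 d) : frameField w c (0, 0, z, φ) m ∈
      affineTangentSpace (subadjointCone C w c m) (fieldV C w c 0 t m) := by
  have : Module.Finite ℂ W := Module.Finite.of_basis w
  have : Nontrivial W := ⟨t, 0, fun h => ht (by simp [h])⟩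
  set T := affineTangentSpace (subadjointCone C w c m) (fieldV C w c 0 t m)
  let J : (W →ₗ[ℂ] ℂ) →ₗ[ℂ] J1 d :=
    LinearMap.proj m ∘ₗ frameField w c ∘ₗ LinearMap.inr ℂ ℂ _ ∘ₗ LinearMap.inr ℂ W _
      ∘ₗ LinearMap.inr ℂ ℂ _
  have hJ : T.mkQ (J φ) = 0 := hC.linearMap_ext_of_smul (L := T.mkQ ∘ₗ J) (fun t' => by
    rw [← map_smul, LinearMap.comp_apply, map_smul]
    exact (Submodule.Quotient.mk_eq_zero T).2
      (smul_frameField_adjoint_mem_affineTangentSpace hC.toIsSymmetricCubic ht t' m)) φ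
  have hφ : frameField w c (0, 0, 0, φ) m ∈ T := (Submodule.Quotient.mk_eq_zero T).1 hJ
  have hsum : ((0, 0, z, φ) : FrameVector W) = (0, 0, z, 0) + (0, 0, 0, φ) := by simp
  rw [hsum, map_add, Pi.add_apply]
  exact T.add_mem (frameField_smul_U0_mem_affineTangentSpace hC.toIsSymmetricCubic ht z m) hφ

end VerticalTangents

section GeneratingFunction

variable {U : Opens (J1 d)} {f : J1 d → ℂ} (hf : DifferentiableOn ℂ f U)

theorem jetFrame_mk (q : FrameVector W) :
    q.1 • (jetFrame w c U).X0 (HolFun.mk f hf) + (jetFrame w c U).X q.2.1 (HolFun.mk f hf)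
      + q.2.2.1 • (jetFrame w c U).U0 (HolFun.mk f hf)
      + (jetFrame w c U).U q.2.2.2 (HolFun.mk f hf) =
    mk (fun x => fderiv ℂ f x (frameField w c q x))
      (differentiableOn_fderiv_field hf (differentiable_frameField q)) := by
  refine ext_evalAt fun m => ?_
  rw [evalAt_mk, frameField_apply]
  simp only [jetFrame_X0, jetFrame_X, jetFrame_U0, jetFrame_U, derivX0, derivX, derivU0, derivU,
    along_mk, map_add, map_smul, evalAt_mk]

theorem jetFrame_V_mk (l : ℂ) (t : W) : (jetFrame w c U).V C l t (HolFun.mk f hf) =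
    mk (fun x => fderiv ℂ f x (frameField w c (coneVector C l t) x))
      (differentiableOn_fderiv_field hf (differentiable_frameField _)) := by
  rw [← jetFrame_mk hf]
  simp only [ContactFrame.V, coneVector, LinearMap.sub_apply, LinearMap.smul_apply, map_smul]
  module

theorem fieldU_coord (m : J1 d) : fieldU w (w.coord c) m = ddp c.succ := by
  simp [fieldU, Finsupp.single_apply]

theorem evalAt_V_V_add_eq_bracketForm (l : ℂ) (t : W) (m : U) :
    evalAt m ((jetFrame w c U).V C l t ((jetFrame w c U).V C l t (HolFun.mk f hf))
      + (l ^ 5 * w.coord c t) • (jetFrame w c U).U0 (HolFun.mk f hf)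
      + l ^ 6 • (jetFrame w c U).U (w.coord c) (HolFun.mk f hf)) =
    bracketForm w c (contactField f) m (coneVector C l t) (coneVector C l t) := by
  rw [bracketForm_contactField U.isOpen hf m.2, jetFrame_V_mk, jetFrame_V_mk, jetFrame_U0,
    jetFrame_U, derivU0, derivU, along_mk, along_mk]
  simp only [map_add, map_smul, evalAt_mk, fieldU_coord, smul_eq_mul]
  simp only [coneVector, map_smul, smul_eq_mul]
  ring

include hf

theorem exists_frameField_eq_lieBracket {m : J1 d} (hm : m ∈ U) (q : FrameVector W) :
    ∃ q', VectorField.lieBracket ℂ (contactField f) (frameField w c q) m =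
        frameField w c q' m ∧ ∀ r, symplecticForm d (frameField w c q' m) (frameField w c r m) =
        bracketForm w c (contactField f) m q r := by
  obtain ⟨q', hq'⟩ := exists_frameField_eq (w := w) (c := c)
    (isContactField_contactField U.isOpen hf _ (differentiable_frameField q).differentiableOn
      (fun x _ => frameField_mem_contactDist q x) m hm)
  exact ⟨q', hq'.symm, fun r => by rw [hq', bracketForm_apply]⟩

namespace ContactFrame.IsSolution

variable {hf} (h : (jetFrame w c U).IsSolution C (HolFun.mk f hf))
include h

theorem bracketForm_coneVector (l : ℂ) (t : W) {m : J1 d} (hm : m ∈ U) :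
    bracketForm w c (contactField f) m (coneVector C l t) (coneVector C l t) = 0 := by
  rw [← evalAt_V_V_add_eq_bracketForm hf l t ⟨m, hm⟩, h l t, map_zero]

theorem bracketForm_coneVector_coneTangent (hC : IsSymmetricCubic C) (l : ℂ) (t s : W) {m : J1 d}
    (hm : m ∈ U) :
    bracketForm w c (contactField f) m (coneVector C l t) (coneTangent C l t s) = 0 := by
  have hadd := bilinear_apply_add_apply_eq_zero_of_cubic (bracketForm w c (contactField f) m)
    fun z => by
      rw [← coneVector_add hC l z t s]
      exact h.bracketForm_coneVector l _ hm
  have hsub := bracketForm_swap (w := w) (c := c) U.isOpen hf hm (coneVector C l t)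
    (coneTangent C l t s)
  rw [symplecticForm_swap, symplecticForm_coneTangent_coneVector hC, neg_neg, zero_mul] at hsub
  linear_combination hadd / 2 + hsub / 2

theorem lieBracket_fieldV_mem_of_ne_zero (hC : IsSymmetricCubic C) {l : ℂ} (hl : l ≠ 0) (t : W)
    {m : J1 d} (hm : m ∈ U) :
    VectorField.lieBracket ℂ (contactField f) (fieldV C w c l t) m ∈
      affineTangentSpace (subadjointCone C w c m) (fieldV C w c l t m) := by
  obtain ⟨q, hq, hq'⟩ := exists_frameField_eq_lieBracket (w := w) (c := c) hf hm (coneVector C l t)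
  rw [fieldV_eq_frameField hC, hq, ← fieldV_eq_frameField hC]
  refine frameField_mem_affineTangentSpace hC hl t ?_ fun s => ?_
  · rw [hq', h.bracketForm_coneVector l t hm]
  · rw [hq', h.bracketForm_coneVector_coneTangent hC l t s hm]

theorem bracketForm_U0_vertical (hC : AdjointsOnNoQuadric C) {m : J1 d} (hm : m ∈ U)
    (z z' : ℂ) (ψ : W →ₗ[ℂ] ℂ) :
    bracketForm w c (contactField f) m (0, 0, z, 0) (0, 0, z', ψ) = 0 := by
  have : Module.Finite ℂ W := Module.Finite.of_basis w
  have he : w.coord c (w c) = 1 := by simp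
  have hU0 : (jetFrame w c U).U0 (HolFun.mk _ (differentiableOn_fderiv_field hf
      (differentiable_frameField (w := w) (c := c) (0, 0, z', ψ)))) = 0 := by
    rw [← jetFrame_mk hf]
    simp only [map_add, map_smul, map_zero, zero_smul, zero_add, LinearMap.zero_apply]
    rw [h.U0_U0 hC he, (jetFrame w c U).U0_U, h.U_U0 hC he, smul_zero, zero_add]
  rw [jetFrame_U0, derivU0, along_mk] at hU0
  have hm0 := congrArg (evalAt ⟨m, hm⟩) hU0
  rw [evalAt_mk, map_zero] at hm0
  have hz : frameField w c (0, 0, z, 0) m = z • ddp 0 := by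
    simp [frameField_apply, fieldX, fieldU]
  rw [bracketForm_contactField U.isOpen hf hm, hz, map_smul, hm0]
  simp

theorem lieBracket_fieldV_zero_mem (hC : AdjointsOnNoQuadric C) (t : W) {m : J1 d} (hm : m ∈ U) :
    VectorField.lieBracket ℂ (contactField f) (fieldV C w c 0 t) m ∈
      affineTangentSpace (subadjointCone C w c m) (fieldV C w c 0 t m) := by
  have hV : fieldV C w c 0 t = frameField w c (0, 0, -(1 / 2 * C t t t), 0) := by
    rw [fieldV_eq_frameField hC.toIsSymmetricCubic, coneVector_zero]
  by_cases ht : C t t t = 0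
  · have hzero : fieldV C w c 0 t = 0 := by
      rw [hV, ht, mul_zero, neg_zero]
      exact map_zero _
    rw [hzero, VectorField.lieBracket_zero_right]
    exact Submodule.zero_mem _
  obtain ⟨⟨a, b, z, φ⟩, hq, hq'⟩ := exists_frameField_eq_lieBracket (w := w) (c := c) hf hm
    (0, 0, -(1 / 2 * C t t t), 0)
  have hvert : ∀ (z' : ℂ) (ψ : W →ₗ[ℂ] ℂ), a * z' + ψ b = 0 := fun z' ψ => by
    simpa [symplecticForm_frameField, h.bracketForm_U0_vertical hC hm] using hq' (0, 0, z', ψ)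
  have ha : a = 0 := by simpa using hvert 1 0
  have hb : b = 0 :=
    (Module.forall_dual_apply_eq_zero_iff ℂ b).1 fun ψ => by simpa using hvert 0 ψ
  have hS : VectorField.lieBracket ℂ (contactField f) (fieldV C w c 0 t) m =
      frameField w c (0, 0, z, φ) m := by
    rw [hV, hq, ha, hb]
  rw [hS]
  exact frameField_vertical_mem_affineTangentSpace hC ht z φ m

end ContactFrame.IsSolution

omit hf in
theorem continuous_bracketForm_coneVector (S : J1 d → J1 d) (m : J1 d) (t : W) :
    Continuous fun l => bracketForm w c S m (coneVector C l t) (coneVector C l t) := by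
  simp only [coneVector_eq_sum, map_add, map_smul, LinearMap.add_apply,
    LinearMap.smul_apply, smul_eq_mul]
  fun_prop

theorem isSolution_of_isSymmetry_contactField (hC : IsSymmetricCubic C)
    (h : IsSymmetry C w c U (contactField f)) :
    (jetFrame w c U).IsSolution C (HolFun.mk f hf) := fun l t => ext_evalAt fun m => by
  rw [evalAt_V_V_add_eq_bracketForm, map_zero]
  refine congrFun ((continuous_bracketForm_coneVector _ _ t).ext_on (dense_compl_singleton 0)
    continuous_const (g := fun _ => 0) fun l hl => ?_) l
  have hV := symplecticForm_eq_zero_of_mem_affineTangentSpace hC hl t (h.preserves l t m m.2)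
  rwa [fieldV_eq_frameField hC] at hV

theorem isSymmetry_contactField_iff_isSolution (hC : AdjointsOnNoQuadric C) :
    IsSymmetry C w c U (contactField f) ↔ (jetFrame w c U).IsSolution C (HolFun.mk f hf) := by
  refine ⟨isSolution_of_isSymmetry_contactField hf hC.toIsSymmetricCubic, fun h =>
    ⟨differentiableOn_contactField U.isOpen hf, isContactField_contactField U.isOpen hf,
      fun l t m hm => ?_⟩⟩
  rcases eq_or_ne l 0 with rfl | hl
  · exact h.lieBracket_fieldV_zero_mem hC t hm
  · exact h.lieBracket_fieldV_mem_of_ne_zero hC.toIsSymmetricCubic hl t hm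

end GeneratingFunction

theorem IsSymmetry.congr {U : Set (J1 d)} (hU : IsOpen U) {S S' : J1 d → J1 d}
    (h : IsSymmetry C w c U S) (hS : Set.EqOn S' S U) : IsSymmetry C w c U S' := by
  have hb : ∀ Y, ∀ m ∈ U, VectorField.lieBracket ℂ S' Y m = VectorField.lieBracket ℂ S Y m :=
    fun Y m hm => Filter.EventuallyEq.lieBracket_vectorField_eq
      (hS.eventuallyEq_of_mem (hU.mem_nhds hm)) Filter.EventuallyEq.rfl
  refine ⟨h.holomorphic.congr hS, fun Y hY hY' m hm => ?_, fun l t m hm => ?_⟩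
  · rw [hb Y m hm]
    exact h.contact Y hY hY' m hm
  · rw [hb _ m hm]
    exact h.preserves l t m hm

theorem eqOn_contactField_of_eqOn {U : Set (J1 d)} (hU : IsOpen U) {f g : J1 d → ℂ}
    (h : Set.EqOn f g U) : Set.EqOn (contactField f) (contactField g) U := fun m hm => by
  rw [contactField_eq, contactField_eq, (h.eventuallyEq_of_mem (hU.mem_nhds hm)).fderiv_eq, h hm]

theorem isSymmetry_contactField_iff_exists_eqOn (hC : AdjointsOnNoQuadric C) {U : Set (J1 d)}
    (hU : IsOpen U) (hU' : IsConnected U) {f : J1 d → ℂ} (hf : DifferentiableOn ℂ f U) :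
    IsSymmetry C w c U (contactField f) ↔
      ∃ g ∈ Submodule.span ℂ {g | ListedFunction C w c g}, Set.EqOn f g U := by
  refine (isSymmetry_contactField_iff_isSolution (U := ⟨U, hU⟩) hf hC).trans
    ⟨fun h => ?_, fun ⟨g, hg, hfg⟩ => isSolution_of_mem_listedRestrictions
      hC.toIsSymmetricCubic ⟨g, hg, fun m => hfg m.2⟩⟩
  obtain ⟨g, hg, hfg⟩ := h.mem_listedRestrictions hC hU'
  exact ⟨g, hg, fun m hm => hfg ⟨m, hm⟩⟩

theorem differentiableOn_of_mem_span (hC : IsSymmetricCubic C) {U : Set (J1 d)}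
    (hU : IsOpen U) {g : J1 d → ℂ} (hg : g ∈ Submodule.span ℂ {g | ListedFunction C w c g}) :
    DifferentiableOn ℂ g U := by
  obtain ⟨F, -, hFg⟩ := exists_solution_of_mem_span (U := ⟨U, hU⟩) hC hg
  exact (differentiableOn_extend F).congr fun m hm =>
    (hFg ⟨m, hm⟩).symm.trans (extend_apply F ⟨m, hm⟩).symm

end Symmetries

theorem propositionP_general {W : Type*} [AddCommGroup W] [Module ℂ W]
    (C : W →ₗ[ℂ] W →ₗ[ℂ] W →ₗ[ℂ] ℂ) (hC : AdjointsOnNoQuadric C)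
    {d : ℕ} (w : Module.Basis (Fin d) ℂ W) (c : Fin d)
    (U : Set (J1 d)) (hU : IsOpen U) (hU' : IsConnected U) :
    (∀ S : J1 d → J1 d, IsSymmetry C w c U S ↔
      ∃ f ∈ Submodule.span ℂ {g | ListedFunction C w c g}, Set.EqOn S (contactField f) U) ∧
    (∀ f : J1 d → ℂ, DifferentiableOn ℂ f U →
      (IsSymmetry C w c U (contactField f) ↔
        ∃ g ∈ Submodule.span ℂ {g | ListedFunction C w c g}, Set.EqOn f g U)) := by
  refine ⟨fun S => ⟨fun hS => ?_, fun ⟨f, hf, hSf⟩ => ?_⟩,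
    fun f hf => isSymmetry_contactField_iff_exists_eqOn hC hU hU' hf⟩
  · obtain ⟨f, hf, hSf⟩ := hS.contact.exists_eqOn_contactField hU hS.holomorphic
    obtain ⟨g, hg, hfg⟩ := (isSymmetry_contactField_iff_exists_eqOn hC hU hU' hf).1
      (hS.congr hU hSf.symm)
    exact ⟨g, hg, hSf.trans (eqOn_contactField_of_eqOn hU hfg)⟩
  · have hf' := differentiableOn_of_mem_span hC.toIsSymmetricCubic hU hf
    exact ((isSymmetry_contactField_iff_exists_eqOn hC hU hU' hf').2
      ⟨f, hf, Set.eqOn_refl f U⟩).congr hU hSf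

theorem propositionP {W : Type*} [AddCommGroup W] [Module ℂ W]
    (C : W →ₗ[ℂ] W →ₗ[ℂ] W →ₗ[ℂ] ℂ) (hC : IsJordanCubicForm C)
    {d : ℕ} (w : Module.Basis (Fin d) ℂ W) (c : Fin d)
    (U : Set (J1 d)) (hU : IsOpen U) (hU' : IsConnected U) :
    (∀ S : J1 d → J1 d, IsSymmetry C w c U S ↔
      ∃ f ∈ Submodule.span ℂ {g | ListedFunction C w c g}, Set.EqOn S (contactField f) U) ∧
    (∀ f : J1 d → ℂ, DifferentiableOn ℂ f U →
      (IsSymmetry C w c U (contactField f) ↔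
        ∃ g ∈ Submodule.span ℂ {g | ListedFunction C w c g}, Set.EqOn f g U)) :=
  propositionP_general C hC.adjointsOnNoQuadric w c U hU hU'
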